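/- \textbf{Setting.} Let $\mathrm R$ be a finite spherical root system (not necessarily crystallographic), $F\subseteq\mathbb R$ a subfield containing all numbers $\langle\beta,\alpha^\vee\rangle$ ($\alpha,\beta\in\mathrm R$), and $\Lambda$ a totally ordered abelian group that is an ordered $F$-vector space. The model space is $\mathbb S=\mathrm{span}_F(\mathrm R)\otimes_F\Lambda$; the spherical Weyl group $\overline W$ acts on it and each $\langle\cdot,\alpha^\vee\rangle$ extends to a map $\mathbb S\to\Lambda$. Fix a basis $B$ of $\mathrm R$ with positive roots $\mathrm R^+$, put $C=\{u\in\mathbb S:\langle u,\alpha^\vee\rangle\ge 0\ \forall\alpha\in\mathrm R^+\}$ and $d(u,v)=\sum_{\alpha\in\mathrm R^+}|\langle v-u,\alpha^\vee\rangle|$. Let $T\ne 0$ be a $\overline W$-invariant subgroup of $\mathbb S$, acting by translations, and $\overline WT=\overline W\ltimes T$. Half-apartments of $\mathbb S$ are the sets $\{u:\langle u,\alpha^\vee\rangle\ge l\}$ ($\alpha\in \mathrm R$, $l\in\Lambda$); such a set is special if $\alpha\otimes l\in T$. A subset of $\mathbb S$ is convex if it is an intersection of finitely many special half-apartments. Weyl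 chambers of $\mathbb S$ are the sets $k+wC$ ($k\in\mathbb S$, $w\in\overline W$), with base point $k$; Weyl simplices are their faces $k+w\{u\in C:\langle u,\alpha^\vee\rangle=0\ \forall\alpha\in J\}$, $J\subseteq B$ (panels: $|J|=1$). A generalized affine building $(X,\mathcal A)$ modeled on $(\mathrm R,\Lambda,T)$ is a set $X$ with a set $\mathcal A$ of injective charts $f:\mathbb S\to X$ (their images are the apartments; Weyl simplices, half-apartments, base points of $X$ are the images of those of $\mathbb S$) such that: (A1) $f\circ w\in\mathcal A$ for $f\in\mathcal A$, $w\in\overline WT$; (A2) if $f(\mathbb S)\cap g(\mathbb S)\neq\emptyset$, then $f^{-1}(g(\mathbb S))$ is closed and convex and $f=g\circ w$ on it for some $w\in\overline WT$; (A3) any two points lie in a common apartment (hence $d$ induces a distance on $X$, computed in any chart containing both points); (A4) any two Weyl chambers contain Weyl chambers $S_1',S_2'$ with $S_1'\cup S_2'$ contained in one apartment; (A5) for every apartment $A$ and $x\in A$ there is a distance non-increasing retraction $r:X\to A$ with $r^{-1}(x)=\{x\}$; (A6) three apartments which pairwise intersect in half-apartments have a common point. The simplices of the spherical building at infinity $\partial_{\mathcal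 A}X$ are the parallel classes $\partial S$ of Weyl simplices $S$ of $X$ (parallel means at bounded distance). The simplices of $\partial A$, for an apartment $A$, are the classes of Weyl simplices contained in $A$. The simplices of the residue $\Delta_xX$ at $x\in X$ are the germs $\Delta_xS$ of Weyl simplices $S$ based at $x$, where $S,S'$ based at $x$ have the same germ if $S\cap S'$ is a neighbourhood of $x$ in $S$ and in $S'$. In both cases the chambers are the classes of Weyl chambers; one simplex is a face of another if they have representatives in a common apartment, with the same base point ($x$, in the case of $\Delta_xX$), one being a face of the other; two distinct chambers are adjacent if they have representatives in a common apartment, with the same base point, which are distinct Weyl chambers sharing a panel; and two chambers are opposite if they have representatives in a common apartment, with the same base point, which are opposite there (of the form $k+wC$ and $k-wC$ in a chart). \textbf{Theorem.} Let $(X,\mathcal A)$ be a generalized affine building as above. (0) For every $x\in X$, every simplex $a$ of $\partial_{\mathcal A}X$ contains exactly one Weyl simplex $S$ based at $x$. So $\pi_x(a)=\Delta_xS$ is a well-defined map $\pi_x$ from the simplices of $\partial_{\mathcal A}X$ to those of $\Delta_xX$. (1) Let $A$ be an apartment of $X$ and let $c,d$ be opposite chambers in $\partial A$. Then for every $x\in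 X$: $x\in A$ if and only if $\pi_x(c)$ and $\pi_x(d)$ are opposite in $\Delta_xX$. (2) Let $A$ be an apartment of $X$ and $x\in A$. Then the restriction of $\pi_x$ to $\partial A$ is an isomorphism onto its image: it is injective, and for simplices $a,b$ of $\partial A$, $a$ is a chamber iff $\pi_x(a)$ is; $a$ is a face of $b$ iff $\pi_x(a)$ is a face of $\pi_x(b)$; and $a,b$ are adjacent chambers iff $\pi_x(a),\pi_x(b)$ are. -/

import Mathlib

open scoped TensorProduct

noncomputable section

namespace AffBuilding

/-! ### The model space

`F` is a subfield of `ℝ`, `P` a finite root system over `F` (not necessarily crystallographic) living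
in the `F`-vector space `M = span_F(R)`, and `Λ` a totally ordered abelian group which is an ordered
`F`-vector space. -/

section Model

variable {ι : Type*} {F : Subfield ℝ} {M N Λ : Type*}
  [AddCommGroup M] [Module F M] [AddCommGroup N] [Module F N]
  [AddCommGroup Λ] [LinearOrder Λ] [Module F Λ]

/-- The model space `span_F(R) ⊗_F Λ`. -/
abbrev ModelSpace (F : Subfield ℝ) (M Λ : Type*) [AddCommGroup M] [Module F M]
    [AddCommGroup Λ] [Module F Λ] : Type _ := M ⊗[F] Λ

/-- The cone of non-negative `F`-linear combinations of the roots with index in `B`. -/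
def posCone (P : RootPairing ι F M N) (B : Set ι) : Submodule {c : F // 0 ≤ c} M :=
  Submodule.span {c : F // 0 ≤ c} (P.root '' B)

/-- `B` indexes a basis (a simple system) of the root system: the roots in `B` are linearly
independent and every root is a non-negative or a non-positive combination of them. -/
structure IsBasis (P : RootPairing ι F M N) (B : Set ι) : Prop where
  linearIndepOn : LinearIndepOn F P.root B
  pos_or_neg : ∀ i, P.root i ∈ posCone P B ∨ -P.root i ∈ posCone P B

/-- The (indices of the) positive roots determined by `B`. -/
def posRoots (P : RootPairing ι F M N) (B : Set ι) : Set ι := {i | P.root i ∈ posCone P B}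

/-- The `Λ`-valued evaluation `u ↦ ⟨u, α∨⟩` for `α` the root with index `i`; on pure tensors
`v ⊗ l ↦ ⟨v, α∨⟩ • l`. -/
def ev (P : RootPairing ι F M N) (i : ι) : ModelSpace F M Λ →ₗ[F] Λ :=
  (TensorProduct.lid F Λ).toLinearMap ∘ₗ LinearMap.rTensor Λ (P.coroot' i)

/-- The reflection `r_α` of the model space; on pure tensors `v ⊗ l ↦ s_α(v) ⊗ l`. -/
def reflect (P : RootPairing ι F M N) (Λ : Type*) [AddCommGroup Λ] [Module F Λ] (i : ι) :
    ModelSpace F M Λ ≃ₗ[F] ModelSpace F M Λ :=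
  TensorProduct.congr (P.reflection i) (LinearEquiv.refl F Λ)

/-- The spherical Weyl group acting on the model space. -/
def weyl (P : RootPairing ι F M N) (Λ : Type*) [AddCommGroup Λ] [Module F Λ] :
    Subgroup (ModelSpace F M Λ ≃ₗ[F] ModelSpace F M Λ) :=
  Subgroup.closure (Set.range (reflect P Λ))

/-- A non-trivial group of translations of the model space normalized by the spherical Weyl group;
the translation by `t` is identified with the image `t` of the origin. -/
structure IsTranslationGroup (P : RootPairing ι F M N) (T : AddSubgroup (ModelSpace F M Λ)) :
    Prop where
  ne_bot : T ≠ ⊥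
  weyl_mem : ∀ w ∈ weyl P Λ, ∀ t ∈ T, w t ∈ T

/-- The affine Weyl group with translation part `T`, as a set of self-maps of the model space. The
full affine Weyl group is the case `T = ⊤`. -/
def affineWeyl (P : RootPairing ι F M N) (T : AddSubgroup (ModelSpace F M Λ)) :
    Set (ModelSpace F M Λ → ModelSpace F M Λ) :=
  {φ | ∃ w ∈ weyl P Λ, ∃ t ∈ T, φ = fun u => w u + t}

/-- The distance `d(u, v) = ∑_{α > 0} |⟨v - u, α∨⟩|` on the model space. -/
def mdist (P : RootPairing ι F M N) (B : Set ι) (u v : ModelSpace F M Λ) : Λ :=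
  ∑ᶠ i ∈ posRoots P B, |ev P i (v - u)|

/-- The half-apartment `{u | l ≤ ⟨u, α∨⟩}`. Replacing `(α, l)` by `(-α, -l)` gives the other
half-apartment with the same bounding hyperplane. -/
def halfSpace (P : RootPairing ι F M N) (i : ι) (l : Λ) : Set (ModelSpace F M Λ) :=
  {u | l ≤ ev P i u}

/-- Half-apartments of the model space. -/
def IsHalfApartment (P : RootPairing ι F M N) (H : Set (ModelSpace F M Λ)) : Prop :=
  ∃ i l, H = halfSpace P i l

/-- Half-apartments which are special with respect to `T`: the bounding hyperplane
`{u | ⟨u, α∨⟩ = l}` is the fixed point set of the reflection `u ↦ r_α(u) + α ⊗ l`, and this reflection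
belongs to the affine Weyl group of `T` if and only if `α ⊗ l ∈ T`. -/
def IsSpecialHalfApartment (P : RootPairing ι F M N) (T : AddSubgroup (ModelSpace F M Λ))
    (H : Set (ModelSpace F M Λ)) : Prop :=
  ∃ i l, P.root i ⊗ₜ[F] l ∈ T ∧ H = halfSpace P i l

/-- Convex subsets of the model space: intersections of finitely many special half-apartments. -/
def IsConvex (P : RootPairing ι F M N) (T : AddSubgroup (ModelSpace F M Λ))
    (Y : Set (ModelSpace F M Λ)) : Prop :=
  ∃ 𝓗 : Set (Set (ModelSpace F M Λ)),
    𝓗.Finite ∧ (∀ H ∈ 𝓗, IsSpecialHalfApartment P T H) ∧ Y = ⋂₀ 𝓗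

/-- Closed subsets with respect to the `Λ`-valued metric of the model space. -/
def IsMClosed (P : RootPairing ι F M N) (B : Set ι) (Y : Set (ModelSpace F M Λ)) : Prop :=
  ∀ u ∉ Y, ∃ ε : Λ, 0 < ε ∧ ∀ v, mdist P B u v < ε → v ∉ Y

/-- The face of the fundamental Weyl chamber cut out by the simple roots in `J ⊆ B`. For `J = ∅` this
is the fundamental Weyl chamber, for `J` a singleton a panel, for `J = B` the origin. -/
def face (P : RootPairing ι F M N) (B J : Set ι) : Set (ModelSpace F M Λ) :=
  {u | (∀ i ∈ posRoots P B, 0 ≤ ev P i u) ∧ ∀ j ∈ J, ev P j u = 0}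

/-- The image of a set (usually a face of the fundamental chamber) under the element `u ↦ w u + k` of
the full affine Weyl group. -/
def place (w : ModelSpace F M Λ ≃ₗ[F] ModelSpace F M Λ) (k : ModelSpace F M Λ)
    (Y : Set (ModelSpace F M Λ)) : Set (ModelSpace F M Λ) :=
  (fun u => w u + k) '' Y

end Model

/-! ### Generalized affine buildings -/

section Building

variable {ι : Type*} {F : Subfield ℝ} {M N Λ : Type*}
  [AddCommGroup M] [Module F M] [AddCommGroup N] [Module F N]
  [AddCommGroup Λ] [LinearOrder Λ] [Module F Λ]
  {X : Type*}

open Classical in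
/-- The distance on `X`: the distance of the preimages under a chart of an apartment containing both
points. (Independent of the chart by axiom (A2); a chart exists by axiom (A3).) -/
def bdist (P : RootPairing ι F M N) (B : Set ι) (𝒜 : Set (ModelSpace F M Λ → X)) (x y : X) : Λ :=
  if h : ∃ l : Λ, ∃ f ∈ 𝒜, ∃ u v, f u = x ∧ f v = y ∧ l = mdist P B u v then h.choose else 0

/-- `S` is a Weyl simplex of `X` of type `J ⊆ B`, based at `x`: the image under a chart of a
simplex `w F_J + k` of the model space with `k` mapped to `x`. -/
def IsWeylSimplexAt (P : RootPairing ι F M N) (B : Set ι) (𝒜 : Set (ModelSpace F M Λ → X))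
    (J : Set ι) (x : X) (S : Set X) : Prop :=
  J ⊆ B ∧ ∃ f ∈ 𝒜, ∃ w ∈ weyl P Λ, ∃ k, f k = x ∧ S = f '' place w k (face P B J)

/-- Weyl chambers of `X` (with some base point). -/
def IsWeylChamber (P : RootPairing ι F M N) (B : Set ι) (𝒜 : Set (ModelSpace F M Λ → X))
    (S : Set X) : Prop :=
  ∃ x, IsWeylSimplexAt P B 𝒜 ∅ x S

/-- `(X, 𝒜)` is a generalized affine building modeled on `(R, Λ, T)`. -/
structure IsAffineBuilding (P : RootPairing ι F M N) (B : Set ι)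
    (T : AddSubgroup (ModelSpace F M Λ)) (𝒜 : Set (ModelSpace F M Λ → X)) : Prop where
  injective : ∀ f ∈ 𝒜, Function.Injective f
  /-- (A1) -/
  comp_mem : ∀ f ∈ 𝒜, ∀ φ ∈ affineWeyl P T, f ∘ φ ∈ 𝒜
  /-- (A2), first part -/
  convex : ∀ f ∈ 𝒜, ∀ g ∈ 𝒜, (Set.range f ∩ Set.range g).Nonempty →
    IsMClosed P B (f ⁻¹' Set.range g) ∧ IsConvex P T (f ⁻¹' Set.range g)
  /-- (A2), second part -/
  transition : ∀ f ∈ 𝒜, ∀ g ∈ 𝒜, (Set.range f ∩ Set.range g).Nonempty →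
    ∃ φ ∈ affineWeyl P T, Set.EqOn f (g ∘ φ) (f ⁻¹' Set.range g)
  /-- (A3) -/
  exists_chart : ∀ x y : X, ∃ f ∈ 𝒜, x ∈ Set.range f ∧ y ∈ Set.range f
  /-- (A4) -/
  exists_subchambers : ∀ S₁ S₂ : Set X, IsWeylChamber P B 𝒜 S₁ → IsWeylChamber P B 𝒜 S₂ →
    ∃ S₁' S₂' : Set X, IsWeylChamber P B 𝒜 S₁' ∧ IsWeylChamber P B 𝒜 S₂' ∧
      S₁' ⊆ S₁ ∧ S₂' ⊆ S₂ ∧ ∃ f ∈ 𝒜, S₁' ∪ S₂' ⊆ Set.range f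
  /-- (A5) -/
  exists_retraction : ∀ f ∈ 𝒜, ∀ x ∈ Set.range f, ∃ r : X → X,
    (∀ y, r y ∈ Set.range f) ∧ (∀ y ∈ Set.range f, r y = y) ∧
    (∀ y z, bdist P B 𝒜 (r y) (r z) ≤ bdist P B 𝒜 y z) ∧ r ⁻¹' {x} = {x}
  /-- (A6) -/
  inter_nonempty : ∀ f ∈ 𝒜, ∀ g ∈ 𝒜, ∀ h ∈ 𝒜,
    (∃ H, IsHalfApartment P H ∧ Set.range f ∩ Set.range g = f '' H) →
    (∃ H, IsHalfApartment P H ∧ Set.range g ∩ Set.range h = g '' H) →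
    (∃ H, IsHalfApartment P H ∧ Set.range f ∩ Set.range h = f '' H) →
    (Set.range f ∩ Set.range g ∩ Set.range h).Nonempty

/-! ### Relations between Weyl simplices with the same base point -/

/-- `S₁` is a face of `S₂` (both in a common apartment and based at `x`). -/
def IsFaceAt (P : RootPairing ι F M N) (B : Set ι) (𝒜 : Set (ModelSpace F M Λ → X))
    (x : X) (S₁ S₂ : Set X) : Prop :=
  ∃ f ∈ 𝒜, ∃ w ∈ weyl P Λ, ∃ k, f k = x ∧ ∃ J₁ J₂ : Set ι, J₂ ⊆ J₁ ∧ J₁ ⊆ B ∧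
    S₁ = f '' place w k (face P B J₁) ∧ S₂ = f '' place w k (face P B J₂)

/-- `S₁` and `S₂` are adjacent Weyl chambers of a common apartment, based at `x`: they are distinct
and have a panel in common. -/
def IsAdjacentAt (P : RootPairing ι F M N) (B : Set ι) (𝒜 : Set (ModelSpace F M Λ → X))
    (x : X) (S₁ S₂ : Set X) : Prop :=
  S₁ ≠ S₂ ∧ ∃ f ∈ 𝒜, ∃ w₁ ∈ weyl P Λ, ∃ w₂ ∈ weyl P Λ, ∃ k, f k = x ∧
    S₁ = f '' place w₁ k (face P B ∅) ∧ S₂ = f '' place w₂ k (face P B ∅) ∧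
    ∃ i ∈ B, ∃ j ∈ B, place w₁ k (face P B {i}) = place w₂ k (face P B {j})

/-- `S₁` and `S₂` are opposite Weyl chambers of a common apartment, based at `x`: in a chart they are
`k + w C` and `k - w C` with `C` the fundamental chamber (the longest element of the Weyl group maps
`C` to `-C`). -/
def IsOppositeAt (P : RootPairing ι F M N) (B : Set ι) (𝒜 : Set (ModelSpace F M Λ → X))
    (x : X) (S₁ S₂ : Set X) : Prop :=
  ∃ f ∈ 𝒜, ∃ w ∈ weyl P Λ, ∃ k, f k = x ∧
    S₁ = f '' place w k (face P B ∅) ∧ S₂ = f '' place w k {u | -u ∈ face P B ∅}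

/-! ### The building at infinity -/

/-- Two subsets of `X` are parallel if they are at bounded distance. -/
def Parallel (P : RootPairing ι F M N) (B : Set ι) (𝒜 : Set (ModelSpace F M Λ → X))
    (S S' : Set X) : Prop :=
  ∃ b : Λ, (∀ x ∈ S, ∃ y ∈ S', bdist P B 𝒜 x y ≤ b) ∧ (∀ y ∈ S', ∃ x ∈ S, bdist P B 𝒜 y x ≤ b)

/-- The parallel class `∂S` of a Weyl simplex `S`. -/
def parClass (P : RootPairing ι F M N) (B : Set ι) (𝒜 : Set (ModelSpace F M Λ → X))
    (S : Set X) : Set (Set X) :=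
  {S' | (∃ J x, IsWeylSimplexAt P B 𝒜 J x S') ∧ Parallel P B 𝒜 S S'}

/-- The simplices of the building at infinity: parallel classes of Weyl simplices of `X`. -/
def infSimplices (P : RootPairing ι F M N) (B : Set ι) (𝒜 : Set (ModelSpace F M Λ → X)) :
    Set (Set (Set X)) :=
  {a | ∃ J x S, IsWeylSimplexAt P B 𝒜 J x S ∧ a = parClass P B 𝒜 S}

/-- The chambers of the building at infinity: parallel classes of Weyl chambers of `X`. -/
def infChambers (P : RootPairing ι F M N) (B : Set ι) (𝒜 : Set (ModelSpace F M Λ → X)) :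
    Set (Set (Set X)) :=
  {a | ∃ S, IsWeylChamber P B 𝒜 S ∧ a = parClass P B 𝒜 S}

/-- The simplices of the apartment `∂A`: parallel classes of Weyl simplices contained in `A`. -/
def boundary (P : RootPairing ι F M N) (B : Set ι) (𝒜 : Set (ModelSpace F M Λ → X))
    (A : Set X) : Set (Set (Set X)) :=
  {a | ∃ J x S, IsWeylSimplexAt P B 𝒜 J x S ∧ S ⊆ A ∧ a = parClass P B 𝒜 S}

/-- The face relation of the building at infinity. -/
def InfLE (P : RootPairing ι F M N) (B : Set ι) (𝒜 : Set (ModelSpace F M Λ → X))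
    (a b : Set (Set X)) : Prop :=
  ∃ x S₁ S₂, IsFaceAt P B 𝒜 x S₁ S₂ ∧ a = parClass P B 𝒜 S₁ ∧ b = parClass P B 𝒜 S₂

/-- Adjacency of chambers at infinity. -/
def InfAdj (P : RootPairing ι F M N) (B : Set ι) (𝒜 : Set (ModelSpace F M Λ → X))
    (c d : Set (Set X)) : Prop :=
  c ≠ d ∧ ∃ x S₁ S₂, IsAdjacentAt P B 𝒜 x S₁ S₂ ∧ c = parClass P B 𝒜 S₁ ∧ d = parClass P B 𝒜 S₂

/-- Opposite chambers at infinity: they are opposite in some apartment. -/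
def InfOpp (P : RootPairing ι F M N) (B : Set ι) (𝒜 : Set (ModelSpace F M Λ → X))
    (c d : Set (Set X)) : Prop :=
  ∃ x S₁ S₂, IsOppositeAt P B 𝒜 x S₁ S₂ ∧ c = parClass P B 𝒜 S₁ ∧ d = parClass P B 𝒜 S₂

/-! ### The residue at a point -/

/-- `S ∩ S'` is a neighborhood of `x` in `S` and in `S'`. -/
def SameGerm (P : RootPairing ι F M N) (B : Set ι) (𝒜 : Set (ModelSpace F M Λ → X))
    (x : X) (S S' : Set X) : Prop :=
  ∃ ε : Λ, 0 < ε ∧ (∀ y ∈ S, bdist P B 𝒜 x y < ε → y ∈ S') ∧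
    (∀ y ∈ S', bdist P B 𝒜 x y < ε → y ∈ S)

/-- The germ `Δ_x S`: the class of all Weyl simplices based at `x` sharing the germ of `S`. -/
def germ (P : RootPairing ι F M N) (B : Set ι) (𝒜 : Set (ModelSpace F M Λ → X))
    (x : X) (S : Set X) : Set (Set X) :=
  {S' | (∃ J, IsWeylSimplexAt P B 𝒜 J x S') ∧ SameGerm P B 𝒜 x S S'}

/-- The simplices of the residue `Δ_x X`: germs at `x` of Weyl simplices based at `x`. -/
def resSimplices (P : RootPairing ι F M N) (B : Set ι) (𝒜 : Set (ModelSpace F M Λ → X))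
    (x : X) : Set (Set (Set X)) :=
  {μ | ∃ J S, IsWeylSimplexAt P B 𝒜 J x S ∧ μ = germ P B 𝒜 x S}

/-- The chambers of the residue `Δ_x X`: germs at `x` of Weyl chambers based at `x`. -/
def resChambers (P : RootPairing ι F M N) (B : Set ι) (𝒜 : Set (ModelSpace F M Λ → X))
    (x : X) : Set (Set (Set X)) :=
  {μ | ∃ S, IsWeylSimplexAt P B 𝒜 ∅ x S ∧ μ = germ P B 𝒜 x S}

/-- The face relation of the residue. -/
def ResLE (P : RootPairing ι F M N) (B : Set ι) (𝒜 : Set (ModelSpace F M Λ → X))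
    (x : X) (μ ν : Set (Set X)) : Prop :=
  ∃ S₁ S₂, IsFaceAt P B 𝒜 x S₁ S₂ ∧ μ = germ P B 𝒜 x S₁ ∧ ν = germ P B 𝒜 x S₂

/-- Adjacency of chambers of the residue. -/
def ResAdj (P : RootPairing ι F M N) (B : Set ι) (𝒜 : Set (ModelSpace F M Λ → X))
    (x : X) (μ ν : Set (Set X)) : Prop :=
  μ ≠ ν ∧ ∃ S₁ S₂, IsAdjacentAt P B 𝒜 x S₁ S₂ ∧ μ = germ P B 𝒜 x S₁ ∧ ν = germ P B 𝒜 x S₂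

/-- Opposite chambers of the residue: they are opposite in some apartment of the residue. -/
def ResOpp (P : RootPairing ι F M N) (B : Set ι) (𝒜 : Set (ModelSpace F M Λ → X))
    (x : X) (μ ν : Set (Set X)) : Prop :=
  ∃ S₁ S₂, IsOppositeAt P B 𝒜 x S₁ S₂ ∧ μ = germ P B 𝒜 x S₁ ∧ ν = germ P B 𝒜 x S₂

/-- `S` is the representative based at `x` of the simplex `a` at infinity. -/
def IsRepAt (P : RootPairing ι F M N) (B : Set ι) (𝒜 : Set (ModelSpace F M Λ → X))
    (x : X) (a : Set (Set X)) (S : Set X) : Prop :=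
  S ∈ a ∧ ∃ J, IsWeylSimplexAt P B 𝒜 J x S

/-- The projection `π_x`: the germ `Δ_x S` of the representative `S` of `a` based at `x` (the union
is over the single such `S`). -/
def proj (P : RootPairing ι F M N) (B : Set ι) (𝒜 : Set (ModelSpace F M Λ → X))
    (x : X) (a : Set (Set X)) : Set (Set X) :=
  {S' | ∃ S, IsRepAt P B 𝒜 x a S ∧ S' ∈ germ P B 𝒜 x S}

end Building

end AffBuilding

end

/-! A chart `f` stands for the chamber at infinity of `f(C)`, and `Asy f g` says that two charts
give the same one. By (A4) any two such chambers lie in the boundary of one apartment, and (A2)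
makes their relative position there a well-defined Weyl group element, recorded by `Delta`. The main
property of this distance is `delta_fixed`: if two chambers share a face, their distances from a
third chamber agree on that face. The reason is metric. Points running off to infinity in directions
`e` and `w • q` separate like `‖e - w • q‖ • l` up to a bounded error, and `eq_of_rnorm_eq` recovers
`w • q` from these norms. For a panel this gives `delta_adjacent`, so galleries can be used at
infinity as in a spherical building.

Let the chamber of `g` be adjacent to that of `f` but not in the boundary of the apartment `A` of
`f`. Two apartments contain the chamber of `g` at infinity together with a half of `A`, one for each
side of a wall direction, and (A6) forces the two halves to cover `A` (`exists_branches`). So each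
point of `A` shares an apartment with that chamber. Moving along a gallery, every chamber at
infinity gets a representative at every point, and faces common at infinity stay common
(`exists_chamber_at`). Uniqueness of representatives comes from convexity: an overlap of apartments
containing a subchamber contains the parallel chamber at each of its points (`asy_eq`).

For (1), let `c` and `d` be opposite and follow the germ at `x` of the representative of `c` along a
minimal gallery to `d`. By `exists_chamber_germ`, either that whole representative lies in an
apartment with `d`, or its germ has, in some apartment, a position relative to `d` strictly shorter
than the longest element. Opposite germs exclude the second case. In the first, an apartment through
`x` contains `c` and `d`; since no half-apartment contains subchambers of opposite directions, (A2)
puts this apartment inside `A`.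

For (2), germs are compared through the transition maps at `x`: a Weyl group element matching small
pieces of two faces preserves the type and fixes the face pointwise (`germ_sx_eq`). So any
configuration of germs at `x` can be moved into `A`, where it is the configuration of the simplices
at infinity. -/

set_option linter.unusedSectionVars false

noncomputable section

namespace AffBuilding

/-! ### Positive roots and the Weyl group -/

section Roots

open RootPairing

variable {ι : Type*} {F : Subfield ℝ} {M N : Type*}
  [AddCommGroup M] [Module F M] [AddCommGroup N] [Module F N]
  {P : RootPairing ι F M N} {B : Set ι}

/-- The index of the negative of a root. -/
def neg (P : RootPairing ι F M N) (i : ι) : ι := P.reflectionPerm i i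

@[simp] lemma root_neg (i : ι) : P.root (neg P i) = -P.root i := by
  simp [neg, P.root_reflectionPerm]

@[simp] lemma coroot_neg (i : ι) : P.coroot (neg P i) = -P.coroot i := by
  simp [neg, P.coroot_reflectionPerm]

@[simp] lemma coroot'_neg (i : ι) : P.coroot' (neg P i) = -P.coroot' i := by
  simp [RootPairing.coroot']

@[simp] lemma neg_neg' (i : ι) : neg P (neg P i) = i := by
  apply P.root.injective; simp

/-- The reflection with index `i` as an element of the Weyl group. -/
def refl (P : RootPairing ι F M N) (i : ι) : P.weylGroup := weylGroup.ofIdx P i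

lemma refl_smul (i : ι) (m : M) : refl P i • m = m - P.coroot' i m • P.root i := by
  change P.reflection i m = _
  rw [P.reflection_apply]

lemma root_smul (g : P.weylGroup) (i : ι) : P.root (g • i) = g • P.root i := by
  rw [weylGroup_apply_root]; rfl

lemma weyl_ext {g h : P.weylGroup} (H : ∀ m : M, g • m = h • m) : g = h := by
  apply Subtype.ext
  apply Equiv.weightHom_injective P
  ext m
  exact H m

lemma coroot'_smul (g : P.weylGroup) (i : ι) (m : M) :
    P.coroot' (g • i) (g • m) = P.coroot' i m := by
  obtain ⟨g, hg⟩ := g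
  change P.coroot' (g • i) (g • m) = P.coroot' i m
  induction hg using weylGroup.induction generalizing i m with
  | mem j =>
    change P.coroot' (P.reflectionPerm j i) (P.reflection j m) = _
    rw [P.coroot'_reflectionPerm]
    simp
  | one => simp
  | mul x y hx hy h1 h2 => rw [mul_smul, mul_smul, h1, h2]

lemma coroot'_smul_left (g : P.weylGroup) (i : ι) (m : M) :
    P.coroot' (g • i) m = P.coroot' i (g⁻¹ • m) := by
  rw [← coroot'_smul g i, smul_inv_smul]

lemma coroot'_smul_right (g : P.weylGroup) (i : ι) (m : M) :
    P.coroot' i (g • m) = P.coroot' (g⁻¹ • i) m := by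
  rw [coroot'_smul_left, inv_inv]

lemma refl_smul_idx_self (i : ι) : refl P i • i = neg P i := rfl

lemma smul_neg (g : P.weylGroup) (i : ι) : g • neg P i = neg P (g • i) := by
  apply P.root.injective; simp [root_smul]

@[simp] lemma refl_mul_self (i : ι) : refl P i * refl P i = 1 := by
  apply weyl_ext; intro m
  rw [mul_smul, one_smul]
  exact P.reflection_same i m

@[simp] lemma refl_inv (i : ι) : (refl P i)⁻¹ = refl P i :=
  inv_eq_of_mul_eq_one_left (refl_mul_self i)

@[simp] lemma refl_refl_smul {α : Type*} [MulAction P.weylGroup α] (i : ι) (a : α) :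
    refl P i • refl P i • a = a := by
  rw [← mul_smul, refl_mul_self, one_smul]

instance : SMulCommClass F P.weylGroup M :=
  ⟨fun c g m => (smul_comm (g : P.Aut) c m).symm⟩

lemma refl_smul_index (g : P.weylGroup) (i : ι) : refl P (g • i) = g * refl P i * g⁻¹ := by
  apply weyl_ext; intro m
  rw [mul_smul, mul_smul, refl_smul, refl_smul, smul_sub, smul_inv_smul, coroot'_smul_left,
    root_smul, smul_comm g]

lemma coroot'_root_self (i : ι) : P.coroot' i (P.root i) = 2 := P.root_coroot_two i

lemma coroot'_ne_zero (i : ι) : P.coroot' i ≠ 0 := fun h => by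
  have := coroot'_root_self (P := P) i
  rw [h] at this
  simp at this

variable [Finite ι]

lemma coroot'_of_root_smul {i j : ι} {c : F} (hc : c ≠ 0) (h : P.root i = c • P.root j) :
    P.coroot' i = c⁻¹ • P.coroot' j := by
  have hN : IsAddTorsionFree N := IsAddTorsionFree.of_isTorsionFree F N
  have := P.smul_coroot_eq_of_root_eq_smul j i c h
  rw [RootPairing.coroot', RootPairing.coroot', ← this, map_smul, smul_smul, inv_mul_cancel₀ hc, one_smul]

/-- The root system need not be reduced, so several roots can be proportional to a simple one. This
lemma makes that harmless: the scalars of root and coroot cancel in the reflection. -/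
lemma refl_eq_of_root_smul {i j : ι} {c : F} (hc : c ≠ 0) (h : P.root i = c • P.root j) :
    refl P i = refl P j := by
  apply weyl_ext; intro m
  rw [refl_smul, refl_smul, coroot'_of_root_smul hc h, h]
  simp only [LinearMap.smul_apply, smul_smul, smul_eq_mul]
  congr 2
  field_simp

lemma rootForm_self_pos (i : ι) : 0 < (letI := Fintype.ofFinite ι; P.RootForm (P.root i) (P.root i)) := by
  let _ := Fintype.ofFinite ι
  rw [P.rootForm_root_self]
  have : (0:F) < P.pairing i i * P.pairing i i := by simp
  exact lt_of_lt_of_le this (Finset.single_le_sum (f := fun j => P.pairing i j * P.pairing i j)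
    (fun j _ => mul_self_nonneg _) (Finset.mem_univ i))

/-- The coroots are proportional to the roots with respect to an invariant form. -/
lemma exists_form (P : RootPairing ι F M N) [P.IsRootSystem] : ∃ φ : M →ₗ[F] Module.Dual F M, ∃ a : ι → F,
    (∀ i, 0 < a i) ∧ ∀ i, φ (P.root i) = a i • P.coroot' i := by
  let _ := Fintype.ofFinite ι
  -- For an invariant form, `(α, ·) = ((α, α) / 2) ⟨·, α∨⟩`.
  refine ⟨P.RootForm, fun i => P.RootForm (P.root i) (P.root i) / 2, fun i => ?_, fun i => ?_⟩
  · exact div_pos (rootForm_self_pos i) two_pos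
  · have h := P.rootForm_self_smul_coroot i
    ext m
    have h2 := congrArg (P.toLinearMap m) h
    rw [map_smul, map_nsmul, P.toLinearMap_apply_apply_Polarization, nsmul_eq_mul] at h2
    have h3 : P.RootForm (P.root i) m = P.RootForm m (P.root i) := P.rootForm_symmetric.eq _ _
    simp only [LinearMap.smul_apply, smul_eq_mul] at h2 ⊢
    rw [h3]
    have : P.coroot' i m = P.toLinearMap m (P.coroot i) := rfl
    rw [this]
    push_cast at h2
    rw [div_mul_eq_mul_div, h2, h3, mul_div_cancel_left₀ _ (two_ne_zero' F)]

end Roots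

/-! ### Simple roots, heights, dominant vectors and fundamental weights. -/

section Roots

open RootPairing Classical

variable {ι : Type*} {F : Subfield ℝ} {M N : Type*}
  [AddCommGroup M] [Module F M] [AddCommGroup N] [Module F N]
  {P : RootPairing ι F M N} {B : Set ι}

lemma root_mem_posCone_of_mem {j : ι} (hj : j ∈ B) : P.root j ∈ posCone P B :=
  Submodule.subset_span ⟨j, hj, rfl⟩

lemma mem_posRoots_of_mem {j : ι} (hj : j ∈ B) : j ∈ posRoots P B := root_mem_posCone_of_mem hj

lemma exists_coeff_of_mem_posCone [Fintype ι] {x : M} (hx : x ∈ posCone P B) :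
    ∃ c : ι → F, (∀ j, 0 ≤ c j) ∧ (∀ j, j ∉ B → c j = 0) ∧ x = ∑ j, c j • P.root j := by
  refine Submodule.span_induction ?_ ?_ ?_ ?_ hx
  · rintro _ ⟨j, hj, rfl⟩
    refine ⟨Pi.single j 1, fun k => ?_, fun k hk => ?_, ?_⟩
    · by_cases h : k = j
      · subst h; simp
      · simp [h]
    · have : k ≠ j := by rintro rfl; exact hk hj
      simp [this]
    · rw [Finset.sum_eq_single j]
      · simp
      · intro k _ hk; simp [hk]
      · simp
  · exact ⟨0, by simp, by simp, by simp⟩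
  · rintro x y _ _ ⟨c, hc, hc', rfl⟩ ⟨d, hd, hd', rfl⟩
    exact ⟨c + d, fun j => add_nonneg (hc j) (hd j), fun j hj => by simp [hc' j hj, hd' j hj],
      by simp [add_smul, Finset.sum_add_distrib]⟩
  · rintro a x _ ⟨c, hc, hc', rfl⟩
    refine ⟨fun j => a * c j, fun j => mul_nonneg a.2 (hc j), fun j hj => by simp [hc' j hj], ?_⟩
    rw [Finset.smul_sum]
    refine Finset.sum_congr rfl fun j _ => ?_
    rw [mul_smul]; rfl

lemma exists_dual_eq_of_linearIndepOn {κ K E : Type*} [Field K] [AddCommGroup E] [Module K E]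
    {v : κ → E} {s : Set κ} (hv : LinearIndepOn K v s) (a : κ → K) :
    ∃ f : E →ₗ[K] K, ∀ j ∈ s, f (v j) = a j := by
  let b := Module.Basis.span hv.linearIndependent
  obtain ⟨g, hg⟩ := LinearMap.exists_extend (b.constr K fun j : s => a j)
  refine ⟨g, fun j hj => ?_⟩
  have h1 : v j = (b ⟨j, hj⟩ : E) := by
    rw [Module.Basis.span_apply]
  have h2 := LinearMap.congr_fun hg (b ⟨j, hj⟩)
  rw [h1]
  simpa using h2

/-- The height of a vector with respect to the simple roots. -/
lemma exists_height (hB : IsBasis P B) : ∃ h : M →ₗ[F] F, ∀ j ∈ B, h (P.root j) = 1 := by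
  exact exists_dual_eq_of_linearIndepOn hB.linearIndepOn fun _ => (1 : F)

variable [Finite ι]

lemma height_pos {h : M →ₗ[F] F} (hh : ∀ j ∈ B, h (P.root j) = 1) {i : ι}
    (hi : i ∈ posRoots P B) : 0 < h (P.root i) := by
  let _ := Fintype.ofFinite ι
  obtain ⟨c, hc, hc', hx⟩ := exists_coeff_of_mem_posCone hi
  have hsum : h (P.root i) = ∑ j, c j := by
    rw [hx, map_sum]
    refine Finset.sum_congr rfl fun j _ => ?_
    by_cases hj : j ∈ B
    · simp [hh j hj]
    · simp [hc' j hj]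
  rw [hsum]
  refine lt_of_le_of_ne (Finset.sum_nonneg fun j _ => hc j) fun h0 => ?_
  rw [eq_comm, Finset.sum_eq_zero_iff_of_nonneg fun j _ => hc j] at h0
  apply P.ne_zero i
  rw [hx]
  exact Finset.sum_eq_zero fun j hj => by rw [h0 j hj, zero_smul]

lemma neg_mem_posRoots_iff (hB : IsBasis P B) {i : ι} :
    neg P i ∈ posRoots P B ↔ i ∉ posRoots P B := by
  constructor
  · intro h1 h2
    obtain ⟨h, hh⟩ := exists_height hB
    have := height_pos hh h1
    have := height_pos hh h2
    simp at *
    linarith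
  · intro h
    rcases hB.pos_or_neg i with h1 | h1
    · exact absurd h1 h
    · simpa [posRoots] using h1

lemma neg_mem_posRoots (hB : IsBasis P B) {i : ι} (h : i ∉ posRoots P B) :
    neg P i ∈ posRoots P B := (neg_mem_posRoots_iff hB).2 h

lemma neg_notMem_posRoots (hB : IsBasis P B) {i : ι} (h : i ∈ posRoots P B) :
    neg P i ∉ posRoots P B := fun h' => (neg_mem_posRoots_iff hB).1 h' h

/-- A simple reflection permutes the positive roots which are not proportional to its root. -/
lemma exists_root_eq_smul_of_refl_smul (hB : IsBasis P B) {j i : ι} (hj : j ∈ B)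
    (hi : i ∈ posRoots P B) (hi' : refl P j • i ∉ posRoots P B) :
    ∃ c : F, 0 < c ∧ P.root i = c • P.root j := by
  let _ := Fintype.ofFinite ι
  obtain ⟨c, hc, hc', hx⟩ := exists_coeff_of_mem_posCone hi
  obtain ⟨d, hd, hd', hy⟩ := exists_coeff_of_mem_posCone (neg_mem_posRoots hB hi')
  rw [root_neg, root_smul, refl_smul] at hy
  -- The reflection changes only the coefficient at `j`. At `k ≠ j` the coefficient `c k ≥ 0`
  -- survives in `s_j α`, whose negative has coefficient `d k ≥ 0`; hence `c k = -d k = 0`.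
  have key : ∀ k ∈ B, k ≠ j → c k = 0 := by
    intro k hk hkj
    obtain ⟨f, hf'⟩ := exists_dual_eq_of_linearIndepOn hB.linearIndepOn
      fun l => if l = k then (1 : F) else 0
    have ev : ∀ e : ι → F, (∀ l, l ∉ B → e l = 0) → f (∑ l, e l • P.root l) = e k := by
      intro e he
      rw [map_sum, Finset.sum_eq_single k]
      · simp [hf' k hk]
      · intro l _ hl
        by_cases hlB : l ∈ B
        · simp [hf' l hlB, hl]
        · simp [he l hlB]
      · simp
    have h1 := congrArg f hy
    have h2 : f (P.root i) = c k := by rw [hx]; exact ev c hc'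
    rw [ev d hd', map_neg, map_sub, h2, map_smul, hf' j hj, if_neg (Ne.symm hkj)] at h1
    simp at h1
    have := hc k
    have := hd k
    linarith
  have hx2 : P.root i = c j • P.root j := by
    rw [hx]
    refine Finset.sum_eq_single j (fun k _ hk => ?_) (by simp)
    by_cases hkB : k ∈ B
    · rw [key k hkB hk, zero_smul]
    · rw [hc' k hkB, zero_smul]
  refine ⟨c j, lt_of_le_of_ne (hc j) fun h => P.ne_zero i ?_, hx2⟩
  rw [hx2, ← h, zero_smul]

variable [P.IsRootSystem]

/-- Positive coroots are non-negative combinations of simple coroots. -/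
lemma exists_coeff_coroot [Fintype ι] {i : ι} (hi : i ∈ posRoots P B) :
    ∃ c : ι → F, (∀ j, 0 ≤ c j) ∧ (∀ j, j ∉ B → c j = 0) ∧
      P.coroot' i = ∑ j, c j • P.coroot' j := by
  obtain ⟨c, hc, hc', hx⟩ := exists_coeff_of_mem_posCone hi
  obtain ⟨φ, a, ha, h⟩ := exists_form P
  refine ⟨fun j => (a i)⁻¹ * (c j * a j),
    fun j => mul_nonneg (inv_nonneg.2 (ha i).le) (mul_nonneg (hc j) (ha j).le),
    fun j hj => by simp [hc' j hj], ?_⟩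
  have h1 := h i
  rw [hx, map_sum] at h1
  have h2 : P.coroot' i = (a i)⁻¹ • a i • P.coroot' i := by
    rw [smul_smul, inv_mul_cancel₀ (ha i).ne', one_smul]
  rw [h2, ← h1, Finset.smul_sum]
  refine Finset.sum_congr rfl fun j _ => ?_
  rw [map_smul, h, smul_smul, smul_smul]
  ring_nf

lemma eq_zero_of_coroot'_eq_zero {m : M} (h : ∀ i, P.coroot' i m = 0) : m = 0 := by
  have h1 : P.toLinearMap m = 0 := by
    apply LinearMap.ext_on_range (v := P.coroot) (IsRootSystem.span_coroot_eq_top)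
    intro i
    exact h i
  apply (LinearMap.IsPerfPair.bijective_left (p := P.toLinearMap)).injective
  simpa using h1

lemma eq_zero_of_simple (hB : IsBasis P B) {m : M} (h : ∀ j ∈ B, P.coroot' j m = 0) : m = 0 := by
  let _ := Fintype.ofFinite ι
  have hp : ∀ i ∈ posRoots P B, P.coroot' i m = 0 := by
    intro i hi
    obtain ⟨c, hc, hc', hx⟩ := exists_coeff_coroot hi
    rw [hx]
    simp only [LinearMap.sum_apply, LinearMap.smul_apply]
    refine Finset.sum_eq_zero fun j _ => ?_
    by_cases hj : j ∈ B
    · rw [h j hj, smul_zero]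
    · rw [hc' j hj, zero_smul]
  refine eq_zero_of_coroot'_eq_zero (P := P) fun i => ?_
  by_cases hi : i ∈ posRoots P B
  · exact hp i hi
  · have := hp _ (neg_mem_posRoots hB hi)
    simpa using this

/-- Fundamental weights: the basis dual to the simple coroots. -/
lemma exists_weights (hB : IsBasis P B) : ∃ ω : B → M,
    (∀ j k : B, P.coroot' j (ω k) = if j = k then 1 else 0) ∧
    ∀ (_ : Fintype B) (m : M), m = ∑ j : B, P.coroot' j m • ω j := by
  let _ := Fintype.ofFinite ι
  have hspan : ⊤ ≤ Submodule.span F (Set.range fun j : B => P.root j) := by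
    rw [← IsRootSystem.span_root_eq_top (P := P), Submodule.span_le]
    have hp : ∀ i ∈ posRoots P B, P.root i ∈ Submodule.span F (Set.range fun j : B => P.root j) := by
      intro i hi
      obtain ⟨c, hc, hc', hx⟩ := exists_coeff_of_mem_posCone hi
      rw [hx]
      refine Submodule.sum_mem _ fun j _ => ?_
      by_cases hj : j ∈ B
      · exact Submodule.smul_mem _ _ (Submodule.subset_span ⟨⟨j, hj⟩, rfl⟩)
      · rw [hc' j hj, zero_smul]; exact Submodule.zero_mem _
    rintro _ ⟨i, rfl⟩
    by_cases hi : i ∈ posRoots P B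
    · exact hp i hi
    · have := hp _ (neg_mem_posRoots hB hi)
      rw [root_neg] at this
      exact (Submodule.neg_mem_iff _).1 this
  let b : Module.Basis B F M := Module.Basis.mk hB.linearIndepOn.linearIndependent hspan
  have hfd : Module.Finite F M := Module.Finite.of_basis b
  -- The simple coroots separate points and there are as many of them as the dimension, so `Φ` is
  -- bijective; the weights are preimages of the unit vectors.
  let Φ : M →ₗ[F] (B → F) := LinearMap.pi fun j : B => P.coroot' j
  have hinj : Function.Injective Φ := by
    rw [← LinearMap.ker_eq_bot, LinearMap.ker_eq_bot']
    intro m hm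
    exact eq_zero_of_simple hB fun j hj => congrFun hm ⟨j, hj⟩
  have hsurj : Function.Surjective Φ := by
    rw [← LinearMap.injective_iff_surjective_of_finrank_eq_finrank]
    · exact hinj
    · rw [Module.finrank_eq_card_basis b]; simp
  choose ω hω using fun k : B => hsurj (Pi.single k 1)
  have h1 : ∀ j k : B, P.coroot' j (ω k) = if j = k then 1 else 0 := by
    intro j k
    have := congrFun (hω k) j
    rw [Pi.single_apply] at this
    exact this
  refine ⟨ω, h1, fun _ m => ?_⟩
  apply hinj
  funext j
  change P.coroot' j m = P.coroot' j _
  rw [map_sum, Finset.sum_eq_single j]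
  · simp [h1]
  · intro k _ hk
    rw [map_smul, h1, if_neg (Ne.symm hk), smul_zero]
  · simp

lemma coroot'_nonneg_of_simple {m : M} (h : ∀ j ∈ B, 0 ≤ P.coroot' j m) {i : ι}
    (hi : i ∈ posRoots P B) : 0 ≤ P.coroot' i m := by
  let _ := Fintype.ofFinite ι
  obtain ⟨c, hc, hc', hx⟩ := exists_coeff_coroot hi
  rw [hx]
  simp only [LinearMap.sum_apply, LinearMap.smul_apply]
  refine Finset.sum_nonneg fun j _ => ?_
  by_cases hj : j ∈ B
  · exact mul_nonneg (hc j) (h j hj)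
  · rw [hc' j hj, zero_smul]

/-- If a dominant vector is orthogonal to a positive root, then this root is a combination of the
simple roots orthogonal to the vector; in particular there are such simple roots. -/
lemma exists_simple_of_coroot'_eq_zero [Fintype ι] {m : M} (h : ∀ j ∈ B, 0 ≤ P.coroot' j m) {i : ι}
    (hi : i ∈ posRoots P B) (h0 : P.coroot' i m = 0) :
    ∃ c : ι → F, (∀ j, 0 ≤ c j) ∧ (∀ j, c j ≠ 0 → j ∈ B ∧ P.coroot' j m = 0) ∧
      P.coroot' i = ∑ j, c j • P.coroot' j := by
  obtain ⟨c, hc, hc', hx⟩ := exists_coeff_coroot hi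
  refine ⟨c, hc, fun j hj => ?_, hx⟩
  have hjB : j ∈ B := by by_contra hh; exact hj (hc' j hh)
  refine ⟨hjB, ?_⟩
  have h1 : ∑ j, c j * P.coroot' j m = 0 := by
    rw [← h0, hx]; simp [LinearMap.sum_apply]
  rw [Finset.sum_eq_zero_iff_of_nonneg] at h1
  · exact (mul_eq_zero.1 (h1 j (Finset.mem_univ _))).resolve_left hj
  · intro k _
    by_cases hk : k ∈ B
    · exact mul_nonneg (hc k) (h k hk)
    · rw [hc' k hk, zero_mul]

end Roots

/-! ### Word length, the exchange condition and the longest element. -/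

section Length

open RootPairing Classical

variable {ι : Type*} {F : Subfield ℝ} {M N : Type*}
  [AddCommGroup M] [Module F M] [AddCommGroup N] [Module F N]
  {P : RootPairing ι F M N} {B : Set ι}

/-- `L` is a word in the simple reflections representing `g`. -/
def IsWord (P : RootPairing ι F M N) (B : Set ι) (L : List ι) (g : P.weylGroup) : Prop :=
  (∀ j ∈ L, j ∈ B) ∧ (L.map (refl P)).prod = g

/-- The word length with respect to the simple reflections. -/
def len (P : RootPairing ι F M N) (B : Set ι) (g : P.weylGroup) : ℕ :=
  sInf {n | ∃ L, IsWord P B L g ∧ L.length = n}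

lemma IsWord.mul {L L' : List ι} {g g' : P.weylGroup} (h : IsWord P B L g)
    (h' : IsWord P B L' g') : IsWord P B (L ++ L') (g * g') := by
  refine ⟨fun j hj => ?_, by rw [List.map_append, List.prod_append, h.2, h'.2]⟩
  rcases List.mem_append.1 hj with hj | hj
  · exact h.1 j hj
  · exact h'.1 j hj

lemma IsWord.inv {L : List ι} {g : P.weylGroup} (h : IsWord P B L g) :
    IsWord P B L.reverse g⁻¹ := by
  refine ⟨fun j hj => h.1 j (by simpa using hj), ?_⟩
  rw [← h.2, List.prod_inv_reverse, List.map_reverse, List.map_map]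
  congr 2
  apply List.map_congr_left
  intro j _
  simp

lemma isWord_one : IsWord P B [] (1 : P.weylGroup) := ⟨by simp, by simp⟩

lemma isWord_refl {j : ι} (hj : j ∈ B) : IsWord P B [j] (refl P j) := ⟨by simpa using hj, by simp⟩

lemma IsWord.len_le {L : List ι} {g : P.weylGroup} (h : IsWord P B L g) : len P B g ≤ L.length :=
  Nat.sInf_le ⟨L, h, rfl⟩

lemma coroot'_neg_of_neg [Finite ι] [P.IsRootSystem] (hB : IsBasis P B) {m : M}
    (h : ∀ j ∈ B, 0 ≤ P.coroot' j m) {i : ι} (hi : i ∉ posRoots P B) : P.coroot' i m ≤ 0 := by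
  have := coroot'_nonneg_of_simple h (neg_mem_posRoots hB hi)
  simpa using this

variable [Finite ι]

/-- Let the letters act on `α_j` one after the other from the right. At a letter `k` where a
positive root turns negative, that root is a positive multiple of `α_k`, so the letter is a
conjugate of `s_j` and cancels against it. -/
lemma exchange (hB : IsBasis P B) {j : ι} (hj : j ∈ B) (L : List ι) (hL : ∀ k ∈ L, k ∈ B)
    (hneg : (L.map (refl P)).prod • j ∉ posRoots P B) :
    ∃ L', IsWord P B L' ((L.map (refl P)).prod * refl P j) ∧ L'.length + 1 = L.length := by
  induction L with
  | nil => simp at hneg; exact absurd (mem_posRoots_of_mem hj) hneg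
  | cons k L ih =>
    have hL' : ∀ k ∈ L, k ∈ B := fun l hl => hL l (List.mem_cons_of_mem _ hl)
    have hk : k ∈ B := hL k (by simp)
    rw [List.map_cons, List.prod_cons] at *
    by_cases h : (L.map (refl P)).prod • j ∈ posRoots P B
    · rw [mul_smul] at hneg
      obtain ⟨c, hc, hcr⟩ := exists_root_eq_smul_of_refl_smul hB hk h hneg
      have h1 := refl_eq_of_root_smul hc.ne' hcr
      rw [refl_smul_index] at h1
      refine ⟨L, ⟨hL', ?_⟩, rfl⟩
      rw [← h1]
      group
      rw [mul_assoc, refl_mul_self, mul_one]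
    · obtain ⟨L', h1, h2⟩ := ih hL' h
      refine ⟨k :: L', ⟨?_, ?_⟩, by simp [h2]⟩
      · intro l hl
        rcases List.mem_cons.1 hl with rfl | hl
        · exact hk
        · exact h1.1 l hl
      · rw [List.map_cons, List.prod_cons, h1.2, mul_assoc]

variable [P.IsRootSystem]

/-- The Weyl group is generated by the simple reflections. -/
lemma closure_simple (hB : IsBasis P B) : Subgroup.closure (refl P '' B) = ⊤ := by
  let _ := Fintype.ofFinite ι
  set W := Subgroup.closure (refl P '' B) with hW
  have hs : ∀ j ∈ B, refl P j ∈ W := fun j hj => Subgroup.subset_closure ⟨j, hj, rfl⟩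
  obtain ⟨h, hh⟩ := exists_height hB
  have hpos : ∀ i ∈ posRoots P B, refl P i ∈ W := by
    intro i hi
    -- Choose a positive root of least height in the `W`-orbit. A simple reflection with positive
    -- coroot value would lower the height further, so it must make the root negative; the root is
    -- then proportional to a simple one.
    let S : Finset ι := Finset.univ.filter fun k => k ∈ posRoots P B ∧ ∃ g ∈ W, k = g • i
    have hS : S.Nonempty := ⟨i, Finset.mem_filter.2 ⟨Finset.mem_univ _, hi, 1, W.one_mem, (one_smul _ i).symm⟩⟩
    obtain ⟨k, hk, hmin⟩ := S.exists_min_image (fun k => h (P.root k)) hS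
    simp only [S, Finset.mem_filter, Finset.mem_univ, true_and] at hk hmin
    obtain ⟨hkp, g, hg, rfl⟩ := hk
    suffices hkey : refl P (g • i) ∈ W by
      rw [refl_smul_index] at hkey
      have := W.mul_mem (W.mul_mem (W.inv_mem hg) hkey) hg
      simpa [mul_assoc] using this
    -- Otherwise the negative of the root would be dominant, against `⟨α, α∨⟩ = 2`.
    obtain ⟨j, hj, hjp⟩ : ∃ j ∈ B, 0 < P.coroot' j (P.root (g • i)) := by
      by_contra! hcon
      have := coroot'_nonneg_of_simple (P := P) (B := B) (m := -P.root (g • i)) (fun j hj => by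
        rw [map_neg]; exact neg_nonneg.2 (hcon j hj)) hkp
      rw [map_neg, coroot'_root_self] at this
      linarith
    have hnot : refl P j • g • i ∉ posRoots P B := by
      intro hp
      have := hmin _ ⟨hp, refl P j * g, W.mul_mem (hs j hj) hg, by rw [mul_smul]⟩
      rw [root_smul (refl P j), refl_smul, map_sub, h.map_smul, hh j hj] at this
      simp at this
      exact absurd hjp (not_lt.2 this)
    obtain ⟨c, hc, hcr⟩ := exists_root_eq_smul_of_refl_smul hB hj hkp hnot
    rw [refl_eq_of_root_smul hc.ne' hcr]
    exact hs j hj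
  have hall : ∀ i, refl P i ∈ W := by
    intro i
    by_cases hi : i ∈ posRoots P B
    · exact hpos i hi
    · rw [← refl_eq_of_root_smul (c := -1) (by norm_num) (i := neg P i) (by simp)]
      exact hpos _ (neg_mem_posRoots hB hi)
  rw [eq_top_iff]
  rintro ⟨g, hg⟩ -
  induction hg using weylGroup.induction with
  | mem i => exact hall i
  | one => exact one_mem _
  | mul x y hx hy h1 h2 => exact mul_mem h1 h2

lemma exists_isWord (hB : IsBasis P B) (g : P.weylGroup) : ∃ L, IsWord P B L g := by
  have hg : g ∈ Subgroup.closure (refl P '' B) := by rw [closure_simple hB]; trivial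
  induction hg using Subgroup.closure_induction with
  | mem x hx => obtain ⟨j, hj, rfl⟩ := hx; exact ⟨_, isWord_refl hj⟩
  | one => exact ⟨_, isWord_one⟩
  | mul x y _ _ h1 h2 =>
    obtain ⟨L, hL⟩ := h1
    obtain ⟨L', hL'⟩ := h2
    exact ⟨_, hL.mul hL'⟩
  | inv x _ h => obtain ⟨L, hL⟩ := h; exact ⟨_, hL.inv⟩

lemma exists_isWord_len (hB : IsBasis P B) (g : P.weylGroup) :
    ∃ L, IsWord P B L g ∧ L.length = len P B g := by
  obtain ⟨L, hL⟩ := exists_isWord hB g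
  exact Nat.sInf_mem (s := {n | ∃ L, IsWord P B L g ∧ L.length = n}) ⟨_, L, hL, rfl⟩

lemma len_mul_le (hB : IsBasis P B) (g h : P.weylGroup) :
    len P B (g * h) ≤ len P B g + len P B h := by
  obtain ⟨L, hL, h1⟩ := exists_isWord_len hB g
  obtain ⟨L', hL', h2⟩ := exists_isWord_len hB h
  rw [← h1, ← h2, ← List.length_append]
  exact (hL.mul hL').len_le

omit [Finite ι] [P.IsRootSystem] in
lemma len_refl_le {j : ι} (hj : j ∈ B) : len P B (refl P j) ≤ 1 := (isWord_refl hj).len_le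

lemma len_inv (hB : IsBasis P B) (g : P.weylGroup) : len P B g⁻¹ = len P B g := by
  apply le_antisymm
  · obtain ⟨L, hL, h1⟩ := exists_isWord_len hB g
    rw [← h1, ← List.length_reverse]
    exact hL.inv.len_le
  · obtain ⟨L, hL, h1⟩ := exists_isWord_len hB g⁻¹
    rw [← h1, ← List.length_reverse]
    simpa using hL.inv.len_le

/-- The exchange condition shortens a word of minimal length by one letter, and subadditivity of the
length forbids a greater drop. -/
lemma len_mul_refl_of_neg (hB : IsBasis P B) {j : ι} (hj : j ∈ B) {g : P.weylGroup}
    (hg : g • j ∉ posRoots P B) : len P B (g * refl P j) + 1 = len P B g := by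
  obtain ⟨L, hL, h1⟩ := exists_isWord_len hB g
  rw [← hL.2] at hg
  obtain ⟨L', h2, h3⟩ := exchange hB hj L hL.1 hg
  rw [hL.2] at h2
  have h4 := h2.len_le
  have h5 := len_mul_le hB (g * refl P j) (refl P j)
  rw [mul_assoc, refl_mul_self, mul_one] at h5
  have := len_refl_le (P := P) hj
  omega

/-- The last letter `j` of a shortest word works: if `g • j` were positive, `g s_j` would be longer
than `g`, although deleting the letter gives it a shorter word. -/
lemma exists_neg_of_ne_one (hB : IsBasis P B) {g : P.weylGroup} (hg : g ≠ 1) :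
    ∃ j ∈ B, g • j ∉ posRoots P B := by
  obtain ⟨L, hL, h1⟩ := exists_isWord_len hB g
  rcases List.eq_nil_or_concat L with rfl | ⟨L', j, rfl⟩
  · exact absurd hL.2.symm (by simpa using hg)
  · rw [List.concat_eq_append] at *
    have hj : j ∈ B := hL.1 j (by simp)
    refine ⟨j, hj, fun hp => ?_⟩
    have hg' : g = (L'.map (refl P)).prod * refl P j := by rw [← hL.2]; simp
    have h2 : (g * refl P j) • j ∉ posRoots P B := by
      rw [mul_smul, refl_smul_idx_self, smul_neg]
      exact neg_notMem_posRoots hB hp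
    have h3 := len_mul_refl_of_neg hB hj h2
    rw [mul_assoc, refl_mul_self, mul_one] at h3
    have h4 : IsWord P B L' (g * refl P j) := by
      refine ⟨fun k hk => hL.1 k (by simp [hk]), ?_⟩
      rw [hg', mul_assoc, refl_mul_self, mul_one]
    have := h4.len_le
    simp at h1
    omega

/-- Induction on the length, multiplying with simple reflections on the right. -/
lemma weyl_induction (hB : IsBasis P B) {p : P.weylGroup → Prop} (one : p 1)
    (step : ∀ g, ∀ j ∈ B, g • j ∈ posRoots P B → len P B (g * refl P j) = len P B g + 1 →
      p g → p (g * refl P j)) (g : P.weylGroup) : p g := by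
  induction hn : len P B g using Nat.strong_induction_on generalizing g with
  | _ n ih =>
    by_cases hg : g = 1
    · rw [hg]; exact one
    · obtain ⟨j, hj, hneg⟩ := exists_neg_of_ne_one hB hg
      have h1 := len_mul_refl_of_neg hB hj hneg
      have h2 : g = (g * refl P j) * refl P j := by rw [mul_assoc, refl_mul_self, mul_one]
      rw [h2]
      refine step _ j hj ?_ ?_ (ih _ (by omega) _ rfl)
      · rw [mul_smul, refl_smul_idx_self, smul_neg]
        exact neg_mem_posRoots hB hneg
      · rw [← h2]; exact h1.symm

lemma eq_one_of_pos (hB : IsBasis P B) {g : P.weylGroup} (h : ∀ j ∈ B, g • j ∈ posRoots P B) :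
    g = 1 := by
  by_contra hg
  obtain ⟨j, hj, hneg⟩ := exists_neg_of_ne_one hB hg
  exact hneg (h j hj)

lemma weyl_eq_one_of_smul_idx {g : P.weylGroup} (h : ∀ i : ι, g • i = i) : g = 1 := by
  apply weyl_ext
  intro m
  rw [one_smul]
  have : Submodule.span F (Set.range P.root) = ⊤ := IsRootSystem.span_root_eq_top
  have hm : m ∈ Submodule.span F (Set.range P.root) := by rw [this]; trivial
  induction hm using Submodule.span_induction with
  | mem x hx => obtain ⟨i, rfl⟩ := hx; rw [← root_smul, h i]
  | zero => simp
  | add x y _ _ h1 h2 => rw [smul_add, h1, h2]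
  | smul c x _ h1 => rw [smul_comm, h1]

instance finite_weyl : Finite P.weylGroup := by
  refine Finite.of_injective (fun g : P.weylGroup => fun i : ι => g • i) fun g h hgh => ?_
  have : h⁻¹ * g = 1 := weyl_eq_one_of_smul_idx fun i => by
    rw [mul_smul, inv_smul_eq_iff]; exact congrFun hgh i
  exact (inv_mul_eq_one.1 this).symm

/-- An element of maximal length among those satisfying `q`: were `g • j` positive, `g s_j` would be
longer. -/
lemma exists_longest (hB : IsBasis P B) (q : P.weylGroup → Prop) (h : ∃ g, q g) :
    ∃ g, q g ∧ ∀ j ∈ B, q (g * refl P j) → g • j ∉ posRoots P B := by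
  obtain ⟨g, hg, hmax⟩ := Set.exists_max_image {g | q g} (len P B) (Set.toFinite _) h
  refine ⟨g, hg, fun j hj hq hp => ?_⟩
  have h2 : (g * refl P j) • j ∉ posRoots P B := by
    rw [mul_smul, refl_smul_idx_self, smul_neg]
    exact neg_notMem_posRoots hB hp
  have h3 := len_mul_refl_of_neg hB hj h2
  rw [mul_assoc, refl_mul_self, mul_one] at h3
  have := hmax _ hq
  omega

/-- A dominant regular vector. -/
lemma exists_face_vector (hB : IsBasis P B) (J : Set ι) :
    ∃ q : M, ∀ j ∈ B, P.coroot' j q = if j ∈ J then 0 else 1 := by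
  obtain ⟨ω, h1, -⟩ := exists_weights hB
  let _ : Fintype B := Fintype.ofFinite B
  refine ⟨∑ k : B, (if (k : ι) ∈ J then (0 : F) else 1) • ω k, fun j hj => ?_⟩
  rw [map_sum, Finset.sum_eq_single (⟨j, hj⟩ : B)]
  · simp only [map_smul]
    rw [h1 ⟨j, hj⟩ ⟨j, hj⟩]; simp
  · intro k _ hk
    rw [map_smul, h1 ⟨j, hj⟩ k, if_neg (Ne.symm hk), smul_zero]
  · simp

lemma coroot'_pos_of_simple {m : M} (h : ∀ j ∈ B, 0 < P.coroot' j m) {i : ι}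
    (hi : i ∈ posRoots P B) : 0 < P.coroot' i m := by
  let _ := Fintype.ofFinite ι
  refine lt_of_le_of_ne (coroot'_nonneg_of_simple (fun j hj => (h j hj).le) hi) fun h0 => ?_
  obtain ⟨c, hc, hc', hx⟩ := exists_simple_of_coroot'_eq_zero (fun j hj => (h j hj).le) hi h0.symm
  have : ∀ j, c j = 0 := fun j => by
    by_contra hj
    exact (h j (hc' j hj).1).ne' (hc' j hj).2
  apply coroot'_ne_zero (P := P) i
  rw [hx]; simp [this]

lemma exists_regular (hB : IsBasis P B) : ∃ r : M, (∀ i ∈ posRoots P B, 0 < P.coroot' i r) ∧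
    ∀ i ∉ posRoots P B, P.coroot' i r < 0 := by
  obtain ⟨r, hr⟩ := exists_face_vector hB (∅ : Set ι)
  have h : ∀ i ∈ posRoots P B, 0 < P.coroot' i r := fun i hi =>
    coroot'_pos_of_simple (fun j hj => by rw [hr j hj]; simp) hi
  refine ⟨r, h, fun i hi => ?_⟩
  have := h _ (neg_mem_posRoots hB hi)
  simpa using this

/-- The Weyl chamber is a strict fundamental domain. -/
lemma eq_of_smul_eq (hB : IsBasis P B) (g : P.weylGroup) {m m' : M}
    (h : ∀ j ∈ B, 0 ≤ P.coroot' j m) (h' : ∀ j ∈ B, 0 ≤ P.coroot' j m') (hg : g • m = m') :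
    m = m' := by
  induction g using weyl_induction hB with
  | one => simpa using hg
  | step g j hj hp _ ih =>
    -- This value is nonnegative by dominance of `m`, and nonpositive because `g s_j` sends `α_j` to
    -- a negative root, evaluated at the dominant `m'`.
    have h1 : P.coroot' j m = 0 := by
      refine le_antisymm ?_ (h j hj)
      rw [← coroot'_smul (g * refl P j), hg, mul_smul, refl_smul_idx_self, smul_neg]
      have := coroot'_nonneg_of_simple h' hp
      simpa using this
    apply ih
    rw [← hg, mul_smul, refl_smul, h1, zero_smul, sub_zero]

/-- The longest element of the Weyl group. -/
lemma exists_opposition (hB : IsBasis P B) :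
    ∃ w : P.weylGroup, ∀ i, w • i ∈ posRoots P B ↔ i ∉ posRoots P B := by
  -- The longest element makes every simple root negative. Testing on the regular vector `r`, `w⁻¹ •
  -- r` is antidominant, so every positive root becomes negative.
  obtain ⟨w, -, hw⟩ := exists_longest hB (fun _ => True) ⟨1, trivial⟩
  obtain ⟨r, hr, hr'⟩ := exists_regular hB
  have h : ∀ i ∈ posRoots P B, w • i ∉ posRoots P B := by
    intro i hi hp
    have h1 : 0 < P.coroot' i (w⁻¹ • r) := by
      rw [← coroot'_smul_left]; exact hr _ hp
    have h2 := coroot'_nonneg_of_simple (P := P) (B := B) (m := -(w⁻¹ • r)) (fun j hj => by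
      rw [map_neg, ← coroot'_smul_left]
      exact neg_nonneg.2 (hr' _ (hw j hj trivial)).le) hi
    rw [map_neg] at h2
    linarith
  refine ⟨w, fun i => ⟨fun h1 h2 => h i h2 h1, fun hi => ?_⟩⟩
  have := h _ (neg_mem_posRoots hB hi)
  rw [smul_neg, neg_mem_posRoots_iff hB, not_not] at this
  exact this

end Length

/-! ### The Weyl-invariant norm, and the recovery of a vector from its distances to the dominant
cone. -/

section Norm

open RootPairing Classical

variable {ι : Type*} {F : Subfield ℝ} {M N : Type*}
  [AddCommGroup M] [Module F M] [AddCommGroup N] [Module F N]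
  {P : RootPairing ι F M N} {B : Set ι} [Finite ι]

/-- The finite set of positive roots. -/
def posFin (P : RootPairing ι F M N) (B : Set ι) : Finset ι := (Set.toFinite (posRoots P B)).toFinset

@[simp] lemma mem_posFin {i : ι} : i ∈ posFin P B ↔ i ∈ posRoots P B := by simp [posFin]

lemma sum_neg_filter {A : Type*} [AddCommMonoid A] (hB : IsBasis P B) (φ : ι → A)
    (p : ι → Prop) [Fintype ι] :
    ∑ i with i ∉ posRoots P B ∧ p i, φ i = ∑ i ∈ posFin P B with p (neg P i), φ (neg P i) := by
  refine Finset.sum_bij' (fun i _ => neg P i) (fun i _ => neg P i) ?_ ?_ ?_ ?_ ?_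
  · intro i hi
    simp only [Finset.mem_filter, Finset.mem_univ, true_and, mem_posFin] at hi ⊢
    exact ⟨neg_mem_posRoots hB hi.1, by simpa using hi.2⟩
  · intro i hi
    simp only [Finset.mem_filter, Finset.mem_univ, true_and, mem_posFin] at hi ⊢
    exact ⟨neg_notMem_posRoots hB hi.1, hi.2⟩
  · simp
  · simp
  · simp

/-- For an even function the sum over all roots is twice the sum over the positive ones, and the
Weyl group permutes all roots. The factor two cancels by the order of `A`. -/
lemma sum_posFin_smul {A : Type*} [AddCommGroup A] [LinearOrder A] [IsOrderedAddMonoid A]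
    (hB : IsBasis P B) (φ : ι → A) (hφ : ∀ i, φ (neg P i) = φ i) (g : P.weylGroup) :
    ∑ i ∈ posFin P B, φ (g • i) = ∑ i ∈ posFin P B, φ i := by
  let _ := Fintype.ofFinite ι
  have key : ∀ ψ : ι → A, (∀ i, ψ (neg P i) = ψ i) →
      ∑ i, ψ i = 2 • ∑ i ∈ posFin P B, ψ i := by
    intro ψ hψ
    rw [← Finset.sum_filter_add_sum_filter_not Finset.univ (fun i => i ∈ posRoots P B), two_nsmul]
    congr 1
    · refine Finset.sum_congr ?_ fun _ _ => rfl
      ext i; simp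
    · have := sum_neg_filter hB ψ (fun _ => True)
      simpa [hψ] using this
  have h1 := key (fun i => φ (g • i)) (fun i => by simp only [smul_neg, hφ])
  have h2 := key φ hφ
  have h3 : ∑ i, φ (g • i) = ∑ i, φ i := Equiv.sum_comp (MulAction.toPerm g) φ
  rw [h3, h2, two_nsmul, two_nsmul] at h1
  rcases lt_trichotomy (∑ i ∈ posFin P B, φ (g • i)) (∑ i ∈ posFin P B, φ i) with h | h | h
  · exact absurd h1 (add_lt_add h h).ne'
  · exact h
  · exact absurd h1 (add_lt_add h h).ne

/-- The norm on `M` which induces the distance of the model space. -/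
def rnorm (P : RootPairing ι F M N) (B : Set ι) (m : M) : F := ∑ i ∈ posFin P B, |P.coroot' i m|

lemma rnorm_smul (hB : IsBasis P B) (g : P.weylGroup) (m : M) :
    rnorm P B (g • m) = rnorm P B m := by
  unfold rnorm
  rw [← sum_posFin_smul hB (fun i => |P.coroot' i (g • m)|) (by simp) g]
  exact Finset.sum_congr rfl fun i _ => by rw [coroot'_smul]

/-- Bounds a perturbation so that finitely many strict signs do not flip. -/
lemma exists_small {κ : Type*} (s : Finset κ) (a b : κ → F) (ha : ∀ i ∈ s, 0 < a i) :
    ∃ ε : F, 0 < ε ∧ ∀ i ∈ s, ε * b i ≤ a i := by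
  induction s using Finset.induction_on with
  | empty => exact ⟨1, one_pos, by simp⟩
  | insert k s hk ih =>
    obtain ⟨ε, hε, h⟩ := ih fun i hi => ha i (Finset.mem_insert_of_mem hi)
    have hak := ha k (Finset.mem_insert_self _ _)
    have hb : 0 < |b k| + 1 := by positivity
    refine ⟨min ε (a k / (|b k| + 1)), lt_min hε (div_pos hak hb), fun i hi => ?_⟩
    have hδ : 0 < min ε (a k / (|b k| + 1)) := lt_min hε (div_pos hak hb)
    rcases Finset.mem_insert.1 hi with rfl | hi'
    · calc _ ≤ min ε (a i / (|b i| + 1)) * (|b i| + 1) :=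
            mul_le_mul_of_nonneg_left ((le_abs_self _).trans (by linarith)) hδ.le
        _ ≤ a i / (|b i| + 1) * (|b i| + 1) := mul_le_mul_of_nonneg_right (min_le_right _ _) hb.le
        _ = a i := div_mul_cancel₀ _ hb.ne'
    · rcases le_total (b i) 0 with hb0 | hb0
      · exact (mul_nonpos_of_nonneg_of_nonpos hδ.le hb0).trans (ha i hi).le
      · exact (mul_le_mul_of_nonneg_right (min_le_left _ _) hb0).trans (h i hi')

variable [P.IsRootSystem]

/-- Among all `v` with `v • q = w • q` the longest is chosen, so that the roots vanishing on `w • q`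
are sorted consistently: a positive root vanishing there is sent by `v⁻¹` to a negative one. -/
lemma exists_longest_rep (hB : IsBasis P B) {q : M} (hq : ∀ j ∈ B, 0 ≤ P.coroot' j q)
    (w : P.weylGroup) : ∃ v : P.weylGroup, v • q = w • q ∧
      ∀ i ∈ posRoots P B, 0 < P.coroot' i (w • q) ↔ v⁻¹ • i ∈ posRoots P B := by
  let _ := Fintype.ofFinite ι
  obtain ⟨v, hv, hmax⟩ := exists_longest hB (fun v => v • q = w • q) ⟨w, rfl⟩
  refine ⟨v, hv, fun i hi => ?_⟩
  rw [← hv, coroot'_smul_right]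
  constructor
  · intro h
    by_contra hn
    exact absurd (coroot'_neg_of_neg hB hq hn) (not_le.2 h)
  · intro h
    refine lt_of_le_of_ne (coroot'_nonneg_of_simple hq h) fun h0 => ?_
    obtain ⟨c, hc, hc', hx⟩ := exists_simple_of_coroot'_eq_zero hq h h0.symm
    -- If `v⁻¹ • i` were positive and vanished on `q`, it would combine simple coroots vanishing on
    -- `q`. By maximality `v` makes their roots negative, so `α_i` would be nonpositive on `r`.
    obtain ⟨r, hr, hr'⟩ := exists_regular hB
    have h1 := hr i hi
    rw [← coroot'_smul v⁻¹, hx] at h1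
    refine absurd h1 (not_lt.2 ?_)
    simp only [LinearMap.sum_apply, LinearMap.smul_apply]
    refine Finset.sum_nonpos fun j _ => ?_
    by_cases hj : c j = 0
    · rw [hj, zero_smul]
    · obtain ⟨hjB, hj0⟩ := hc' j hj
      refine mul_nonpos_of_nonneg_of_nonpos (hc j) ?_
      rw [coroot'_smul_right, inv_inv]
      refine (hr' _ (hmax j hjB ?_)).le
      rw [mul_smul, refl_smul, hj0, zero_smul, sub_zero, hv]

/-- The vector `w • q` for dominant `q` is determined by its distances to the dominant vectors. -/
lemma eq_of_rnorm_eq (hB : IsBasis P B) {q : M} (hq : ∀ j ∈ B, 0 ≤ P.coroot' j q)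
    (w w' : P.weylGroup)
    (H : ∀ e, (∀ j ∈ B, 0 ≤ P.coroot' j e) → rnorm P B (e - w • q) = rnorm P B (e - w' • q)) :
    w • q = w' • q := by
  let _ := Fintype.ofFinite ι
  obtain ⟨v, hv, hvp⟩ := exists_longest_rep hB hq w
  obtain ⟨v', hv', hvp'⟩ := exists_longest_rep hB hq w'
  suffices h : v = v' by rw [← hv, ← hv', h]
  -- For small `ε`, `‖ε e - u‖ = ‖u‖ + ε ρ(e) - 2 ε S_v(e)`: moving from the origin to `ε e`, a term
  -- decreases exactly when its coroot is positive on `u`. So the distances determine `S_v` on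
  -- dominant vectors.
  set S : P.weylGroup → M → F := fun v e => ∑ i ∈ posFin P B with v⁻¹ • i ∈ posRoots P B,
    P.coroot' i e with hS
  set ρ : M → F := fun e => ∑ i ∈ posFin P B, P.coroot' i e with hρ
  have expand : ∀ (v : P.weylGroup) (u e : M) (ε : F), 0 ≤ ε →
      (∀ j ∈ B, 0 ≤ P.coroot' j e) →
      (∀ i ∈ posRoots P B, 0 < P.coroot' i u ↔ v⁻¹ • i ∈ posRoots P B) →
      (∀ i ∈ posRoots P B, 0 < P.coroot' i u → ε * P.coroot' i e ≤ P.coroot' i u) →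
      rnorm P B (ε • e - u) = rnorm P B u + ε * ρ e - 2 * ε * S v e := by
    intro v u e ε hε he h1 h2
    simp only [rnorm, hρ, hS, Finset.sum_filter, Finset.mul_sum]
    rw [← Finset.sum_add_distrib, ← Finset.sum_sub_distrib]
    refine Finset.sum_congr rfl fun i hi => ?_
    rw [mem_posFin] at hi
    have he' := mul_nonneg hε (coroot'_nonneg_of_simple he hi)
    rw [map_sub, map_smul, smul_eq_mul]
    by_cases hi2 : v⁻¹ • i ∈ posRoots P B
    · have h3 := (h1 i hi).2 hi2
      have h4 := h2 i hi h3
      rw [if_pos hi2, abs_of_nonpos (by linarith), abs_of_pos h3]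
      ring
    · have h3 : P.coroot' i u ≤ 0 := not_lt.1 fun h => hi2 ((h1 i hi).1 h)
      rw [if_neg hi2, abs_of_nonneg (by linarith), abs_of_nonpos h3]
      ring
  have hSeq : ∀ e, (∀ j ∈ B, 0 ≤ P.coroot' j e) → S v e = S v' e := by
    intro e he
    obtain ⟨ε₁, hε₁, h₁⟩ := exists_small (F := F) ((posFin P B).filter fun i => 0 < P.coroot' i (w • q))
      (fun i => P.coroot' i (w • q)) (fun i => P.coroot' i e)
      fun i hi => (Finset.mem_filter.1 hi).2
    obtain ⟨ε₂, hε₂, h₂⟩ := exists_small (F := F) ((posFin P B).filter fun i => 0 < P.coroot' i (w' • q))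
      (fun i => P.coroot' i (w' • q)) (fun i => P.coroot' i e)
      fun i hi => (Finset.mem_filter.1 hi).2
    have hε : 0 < min ε₁ ε₂ := lt_min hε₁ hε₂
    have e1 := expand v (w • q) e (min ε₁ ε₂) hε.le he hvp fun i hi h =>
      (mul_le_mul_of_nonneg_right (min_le_left _ _) (coroot'_nonneg_of_simple he hi)).trans
        (h₁ i (Finset.mem_filter.2 ⟨mem_posFin.2 hi, h⟩))
    have e2 := expand v' (w' • q) e (min ε₁ ε₂) hε.le he hvp' fun i hi h =>
      (mul_le_mul_of_nonneg_right (min_le_right _ _) (coroot'_nonneg_of_simple he hi)).trans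
        (h₂ i (Finset.mem_filter.2 ⟨mem_posFin.2 hi, h⟩))
    have e3 := H ((min ε₁ ε₂) • e) fun j hj => by
      rw [map_smul]; exact mul_nonneg hε.le (he j hj)
    have e4 := H 0 (by simp)
    have e5 : ∀ m : M, rnorm P B (0 - m) = rnorm P B m := fun m => by simp [rnorm]
    rw [e5, e5] at e4
    rw [e1, e2, e4] at e3
    have : 2 * min ε₁ ε₂ * S v e = 2 * min ε₁ ε₂ * S v' e := by linarith
    exact mul_left_cancel₀ (by positivity) this
  -- The coroots of `v • R⁺` are the positive ones counted by `S` and the negatives of the positive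
  -- ones left out. So `S_v` and the function `ρ ∘ v⁻¹` carry the same information.
  have hρS : ∀ (v : P.weylGroup) (e : M), ρ (v⁻¹ • e) = 2 * S v e - ρ e := by
    intro v e
    have h1 : ρ (v⁻¹ • e) = ∑ i with v⁻¹ • i ∈ posRoots P B, P.coroot' i e := by
      simp only [hρ]
      refine Finset.sum_bij' (fun i _ => v • i) (fun i _ => v⁻¹ • i) ?_ ?_ ?_ ?_ ?_
      · intro i hi; simpa using hi
      · intro i hi; simpa using hi
      · simp
      · simp
      · intro i _
        rw [coroot'_smul_left]
    have h2 : ∑ i with v⁻¹ • i ∈ posRoots P B, P.coroot' i e =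
        S v e + ∑ i with i ∉ posRoots P B ∧ v⁻¹ • i ∈ posRoots P B, P.coroot' i e := by
      rw [← Finset.sum_filter_add_sum_filter_not _ (fun i => i ∈ posRoots P B),
        Finset.filter_filter, Finset.filter_filter]
      congr 1
      · refine Finset.sum_congr ?_ fun _ _ => rfl
        ext i; simp [and_comm]
      · refine Finset.sum_congr ?_ fun _ _ => rfl
        ext i; simp [and_comm]
    rw [h1, h2, sum_neg_filter hB]
    have h3 : ρ e = S v e + ∑ i ∈ posFin P B with v⁻¹ • neg P i ∈ posRoots P B, P.coroot' i e := by
      simp only [hρ, hS]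
      rw [← Finset.sum_filter_add_sum_filter_not _ (fun i => v⁻¹ • i ∈ posRoots P B)]
      congr 1
      refine Finset.sum_congr ?_ fun _ _ => rfl
      ext i
      simp only [Finset.mem_filter, smul_neg, neg_mem_posRoots_iff hB]
    have h4 : ∑ i ∈ posFin P B with v⁻¹ • neg P i ∈ posRoots P B, P.coroot' (neg P i) e =
        - ∑ i ∈ posFin P B with v⁻¹ • neg P i ∈ posRoots P B, P.coroot' i e := by
      rw [← Finset.sum_neg_distrib]
      exact Finset.sum_congr rfl fun i _ => by simp
    rw [h4]
    linarith
  obtain ⟨r, hr, hr'⟩ := exists_regular hB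
  have hρlin : ∀ (a b : M) (c : F), ρ (a - c • b) = ρ a - c * ρ b := by
    intro a b c
    simp only [hρ, Finset.mul_sum, ← Finset.sum_sub_distrib, map_sub, map_smul, smul_eq_mul]
  -- Equality on dominant vectors extends linearly, since `ε e + r` is dominant for small `ε` and
  -- regular dominant `r`.
  have hall : ∀ e : M, ρ (v⁻¹ • e) = ρ (v'⁻¹ • e) := by
    intro e
    obtain ⟨ε, hε, h⟩ := exists_small (F := F) (posFin P B) (fun i => P.coroot' i r)
      (fun i => -P.coroot' i e) fun i hi => hr i (by simpa using hi)
    have hd : ∀ j ∈ B, 0 ≤ P.coroot' j (ε • e + r) := fun j hj => by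
      have := h j (by simpa using mem_posRoots_of_mem hj)
      rw [map_add, map_smul, smul_eq_mul]
      linarith
    have hd' : ∀ j ∈ B, 0 ≤ P.coroot' j r := fun j hj => (hr j (mem_posRoots_of_mem hj)).le
    have e1 := hρS v (ε • e + r)
    have e1' := hρS v' (ε • e + r)
    have e2 := hρS v r
    have e2' := hρS v' r
    rw [hSeq _ hd] at e1
    rw [hSeq _ hd'] at e2
    have key : ∀ g : P.weylGroup, ρ (g • (ε • e + r)) = ε * ρ (g • e) + ρ (g • r) := by
      intro g
      have := hρlin (g • r) (g • e) (-ε)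
      rw [neg_smul, sub_neg_eq_add, add_comm (g • r), smul_comm ε g, ← smul_add] at this
      rw [this]; ring
    rw [key] at e1 e1'
    have : ε * ρ (v⁻¹ • e) = ε * ρ (v'⁻¹ • e) := by linarith
    exact mul_left_cancel₀ hε.ne' this
  -- Now `ρ(v⁻¹v' r) = ρ(r) = ‖r‖ = ‖v⁻¹v' r‖`, so no positive coroot is negative on `v⁻¹v' r`;
  -- since `r` is regular, `v⁻¹v' = 1`.
  have hx := hall (v' • r)
  rw [inv_smul_smul, ← mul_smul] at hx
  have hsum : ∑ i ∈ posFin P B, (|P.coroot' i ((v⁻¹ * v') • r)| - P.coroot' i ((v⁻¹ * v') • r)) = 0 := by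
    rw [Finset.sum_sub_distrib]
    have h1 := rnorm_smul hB (v⁻¹ * v') r
    have h2 : rnorm P B r = ρ r := Finset.sum_congr rfl fun i hi =>
      abs_of_pos (hr i (by simpa using hi))
    have h3 : rnorm P B ((v⁻¹ * v') • r) = ρ ((v⁻¹ * v') • r) := by rw [h1, h2, hx]
    exact sub_eq_zero.2 h3
  rw [Finset.sum_eq_zero_iff_of_nonneg fun i _ => sub_nonneg.2 (le_abs_self _)] at hsum
  have hone : (v⁻¹ * v')⁻¹ = 1 := by
    refine eq_one_of_pos hB fun j hj => ?_
    by_contra hn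
    have h1 := hr' _ hn
    rw [← coroot'_smul_right] at h1
    have h2 := hsum j (by simpa using mem_posRoots_of_mem hj)
    rw [abs_of_neg h1] at h2
    linarith
  exact inv_mul_eq_one.1 (inv_eq_one.1 hone)

end Norm

/-! ### The model space -/

section ModelLemmas

open RootPairing Classical

variable {ι : Type*} {F : Subfield ℝ} {M N Λ : Type*}
  [AddCommGroup M] [Module F M] [AddCommGroup N] [Module F N]
  [AddCommGroup Λ] [Module F Λ]
  {P : RootPairing ι F M N} {B : Set ι}

lemma weyl_closure_refl : Subgroup.closure (Set.range (refl P)) = ⊤ := by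
  rw [eq_top_iff]
  rintro ⟨g, hg⟩ -
  induction hg using weylGroup.induction with
  | mem i => exact Subgroup.subset_closure ⟨i, rfl⟩
  | one => exact one_mem _
  | mul x y hx hy h1 h2 => exact mul_mem h1 h2

/-- The spherical Weyl group of the model space is the image of the Weyl group. -/
lemma mem_weyl_iff {w : ModelSpace F M Λ ≃ₗ[F] ModelSpace F M Λ} :
    w ∈ weyl P Λ ↔ ∃ g : P.weylGroup, ∀ u, w u = g • u := by
  have h1 : weyl P Λ = (DistribMulAction.toModuleAut F (ModelSpace F M Λ) (S := P.weylGroup)).range := by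
    rw [MonoidHom.range_eq_map, ← weyl_closure_refl, MonoidHom.map_closure, weyl, ← Set.range_comp]
    congr 2
    funext i
    refine LinearEquiv.ext fun u => ?_
    change TensorProduct.congr (P.reflection i) (LinearEquiv.refl F Λ) u = refl P i • u
    induction u using TensorProduct.induction_on with
    | zero => simp
    | tmul m l => rfl
    | add x y h1 h2 => rw [smul_add, map_add, h1, h2]
  rw [h1]
  constructor
  · rintro ⟨g, rfl⟩; exact ⟨g, fun u => rfl⟩
  · rintro ⟨g, hg⟩; exact ⟨g, by ext1 u; exact (hg u).symm⟩

lemma exists_weyl (g : P.weylGroup) : ∃ w ∈ weyl P Λ, ∀ u, w u = g • u :=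
  ⟨DistribMulAction.toModuleAut F (ModelSpace F M Λ) g, mem_weyl_iff.2 ⟨g, fun _ => rfl⟩, fun _ => rfl⟩

variable [LinearOrder Λ]

@[simp] lemma ev_tmul (i : ι) (m : M) (l : Λ) : ev P i (m ⊗ₜ[F] l) = P.coroot' i m • l := by
  simp [ev]

lemma ev_smul (g : P.weylGroup) (i : ι) (u : ModelSpace F M Λ) : ev P (g • i) (g • u) = ev P i u := by
  induction u using TensorProduct.induction_on with
  | zero => simp
  | tmul m l => rw [TensorProduct.smul_tmul', ev_tmul, ev_tmul, coroot'_smul]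
  | add x y h1 h2 => rw [smul_add, map_add, map_add, h1, h2]

lemma ev_smul_left (g : P.weylGroup) (i : ι) (u : ModelSpace F M Λ) :
    ev P (g • i) u = ev P i (g⁻¹ • u) := by
  rw [← ev_smul g i, smul_inv_smul]

lemma ev_smul_right (g : P.weylGroup) (i : ι) (u : ModelSpace F M Λ) :
    ev P i (g • u) = ev P (g⁻¹ • i) u := by
  rw [ev_smul_left, inv_inv]

lemma refl_smul_of_ev_eq_zero {i : ι} {u : ModelSpace F M Λ} (h : ev P i u = 0) :
    refl P i • u = u := by
  have : ∀ u : ModelSpace F M Λ, refl P i • u = u - P.root i ⊗ₜ[F] ev P i u := by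
    intro u
    induction u using TensorProduct.induction_on with
    | zero => simp
    | tmul m l =>
      rw [TensorProduct.smul_tmul', refl_smul, ev_tmul, TensorProduct.sub_tmul,
        TensorProduct.smul_tmul]
    | add x y h1 h2 => rw [smul_add, h1, h2, map_add, TensorProduct.tmul_add]; abel
  rw [this, h, TensorProduct.tmul_zero, sub_zero]

/-- Linear relations between coroots pass to the `Λ`-valued evaluations; it suffices to check pure
tensors. -/
lemma ev_eq_sum {κ : Type*} {s : Finset κ} {i : ι} {c : κ → F} {e : κ → ι}
    (h : P.coroot' i = ∑ j ∈ s, c j • P.coroot' (e j)) (u : ModelSpace F M Λ) :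
    ev P i u = ∑ j ∈ s, c j • ev P (e j) u := by
  induction u using TensorProduct.induction_on with
  | zero => simp
  | tmul m l =>
    rw [ev_tmul, h]
    simp only [LinearMap.sum_apply, LinearMap.smul_apply, Finset.sum_smul, ev_tmul, smul_eq_mul, mul_smul]
  | add x y h1 h2 => rw [map_add, h1, h2, ← Finset.sum_add_distrib]; simp [smul_add]

lemma ev_eq_smul {i j : ι} {c : F} (h : P.coroot' i = c • P.coroot' j) (u : ModelSpace F M Λ) :
    ev P i u = c • ev P j u := by
  have := ev_eq_sum (P := P) (s := {()}) (i := i) (c := fun _ => c) (e := fun _ => j) (by simpa using h) u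
  simpa using this

@[simp] lemma ev_neg (i : ι) (u : ModelSpace F M Λ) : ev P (neg P i) u = -ev P i u := by
  have h : P.coroot' (neg P i) = (-1 : F) • P.coroot' i := by
    rw [coroot'_neg]; exact (neg_one_smul F _).symm
  rw [ev_eq_smul h]; exact neg_one_smul F _

variable [Finite ι] [P.IsRootSystem]

/-- The fundamental weights give coordinates: `u = ∑ ω_j ⊗ ⟨u, α_j∨⟩`. -/
lemma model_ext (hB : IsBasis P B) {u v : ModelSpace F M Λ} (h : ∀ j ∈ B, ev P j u = ev P j v) :
    u = v := by
  let _ : Fintype B := Fintype.ofFinite B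
  obtain ⟨ω, -, h2⟩ := exists_weights hB
  have key : ∀ u : ModelSpace F M Λ, u = ∑ j : B, ω j ⊗ₜ[F] ev P (j : ι) u := by
    intro u
    induction u using TensorProduct.induction_on with
    | zero => simp
    | tmul m l =>
      conv_lhs => rw [h2 _ m]
      rw [TensorProduct.sum_tmul]
      refine Finset.sum_congr rfl fun j _ => ?_
      rw [ev_tmul, TensorProduct.smul_tmul]
    | add x y h1 h2 =>
      conv_lhs => rw [h1, h2]
      rw [← Finset.sum_add_distrib]
      simp [TensorProduct.tmul_add]
  rw [key u, key v]
  exact Finset.sum_congr rfl fun j _ => by rw [h j j.2]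

lemma exists_ev_eq (hB : IsBasis P B) (l : ι → Λ) :
    ∃ u : ModelSpace F M Λ, ∀ j ∈ B, ev P j u = l j := by
  let _ : Fintype B := Fintype.ofFinite B
  obtain ⟨ω, h1, -⟩ := exists_weights hB
  refine ⟨∑ k : B, ω k ⊗ₜ[F] l k, fun j hj => ?_⟩
  rw [map_sum, Finset.sum_eq_single (⟨j, hj⟩ : B)]
  · rw [ev_tmul, h1 ⟨j, hj⟩ ⟨j, hj⟩, if_pos rfl, one_smul]
  · intro k _ hk
    rw [ev_tmul, h1 ⟨j, hj⟩ k, if_neg (Ne.symm hk), zero_smul]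
  · simp

variable [IsOrderedAddMonoid Λ] [IsOrderedModule F Λ]

lemma smul_pos_of_pos {c : F} {l : Λ} (hc : 0 < c) (hl : 0 < l) : 0 < c • l :=
  lt_of_le_of_ne (smul_nonneg hc.le hl.le) (smul_ne_zero hc.ne' hl.ne').symm

/-- The fundamental Weyl chamber. -/
def chamber (P : RootPairing ι F M N) (B : Set ι) (Λ : Type*) [AddCommGroup Λ] [LinearOrder Λ]
    [Module F Λ] : Set (ModelSpace F M Λ) := face P B ∅

omit [Finite ι] [P.IsRootSystem] [IsOrderedAddMonoid Λ] [IsOrderedModule F Λ] in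
lemma mem_chamber {u : ModelSpace F M Λ} :
    u ∈ chamber P B Λ ↔ ∀ i ∈ posRoots P B, 0 ≤ ev P i u := by
  simp [chamber, face]

omit [Finite ι] [P.IsRootSystem] [IsOrderedAddMonoid Λ] [IsOrderedModule F Λ] in
lemma mem_face {J : Set ι} {u : ModelSpace F M Λ} :
    u ∈ face P B J ↔ u ∈ chamber P B Λ ∧ ∀ j ∈ J, ev P j u = 0 := by
  simp [chamber, face]

omit [Finite ι] [P.IsRootSystem] [IsOrderedAddMonoid Λ] [IsOrderedModule F Λ] in
lemma face_subset_chamber {J : Set ι} : face P B J ⊆ chamber P B Λ := fun _ hu => (mem_face.1 hu).1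

lemma mem_chamber_iff_simple {u : ModelSpace F M Λ} :
    u ∈ chamber P B Λ ↔ ∀ j ∈ B, 0 ≤ ev P j u := by
  let _ := Fintype.ofFinite ι
  rw [mem_chamber]
  refine ⟨fun h j hj => h j (mem_posRoots_of_mem hj), fun h i hi => ?_⟩
  obtain ⟨c, hc, hc', hx⟩ := exists_coeff_coroot hi
  rw [ev_eq_sum (e := id) hx]
  refine Finset.sum_nonneg fun j _ => ?_
  by_cases hj : j ∈ B
  · exact smul_nonneg (hc j) (h j hj)
  · rw [hc' j hj, zero_smul]

omit [Finite ι] [P.IsRootSystem] [IsOrderedModule F Λ] in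
lemma zero_mem_chamber : (0 : ModelSpace F M Λ) ∈ chamber P B Λ := by simp [mem_chamber]

omit [Finite ι] [P.IsRootSystem] [IsOrderedModule F Λ] in
lemma zero_mem_face {J : Set ι} : (0 : ModelSpace F M Λ) ∈ face P B J :=
  mem_face.2 ⟨zero_mem_chamber, by simp⟩

omit [Finite ι] [P.IsRootSystem] [IsOrderedModule F Λ] in
lemma add_mem_chamber {u v : ModelSpace F M Λ} (hu : u ∈ chamber P B Λ) (hv : v ∈ chamber P B Λ) :
    u + v ∈ chamber P B Λ := by
  rw [mem_chamber] at *
  intro i hi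
  rw [map_add]
  exact add_nonneg (hu i hi) (hv i hi)

omit [P.IsRootSystem] [IsOrderedModule F Λ] in
lemma ev_nonpos_of_neg (hB : IsBasis P B) {u : ModelSpace F M Λ} (hu : u ∈ chamber P B Λ) {i : ι}
    (hi : i ∉ posRoots P B) : ev P i u ≤ 0 := by
  have := mem_chamber.1 hu _ (neg_mem_posRoots hB hi)
  simpa using this

omit [IsOrderedAddMonoid Λ] in
lemma tmul_mem_chamber {q : M} (hq : ∀ j ∈ B, 0 ≤ P.coroot' j q) {l : Λ} (hl : 0 ≤ l) :
    q ⊗ₜ[F] l ∈ chamber P B Λ := by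
  rw [mem_chamber]
  intro i hi
  rw [ev_tmul]
  exact smul_nonneg (coroot'_nonneg_of_simple hq hi) hl

/-- A simple root whose image under an element fixing a dominant vector is negative vanishes on this
vector. -/
lemma ev_eq_zero_of_fixed (hB : IsBasis P B) {u : ModelSpace F M Λ} (hu : u ∈ chamber P B Λ)
    {g : P.weylGroup} (hg : g • u = u) {j : ι} (hj : j ∈ posRoots P B) (hn : g • j ∉ posRoots P B) :
    ev P j u = 0 := by
  refine le_antisymm ?_ (mem_chamber.1 hu j hj)
  rw [← ev_smul g j, hg]
  exact ev_nonpos_of_neg hB hu hn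

/-- A chamber vector dominating two given vectors. -/
lemma exists_common_upper (hB : IsBasis P B) (u v : ModelSpace F M Λ) :
    ∃ k, k - u ∈ chamber P B Λ ∧ k - v ∈ chamber P B Λ := by
  obtain ⟨k, hk⟩ := exists_ev_eq hB fun j => max (ev P j u) (ev P j v)
  refine ⟨k, mem_chamber_iff_simple.2 fun j hj => ?_, mem_chamber_iff_simple.2 fun j hj => ?_⟩
  · rw [map_sub, hk j hj]; exact sub_nonneg.2 (le_max_left _ _)
  · rw [map_sub, hk j hj]; exact sub_nonneg.2 (le_max_right _ _)

/-- A regular vector is tensored with an element of `Λ` chosen according to `b`, so that `Λ` need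
not be Archimedean. -/
lemma exists_lt_ev (hB : IsBasis P B) {i : ι} (hi : i ∈ posRoots P B) {l₀ : Λ} (h₀ : 0 < l₀) (b : Λ) :
    ∃ u ∈ chamber P B Λ, b < ev P i u := by
  obtain ⟨r, hr, -⟩ := exists_regular hB
  have hri := hr i hi
  refine ⟨r ⊗ₜ[F] ((P.coroot' i r)⁻¹ • (|b| + l₀)), tmul_mem_chamber
    (fun j hj => (hr j (mem_posRoots_of_mem hj)).le)
    (smul_nonneg (inv_nonneg.2 hri.le) (add_nonneg (abs_nonneg _) h₀.le)), ?_⟩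
  rw [ev_tmul, smul_smul, mul_inv_cancel₀ hri.ne', one_smul]
  exact (le_abs_self b).trans_lt (lt_add_of_pos_right _ h₀)

lemma weyl_eq_one_of_fixes_chamber (hB : IsBasis P B) {l₀ : Λ} (h₀ : 0 < l₀) {g : P.weylGroup}
    (hg : ∀ u ∈ chamber P B Λ, g • u = u) : g = 1 := by
  refine eq_one_of_pos hB fun j hj => ?_
  by_contra hn
  obtain ⟨u, hu, hlt⟩ := exists_lt_ev hB (mem_posRoots_of_mem hj) h₀ 0
  exact hlt.ne' (ev_eq_zero_of_fixed hB hu (hg u hu) (mem_posRoots_of_mem hj) hn)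

/-- The image of the chamber under `g` contains no half-line leaving the half-space of `i`, unless
`g⁻¹ • i` is positive. -/
lemma inv_smul_mem_posRoots (hB : IsBasis P B) {l₀ : Λ} (h₀ : 0 < l₀) {g : P.weylGroup} {i : ι}
    {k : ModelSpace F M Λ} {l : Λ} (h : ∀ u ∈ chamber P B Λ, l ≤ ev P i (k + g • u)) :
    g⁻¹ • i ∈ posRoots P B := by
  by_contra hn
  obtain ⟨u, hu, hlt⟩ := exists_lt_ev hB (neg_mem_posRoots hB hn) h₀ (ev P i k - l)
  have := h u hu
  rw [map_add, ev_smul_right] at this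
  rw [ev_neg] at hlt
  have h2 := add_lt_add_of_le_of_lt this hlt
  simp [add_comm, sub_eq_add_neg] at h2

/-! ### The norm on the model space -/

/-- The norm inducing the distance of the model space. -/
def vnorm (P : RootPairing ι F M N) (B : Set ι) (u : ModelSpace F M Λ) : Λ :=
  ∑ i ∈ posFin P B, |ev P i u|

omit [P.IsRootSystem] [IsOrderedAddMonoid Λ] [IsOrderedModule F Λ] in
lemma mdist_eq (u v : ModelSpace F M Λ) : mdist P B u v = vnorm P B (v - u) := by
  rw [mdist, vnorm, posFin, finsum_mem_eq_finite_toFinset_sum]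

omit [P.IsRootSystem] [IsOrderedModule F Λ] in
lemma vnorm_smul (hB : IsBasis P B) (g : P.weylGroup) (u : ModelSpace F M Λ) :
    vnorm P B (g • u) = vnorm P B u := by
  unfold vnorm
  rw [← sum_posFin_smul hB (fun i => |ev P i (g • u)|) (by simp) g]
  exact Finset.sum_congr rfl fun i _ => by rw [ev_smul]

omit [P.IsRootSystem] [IsOrderedModule F Λ] in
lemma vnorm_add_le (u v : ModelSpace F M Λ) : vnorm P B (u + v) ≤ vnorm P B u + vnorm P B v := by
  unfold vnorm
  rw [← Finset.sum_add_distrib]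
  exact Finset.sum_le_sum fun i _ => by rw [map_add]; exact abs_add_le _ _

omit [P.IsRootSystem] [IsOrderedModule F Λ] in
@[simp] lemma vnorm_neg (u : ModelSpace F M Λ) : vnorm P B (-u) = vnorm P B u := by
  simp [vnorm]

omit [P.IsRootSystem] [IsOrderedModule F Λ] in
@[simp] lemma vnorm_zero : vnorm P B (0 : ModelSpace F M Λ) = 0 := by simp [vnorm]

omit [P.IsRootSystem] [IsOrderedModule F Λ] in
lemma abs_ev_le_vnorm (hB : IsBasis P B) (i : ι) (u : ModelSpace F M Λ) : |ev P i u| ≤ vnorm P B u := by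
  by_cases hi : i ∈ posRoots P B
  · exact Finset.single_le_sum (f := fun i => |ev P i u|) (fun _ _ => abs_nonneg _) (mem_posFin.2 hi)
  · have := Finset.single_le_sum (f := fun i => |ev P i u|) (fun _ _ => abs_nonneg _)
      (mem_posFin.2 (neg_mem_posRoots hB hi))
    simpa [vnorm] using this

omit [P.IsRootSystem] in
lemma vnorm_tmul (m : M) {l : Λ} (hl : 0 ≤ l) : vnorm P B (m ⊗ₜ[F] l) = rnorm P B m • l := by
  rw [vnorm, rnorm, Finset.sum_smul]
  exact Finset.sum_congr rfl fun i _ => by rw [ev_tmul, abs_smul, abs_of_nonneg hl]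

/-! ### Convex sets -/

omit [IsOrderedAddMonoid Λ] [P.IsRootSystem] [Finite ι] [IsOrderedModule F Λ] in
lemma IsConvex.exists_list {T : AddSubgroup (ModelSpace F M Λ)} {Y : Set (ModelSpace F M Λ)}
    (h : IsConvex P T Y) : ∃ S : Set (ι × Λ), S.Finite ∧ Y = {u | ∀ p ∈ S, p.2 ≤ ev P p.1 u} := by
  obtain ⟨𝓗, hf, hs, rfl⟩ := h
  choose i l hil using hs
  have := hf.to_subtype
  refine ⟨Set.range fun H : 𝓗 => (i H.1 H.2, l H.1 H.2), Set.finite_range _, ?_⟩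
  ext u
  simp only [Set.mem_sInter, Set.forall_mem_range, Set.mem_ofPred_eq, Subtype.forall]
  refine forall₂_congr fun H hH => ?_
  conv_lhs => rw [(hil H hH).2]
  rfl

/-- A convex set which contains a subchamber contains the parallel chambers based at its points. -/
lemma IsConvex.add_mem (hB : IsBasis P B) {l₀ : Λ} (h₀ : 0 < l₀) {T : AddSubgroup (ModelSpace F M Λ)}
    {Y : Set (ModelSpace F M Λ)} (h : IsConvex P T Y) {g : P.weylGroup} {k : ModelSpace F M Λ}
    (hk : ∀ u ∈ chamber P B Λ, k + g • u ∈ Y) {v : ModelSpace F M Λ} (hv : v ∈ Y)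
    {u : ModelSpace F M Λ} (hu : u ∈ chamber P B Λ) : v + g • u ∈ Y := by
  obtain ⟨S, -, rfl⟩ := h.exists_list
  intro p hp
  -- Each defining half-space contains a translate of `g • C`, so its root is nonnegative on `g • C`
  -- and adding such vectors cannot leave it.
  have h1 := inv_smul_mem_posRoots hB h₀ (fun u hu => hk u hu p hp)
  rw [map_add, ev_smul_right]
  exact (hv p hp).trans (le_add_of_nonneg_right (mem_chamber.1 hu _ h1))

/-- A convex set which contains subchambers in opposite directions is the whole space. -/
lemma IsConvex.eq_univ (hB : IsBasis P B) {l₀ : Λ} (h₀ : 0 < l₀) {T : AddSubgroup (ModelSpace F M Λ)}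
    {Y : Set (ModelSpace F M Λ)} (h : IsConvex P T Y) {w : P.weylGroup}
    (hw : ∀ i, w • i ∈ posRoots P B ↔ i ∉ posRoots P B) {k k' : ModelSpace F M Λ}
    (hk : ∀ u ∈ chamber P B Λ, k + u ∈ Y) (hk' : ∀ u ∈ chamber P B Λ, k' + w • u ∈ Y) :
    Y = Set.univ := by
  obtain ⟨S, -, rfl⟩ := h.exists_list
  suffices S = ∅ by rw [this]; simp
  by_contra hne
  obtain ⟨p, hp⟩ := Set.nonempty_iff_ne_empty.2 hne
  have h1 := inv_smul_mem_posRoots hB h₀ (g := 1) (fun u hu => by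
    rw [one_smul]; exact hk u hu p hp)
  have h2 := inv_smul_mem_posRoots hB h₀ (fun u hu => hk' u hu p hp)
  rw [inv_one, one_smul] at h1
  have h3 := (hw (w⁻¹ • p.1)).1
  rw [smul_inv_smul] at h3
  exact h3 h1 h2

/-- A convex set which contains subchambers of the chamber and of the chamber opposite to its
`j`-adjacent chamber is the whole space or a half-apartment with wall direction `j`. -/
lemma IsConvex.eq_halfSpace (hB : IsBasis P B) {l₀ : Λ} (h₀ : 0 < l₀) {T : AddSubgroup (ModelSpace F M Λ)}
    {Y : Set (ModelSpace F M Λ)} (h : IsConvex P T Y) {w : P.weylGroup}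
    (hw : ∀ i, w • i ∈ posRoots P B ↔ i ∉ posRoots P B) {j : ι} (hj : j ∈ B)
    {k k' : ModelSpace F M Λ}
    (hk : ∀ u ∈ chamber P B Λ, k + u ∈ Y)
    (hk' : ∀ u ∈ chamber P B Λ, k' + (refl P j * w) • u ∈ Y) :
    Y = Set.univ ∨ ∃ l, Y = halfSpace P j l := by
  obtain ⟨S, hSf, rfl⟩ := h.exists_list
  -- The root of a defining half-space is positive by the first subchamber and becomes negative
  -- under `s_j` by the second; hence it is a positive multiple of `α_j`, and the bound is rescaled
  -- accordingly.
  have key : ∀ p ∈ S, ∃ l : Λ, ∀ u : ModelSpace F M Λ, p.2 ≤ ev P p.1 u ↔ l ≤ ev P j u := by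
    intro p hp
    have h1 := inv_smul_mem_posRoots hB h₀ (g := 1) (fun u hu => by
      rw [one_smul]; exact hk u hu p hp)
    have h2 := inv_smul_mem_posRoots hB h₀ (fun u hu => hk' u hu p hp)
    rw [inv_one, one_smul] at h1
    rw [mul_inv_rev, mul_smul, refl_inv] at h2
    have h3 := (hw (w⁻¹ • refl P j • p.1)).1
    rw [smul_inv_smul] at h3
    have h4 : refl P j • p.1 ∉ posRoots P B := fun h => h3 h h2
    obtain ⟨c, hc, hcr⟩ := exists_root_eq_smul_of_refl_smul hB hj h1 h4
    refine ⟨c • p.2, fun u => ?_⟩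
    have h5 : ev P p.1 u = c⁻¹ • ev P j u := ev_eq_smul (coroot'_of_root_smul hc.ne' hcr) u
    have h6 : ev P j u = c • ev P p.1 u := by rw [h5, smul_smul, mul_inv_cancel₀ hc.ne', one_smul]
    constructor
    · intro hle; rw [h6]; exact smul_le_smul_of_nonneg_left hle hc.le
    · intro hle
      rw [h5]
      have := smul_le_smul_of_nonneg_left hle (inv_nonneg.2 hc.le)
      rwa [smul_smul, inv_mul_cancel₀ hc.ne', one_smul] at this
  choose! l hl using key
  rcases S.eq_empty_or_nonempty with rfl | hne
  · left; simp
  · right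
    obtain ⟨p, hp, hmax⟩ := Set.exists_max_image S l hSf hne
    refine ⟨l p, ?_⟩
    ext u
    constructor
    · intro hu; exact (hl p hp u).1 (hu p hp)
    · intro hu p' hp'; exact (hl p' hp' u).2 ((hmax p' hp').trans hu)

end ModelLemmas

/-! ### Charts, distances and the Weyl distance at infinity -/

section Stabilizer

variable {ι : Type*} {F : Subfield ℝ} {M N : Type*}
  [AddCommGroup M] [Module F M] [AddCommGroup N] [Module F N]
  {P : RootPairing ι F M N} {B : Set ι} [Finite ι] [P.IsRootSystem]

lemma coroot'_eq_zero_of_fixed (hB : IsBasis P B) {q : M} (hq : ∀ j ∈ B, 0 ≤ P.coroot' j q)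
    {g : P.weylGroup} (hg : g • q = q) {j : ι} (hj : j ∈ B) (hn : g • j ∉ posRoots P B) :
    P.coroot' j q = 0 := by
  refine le_antisymm ?_ (hq j hj)
  rw [← coroot'_smul g j, hg]
  exact coroot'_neg_of_neg hB hq hn

open Classical in
-- Take `q` vanishing only on the simple coroot `j`. A nontrivial element of its stabilizer makes
-- some simple root negative, which can only be `α_j`. If `g` and `g s_j` were both nontrivial, both
-- would make `α_j` negative, which is impossible.
lemma exists_panel_vector (hB : IsBasis P B) {j : ι} (hj : j ∈ B) :
    ∃ q : M, (∀ k ∈ B, 0 ≤ P.coroot' k q) ∧ refl P j • q = q ∧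
      ∀ g : P.weylGroup, g • q = q → g = 1 ∨ g = refl P j := by
  obtain ⟨q, hq⟩ := exists_face_vector hB {j}
  have hq0 : ∀ k ∈ B, 0 ≤ P.coroot' k q := fun k hk => by rw [hq k hk]; split_ifs <;> simp
  have hj0 : refl P j • q = q := by rw [refl_smul, hq j hj]; simp
  have hk : ∀ k ∈ B, P.coroot' k q = 0 → k = j := fun k hk h => by
    by_contra hne
    rw [hq k hk] at h
    simp [hne] at h
  refine ⟨q, hq0, hj0, fun g hg => ?_⟩
  by_cases h1 : g = 1
  · exact Or.inl h1
  right
  obtain ⟨k, hkB, hn⟩ := exists_neg_of_ne_one hB h1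
  obtain rfl := hk k hkB (coroot'_eq_zero_of_fixed hB hq0 hg hkB hn)
  by_contra h2
  have h3 : g * refl P k ≠ 1 := fun h => h2 (by rw [← refl_inv]; exact eq_inv_of_mul_eq_one_left h)
  obtain ⟨l, hl, hn'⟩ := exists_neg_of_ne_one hB h3
  have h4 : (g * refl P k) • q = q := by rw [mul_smul, hj0, hg]
  obtain rfl := hk l hl (coroot'_eq_zero_of_fixed hB hq0 h4 hl hn')
  rw [mul_smul, refl_smul_idx_self, smul_neg] at hn'
  exact hn' (neg_mem_posRoots hB hn)

end Stabilizer

/-! ### Asymptotic charts, the distance on the building and the Weyl distance at infinity. -/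

section Charts

open Classical

variable {ι : Type*} {F : Subfield ℝ} {M N Λ : Type*}
  [AddCommGroup M] [Module F M] [AddCommGroup N] [Module F N]
  [AddCommGroup Λ] [LinearOrder Λ] [Module F Λ]
  {X : Type*}
  {P : RootPairing ι F M N} {B : Set ι}
  {T : AddSubgroup (ModelSpace F M Λ)} {𝒜 : Set (ModelSpace F M Λ → X)}

/-- A generalized affine building together with the standing assumptions on the model space. -/
structure Setup (P : RootPairing ι F M N) (B : Set ι)
    (T : AddSubgroup (ModelSpace F M Λ)) (𝒜 : Set (ModelSpace F M Λ → X)) : Prop where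
  basis : IsBasis P B
  exists_pos : ∃ l : Λ, 0 < l
  building : IsAffineBuilding P B T 𝒜

/-- The chart `f` precomposed with an element of the spherical Weyl group. -/
def tw (f : ModelSpace F M Λ → X) (g : P.weylGroup) : ModelSpace F M Λ → X := fun u => f (g • u)

omit [LinearOrder Λ] in
@[simp] lemma tw_apply (f : ModelSpace F M Λ → X) (g : P.weylGroup) (u : ModelSpace F M Λ) :
    tw f g u = f (g • u) := rfl

omit [LinearOrder Λ] in
@[simp] lemma tw_tw (f : ModelSpace F M Λ → X) (g h : P.weylGroup) : tw (tw f g) h = tw f (g * h) := by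
  funext u; simp [mul_smul]

omit [LinearOrder Λ] in
@[simp] lemma tw_one (f : ModelSpace F M Λ → X) : tw f (1 : P.weylGroup) = f := by
  funext u; simp

omit [LinearOrder Λ] in
lemma range_tw (f : ModelSpace F M Λ → X) (g : P.weylGroup) : Set.range (tw f g) = Set.range f :=
  (MulAction.surjective g).range_comp f

/-- The images of the fundamental chamber under the charts `f` and `g` contain a common subchamber:
they define the same chamber at infinity. -/
def Asy (P : RootPairing ι F M N) (B : Set ι) (f g : ModelSpace F M Λ → X) : Prop :=
  ∃ k k', ∀ u ∈ chamber P B Λ, f (k + u) = g (k' + u)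

/-- The Weyl distance of the chambers at infinity defined by the charts `f` and `g` is `w`. -/
def Delta (P : RootPairing ι F M N) (B : Set ι) (𝒜 : Set (ModelSpace F M Λ → X))
    (f g : ModelSpace F M Λ → X) (w : P.weylGroup) : Prop :=
  ∃ h ∈ 𝒜, Asy P B f h ∧ Asy P B g (tw h w)

lemma Asy.refl (f : ModelSpace F M Λ → X) : Asy P B f f := ⟨0, 0, fun _ _ => rfl⟩

lemma Asy.symm {f g : ModelSpace F M Λ → X} (h : Asy P B f g) : Asy P B g f := by
  obtain ⟨k, k', h⟩ := h
  exact ⟨k', k, fun u hu => (h u hu).symm⟩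

lemma asy_translate (f : ModelSpace F M Λ → X) (t : ModelSpace F M Λ) :
    Asy P B f (fun u => f (u + t)) := ⟨t, 0, fun u _ => by simp [add_comm]⟩

variable [Finite ι] [P.IsRootSystem] [IsOrderedAddMonoid Λ] [IsOrderedModule F Λ]

namespace Setup

variable (H : Setup P B T 𝒜)
include H

omit [IsOrderedModule F Λ] [IsOrderedAddMonoid Λ] [P.IsRootSystem] [Finite ι] in
lemma comp_mem {f : ModelSpace F M Λ → X} (hf : f ∈ 𝒜) (g : P.weylGroup) {t : ModelSpace F M Λ}
    (ht : t ∈ T) : (fun u => f (g • u + t)) ∈ 𝒜 := by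
  obtain ⟨w, hw, hwg⟩ := exists_weyl (P := P) (Λ := Λ) g
  refine H.building.comp_mem f hf (fun u => g • u + t) ⟨w, hw, t, ht, ?_⟩
  funext u; rw [hwg]

omit [IsOrderedModule F Λ] [IsOrderedAddMonoid Λ] [P.IsRootSystem] [Finite ι] in
lemma tw_mem {f : ModelSpace F M Λ → X} (hf : f ∈ 𝒜) (g : P.weylGroup) : tw f g ∈ 𝒜 := by
  have : (fun u => f (g • u)) ∈ 𝒜 := by simpa using H.comp_mem hf g T.zero_mem
  exact this

omit [IsOrderedModule F Λ] [IsOrderedAddMonoid Λ] [P.IsRootSystem] [Finite ι] in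
lemma translate_mem {f : ModelSpace F M Λ → X} (hf : f ∈ 𝒜) {t : ModelSpace F M Λ} (ht : t ∈ T) :
    (fun u => f (u + t)) ∈ 𝒜 := by
  have := H.comp_mem hf 1 ht
  simpa using this

omit [IsOrderedModule F Λ] [IsOrderedAddMonoid Λ] [P.IsRootSystem] [Finite ι] in
lemma inj {f : ModelSpace F M Λ → X} (hf : f ∈ 𝒜) {u v : ModelSpace F M Λ} (h : f u = f v) : u = v :=
  H.building.injective f hf h

omit [IsOrderedModule F Λ] [IsOrderedAddMonoid Λ] [P.IsRootSystem] [Finite ι] in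
lemma exists_transition {f g : ModelSpace F M Λ → X} (hf : f ∈ 𝒜) (hg : g ∈ 𝒜)
    {u v : ModelSpace F M Λ} (h : f u = g v) :
    ∃ w : P.weylGroup, ∃ t ∈ T, ∀ x, f x ∈ Set.range g → f x = g (w • x + t) := by
  obtain ⟨φ, ⟨w, hw, t, ht, rfl⟩, hφ⟩ := H.building.transition f hf g hg ⟨f u, ⟨u, rfl⟩, ⟨v, h.symm⟩⟩
  obtain ⟨w', hw'⟩ := mem_weyl_iff.1 hw
  refine ⟨w', t, ht, fun x hx => ?_⟩
  have := hφ hx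
  rw [Function.comp_apply, hw'] at this
  exact this

omit [IsOrderedModule F Λ] [IsOrderedAddMonoid Λ] [P.IsRootSystem] [Finite ι] in
lemma convex {f g : ModelSpace F M Λ → X} (hf : f ∈ 𝒜) (hg : g ∈ 𝒜)
    {u v : ModelSpace F M Λ} (h : f u = g v) : IsConvex P T (f ⁻¹' Set.range g) :=
  (H.building.convex f hf g hg ⟨f u, ⟨u, rfl⟩, ⟨v, h.symm⟩⟩).2

omit [P.IsRootSystem] [IsOrderedModule F Λ] in
lemma bdist_eq {f : ModelSpace F M Λ → X} (hf : f ∈ 𝒜) (u v : ModelSpace F M Λ) :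
    bdist P B 𝒜 (f u) (f v) = vnorm P B (v - u) := by
  have h : ∃ l : Λ, ∃ f' ∈ 𝒜, ∃ u' v', f' u' = f u ∧ f' v' = f v ∧ l = mdist P B u' v' :=
    ⟨_, f, hf, u, v, rfl, rfl, rfl⟩
  rw [bdist, dif_pos h]
  obtain ⟨f', hf', u', v', hu, hv, hl⟩ := h.choose_spec
  rw [hl, mdist_eq]
  obtain ⟨w, t, -, hw⟩ := H.exists_transition hf' hf hu
  have h1 : u = w • u' + t := H.inj hf (by rw [← hw u' ⟨u, hu.symm⟩, hu])
  have h2 : v = w • v' + t := H.inj hf (by rw [← hw v' ⟨v, hv.symm⟩, hv])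
  rw [h1, h2, add_sub_add_right_eq_sub, ← smul_sub, vnorm_smul H.basis]

omit [P.IsRootSystem] [IsOrderedModule F Λ] in
lemma bdist_self (x : X) : bdist P B 𝒜 x x = 0 := by
  obtain ⟨f, hf, ⟨u, rfl⟩, -⟩ := H.building.exists_chart x x
  rw [H.bdist_eq hf, sub_self, vnorm_zero]

omit [P.IsRootSystem] [IsOrderedModule F Λ] in
lemma bdist_comm (x y : X) : bdist P B 𝒜 x y = bdist P B 𝒜 y x := by
  obtain ⟨f, hf, ⟨u, rfl⟩, ⟨v, rfl⟩⟩ := H.building.exists_chart x y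
  rw [H.bdist_eq hf, H.bdist_eq hf, ← neg_sub, vnorm_neg]

omit [P.IsRootSystem] [IsOrderedModule F Λ] in
-- Axiom (A5) retracts `y` into an apartment containing `x` and `z` without increasing distances;
-- there the norm is subadditive.
lemma bdist_triangle (x y z : X) : bdist P B 𝒜 x z ≤ bdist P B 𝒜 x y + bdist P B 𝒜 y z := by
  obtain ⟨f, hf, hx, hz⟩ := H.building.exists_chart x z
  obtain ⟨r, h1, h2, h3, -⟩ := H.building.exists_retraction f hf x hx
  have e1 := h3 x y
  have e2 := h3 y z
  rw [h2 x hx] at e1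
  rw [h2 z hz] at e2
  refine le_trans ?_ (add_le_add e1 e2)
  obtain ⟨u, rfl⟩ := hx
  obtain ⟨v, hv⟩ := h1 y
  obtain ⟨u', rfl⟩ := hz
  rw [← hv, H.bdist_eq hf, H.bdist_eq hf, H.bdist_eq hf, ← sub_add_sub_cancel' v u u']
  exact vnorm_add_le _ _

lemma asy_trans {f g h : ModelSpace F M Λ → X} (h1 : Asy P B f g) (h2 : Asy P B g h) :
    Asy P B f h := by
  obtain ⟨k₁, k₁', h1⟩ := h1
  obtain ⟨k₂, k₂', h2⟩ := h2
  obtain ⟨k, hk, hk'⟩ := exists_common_upper H.basis k₁' k₂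
  refine ⟨k₁ + (k - k₁'), k₂' + (k - k₂), fun u hu => ?_⟩
  have e1 := h1 _ (add_mem_chamber hk hu)
  have e2 := h2 _ (add_mem_chamber hk' hu)
  rw [add_assoc, e1, add_assoc, ← e2]
  congr 1
  abel

lemma eq_one_of_fixes {w : P.weylGroup} (hw : ∀ u ∈ chamber P B Λ, w • u = u) : w = 1 := by
  obtain ⟨l₀, h₀⟩ := H.exists_pos
  exact weyl_eq_one_of_fixes_chamber H.basis h₀ hw

lemma eq_of_smul_chamber {w w' : P.weylGroup} {t t' : ModelSpace F M Λ}
    (h : ∀ u ∈ chamber P B Λ, w • u + t = w' • u + t') : w = w' ∧ t = t' := by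
  have h0 := h 0 zero_mem_chamber
  simp only [smul_zero, zero_add] at h0
  refine ⟨?_, h0⟩
  rw [← inv_mul_eq_one]
  apply H.eq_one_of_fixes
  intro u hu
  have := h u hu
  rw [h0, add_left_inj] at this
  rw [mul_smul, ← this, inv_smul_smul]

/-- Charts with the same chamber at infinity differ by a translation on their overlap. -/
lemma asy_transition {f g : ModelSpace F M Λ → X} (hf : f ∈ 𝒜) (hg : g ∈ 𝒜) (h : Asy P B f g) :
    ∃ t ∈ T, ∀ x, f x ∈ Set.range g → f x = g (x + t) := by
  obtain ⟨k, k', h⟩ := h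
  obtain ⟨w, t, ht, hw⟩ := H.exists_transition hf hg (h 0 zero_mem_chamber)
  obtain ⟨h1, -⟩ := H.eq_of_smul_chamber (w := w) (w' := 1) (t := w • k + t) (t' := k') fun u hu => by
    have h2 : f (k + u) = g (w • (k + u) + t) := hw _ ⟨_, (h u hu).symm⟩
    rw [h u hu] at h2
    have h3 := H.inj hg h2
    rw [one_smul, add_comm u k', h3, smul_add]; abel
  subst h1
  exact ⟨t, ht, fun x hx => by simpa using hw x hx⟩

/-- Normal form of `Asy`: after a translation the charts agree on their overlap, which is convex and
contains a subchamber. -/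
lemma asy_normalize {f g : ModelSpace F M Λ → X} (hf : f ∈ 𝒜) (hg : g ∈ 𝒜) (h : Asy P B f g) :
    ∃ g' ∈ 𝒜, Asy P B g g' ∧ (∃ t, g' = fun u => g (u + t)) ∧ Set.range g' = Set.range g ∧
      (∀ x, f x ∈ Set.range g' → f x = g' x) ∧
      ∃ k, ∀ u ∈ chamber P B Λ, f (k + u) = g' (k + u) := by
  obtain ⟨t, ht, h1⟩ := H.asy_transition hf hg h
  have hr : Set.range (fun u => g (u + t)) = Set.range g :=
    (AddGroup.addRight_bijective t).surjective.range_comp g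
  refine ⟨_, H.translate_mem hg ht, asy_translate g t, ⟨t, rfl⟩, hr, fun x hx => ?_, ?_⟩
  · rw [hr] at hx; exact h1 x hx
  · obtain ⟨k, k', h⟩ := h
    exact ⟨k, fun u hu => h1 _ ⟨_, (h u hu).symm⟩⟩

/-- Parallel chambers with the same base point agree. -/
lemma asy_eq {f g : ModelSpace F M Λ → X} (hf : f ∈ 𝒜) (hg : g ∈ 𝒜) (h : Asy P B f g)
    {u v : ModelSpace F M Λ} (huv : f u = g v) {q : ModelSpace F M Λ} (hq : q ∈ chamber P B Λ) :
    f (u + q) = g (v + q) := by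
  obtain ⟨l₀, h₀⟩ := H.exists_pos
  obtain ⟨t, -, h1⟩ := H.asy_transition hf hg h
  obtain ⟨k, k', h⟩ := h
  have h2 : v = u + t := H.inj hg (by rw [← huv]; exact h1 u ⟨v, huv.symm⟩)
  have h3 := (H.convex hf hg huv).add_mem H.basis h₀ (g := 1) (k := k) (fun w hw => by
    rw [one_smul]; exact ⟨_, (h w hw).symm⟩) (v := u) ⟨v, huv.symm⟩ hq
  rw [one_smul] at h3
  rw [h1 _ h3, h2]
  congr 1
  abel

/-- A chamber contained in an apartment is parallel to a chamber of a chart of this apartment. -/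
lemma exists_eq_of_subset {f g : ModelSpace F M Λ → X} (hf : f ∈ 𝒜) (hg : g ∈ 𝒜) {w : P.weylGroup}
    {k : ModelSpace F M Λ} {S : Set (ModelSpace F M Λ)} (h0 : (0 : ModelSpace F M Λ) ∈ S)
    (h : ∀ u ∈ S, f (k + w • u) ∈ Set.range g) :
    ∃ (v : P.weylGroup) (k' : ModelSpace F M Λ), ∀ u ∈ S, f (k + w • u) = g (k' + v • u) := by
  obtain ⟨y, hy⟩ := h 0 h0
  obtain ⟨v, t, -, hv⟩ := H.exists_transition hf hg hy.symm
  refine ⟨v * w, v • k + t, fun u hu => ?_⟩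
  rw [hv _ (h u hu), smul_add, mul_smul]
  congr 1
  abel

lemma exists_delta {f g : ModelSpace F M Λ → X} (hf : f ∈ 𝒜) (hg : g ∈ 𝒜) :
    ∃ w : P.weylGroup, Delta P B 𝒜 f g w := by
  obtain ⟨l₀, h₀⟩ := H.exists_pos
  have hch : ∀ f ∈ 𝒜, IsWeylChamber P B 𝒜 (f '' chamber P B Λ) := fun f hf => by
    refine ⟨f 0, Set.empty_subset _, f, hf, 1, one_mem _, 0, rfl, ?_⟩
    simp [place, chamber]
  obtain ⟨S₁, S₂, h1, h2, h1s, h2s, h, hh, hS⟩ := H.building.exists_subchambers _ _ (hch f hf) (hch g hg)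
  -- A Weyl chamber inside `f(C)` is a translate of it in the chart: the positive coroots are
  -- bounded below on it, so its direction `v` is trivial. Hence the chambers supplied by (A4)
  -- represent the same chambers at infinity.
  have key : ∀ f ∈ 𝒜, ∀ S, IsWeylChamber P B 𝒜 S → S ⊆ f '' chamber P B Λ → S ⊆ Set.range h →
      ∃ v : P.weylGroup, Asy P B f (tw h v) := by
    rintro f hf S ⟨x, -, f₁, hf₁, w₁, hw, k, -, rfl⟩ hsf hsh
    obtain ⟨w, hw'⟩ := mem_weyl_iff.1 hw
    have hS : ∀ u ∈ chamber P B Λ, f₁ (k + w • u) ∈ f₁ '' place w₁ k (face P B ∅) := fun u hu =>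
      ⟨_, ⟨u, hu, rfl⟩, by simp only [hw', add_comm]⟩
    obtain ⟨v, k', e1⟩ := H.exists_eq_of_subset hf₁ hf (k := k) (w := w) zero_mem_chamber
      fun u hu => (Set.image_subset_range _ _) (hsf (hS u hu))
    obtain ⟨v', k'', e2⟩ := H.exists_eq_of_subset hf₁ hh (k := k) (w := w) zero_mem_chamber
      fun u hu => hsh (hS u hu)
    have hv : v⁻¹ = 1 := by
      refine eq_one_of_pos H.basis fun j hj => inv_smul_mem_posRoots H.basis h₀ (k := k') (l := 0)
        fun u hu => ?_
      obtain ⟨y, hy, hy'⟩ := hsf (hS u hu)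
      rw [e1 u hu] at hy'
      rw [← H.inj hf hy']
      exact mem_chamber.1 hy _ (mem_posRoots_of_mem hj)
    rw [inv_eq_one] at hv
    subst hv
    refine ⟨v', k', v'⁻¹ • k'', fun u hu => ?_⟩
    have := (e1 u hu).symm.trans (e2 u hu)
    rw [one_smul] at this
    rw [this, tw_apply, smul_add, smul_inv_smul]
  obtain ⟨v, hv⟩ := key f hf S₁ h1 h1s (Set.subset_union_left.trans hS)
  obtain ⟨v', hv'⟩ := key g hg S₂ h2 h2s (Set.subset_union_right.trans hS)
  exact ⟨v⁻¹ * v', tw h v, H.tw_mem hh v, hv, by simpa using hv'⟩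

/-- The two comparison charts differ by a translation on their overlap. The overlap also contains a
subchamber for `g`, whose direction read in one chart is both `w` and `w'`. -/
lemma delta_unique {f g : ModelSpace F M Λ → X} {w w' : P.weylGroup}
    (h1 : Delta P B 𝒜 f g w) (h2 : Delta P B 𝒜 f g w') : w = w' := by
  obtain ⟨h, hh, e1, e2⟩ := h1
  obtain ⟨h', hh', e1', e2'⟩ := h2
  obtain ⟨t, -, ht⟩ := H.asy_transition hh hh' (H.asy_trans e1.symm e1')
  obtain ⟨k, k', hk⟩ := H.asy_trans e2.symm e2'
  refine (H.eq_of_smul_chamber (t := w • k + t) (t' := w' • k') fun u hu => ?_).1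
  have h3 : h (w • (k + u)) = h' (w' • (k' + u)) := hk u hu
  rw [ht _ ⟨_, h3.symm⟩] at h3
  have := H.inj hh' h3
  rw [smul_add, smul_add] at this
  rw [add_comm (w' • u), ← this]
  abel

lemma delta_congr {f f' g g' : ModelSpace F M Λ → X} {w : P.weylGroup}
    (h : Delta P B 𝒜 f g w) (hf : Asy P B f f') (hg : Asy P B g g') : Delta P B 𝒜 f' g' w := by
  obtain ⟨h, hh, e1, e2⟩ := h
  exact ⟨h, hh, H.asy_trans hf.symm e1, H.asy_trans hg.symm e2⟩

omit [P.IsRootSystem] [IsOrderedModule F Λ] [Finite ι] [IsOrderedAddMonoid Λ] in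
lemma delta_symm {f g : ModelSpace F M Λ → X} {w : P.weylGroup}
    (h : Delta P B 𝒜 f g w) : Delta P B 𝒜 g f w⁻¹ := by
  obtain ⟨h, hh, e1, e2⟩ := h
  exact ⟨tw h w, H.tw_mem hh w, e2, by simpa using e1⟩

omit [P.IsRootSystem] [IsOrderedModule F Λ] [Finite ι] [IsOrderedAddMonoid Λ] in
lemma delta_tw {f : ModelSpace F M Λ → X} (hf : f ∈ 𝒜) (v w : P.weylGroup) :
    Delta P B 𝒜 (tw f v) (tw f w) (v⁻¹ * w) :=
  ⟨tw f v, H.tw_mem hf v, Asy.refl _, by simpa using Asy.refl _⟩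

omit [P.IsRootSystem] [IsOrderedModule F Λ] [Finite ι] [IsOrderedAddMonoid Λ] in
lemma delta_self_tw {f : ModelSpace F M Λ → X} (hf : f ∈ 𝒜) (w : P.weylGroup) :
    Delta P B 𝒜 f (tw f w) w := ⟨f, hf, Asy.refl _, Asy.refl _⟩

lemma delta_one_iff {f g : ModelSpace F M Λ → X} (hf : f ∈ 𝒜) :
    Delta P B 𝒜 f g 1 ↔ Asy P B f g := by
  constructor
  · rintro ⟨h, hh, e1, e2⟩
    exact H.asy_trans e1 (by simpa using e2.symm)
  · intro h
    exact ⟨f, hf, Asy.refl _, by simpa using h.symm⟩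

omit [P.IsRootSystem] [IsOrderedModule F Λ] in
lemma asy_bounded {f g : ModelSpace F M Λ → X} (hf : f ∈ 𝒜) (hg : g ∈ 𝒜) (h : Asy P B f g) :
    ∃ b, ∀ u ∈ chamber P B Λ, bdist P B 𝒜 (f u) (g u) ≤ b := by
  obtain ⟨k, k', h⟩ := h
  refine ⟨vnorm P B k + vnorm P B k', fun u hu => ?_⟩
  refine (H.bdist_triangle _ (f (k + u)) _).trans (add_le_add ?_ ?_)
  · rw [H.bdist_eq hf, add_sub_cancel_right]
  · rw [h u hu, H.bdist_eq hg, sub_add_cancel_right, vnorm_neg]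

/-- Linear growth beats a bounded error, also over a non-Archimedean `Λ`: if `x > y`, the choice `l
= (x - y)⁻¹ • (|b| + l₀)` violates the bound. -/
lemma le_of_smul_le {x y : F} {b : Λ} (h : ∀ l : Λ, 0 ≤ l → x • l ≤ y • l + b) : x ≤ y := by
  by_contra! hlt
  obtain ⟨l₀, h₀⟩ := H.exists_pos
  have hc : 0 < x - y := sub_pos.2 hlt
  have hl : 0 ≤ (x - y)⁻¹ • (|b| + l₀) :=
    smul_nonneg (inv_nonneg.2 hc.le) (add_nonneg (abs_nonneg _) h₀.le)
  have h1 := h _ hl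
  rw [← sub_le_iff_le_add', ← sub_smul, smul_smul, mul_inv_cancel₀ hc.ne', one_smul] at h1
  exact absurd (h1.trans (le_abs_self b)) (not_le.2 (lt_add_of_pos_right _ h₀))

/-- The points `g (q ⊗ l)` and `g' (q ⊗ l)` stay at bounded distance because `v` fixes `q`. Their
distances to `f (e ⊗ l)` are `‖e - w q‖ • l` and `‖e - w' q‖ • l` up to bounded errors, so the
coefficients can be compared. -/
lemma delta_fixed_le {f g g' : ModelSpace F M Λ → X} (hf : f ∈ 𝒜) (hg : g ∈ 𝒜) (hg' : g' ∈ 𝒜)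
    {w w' v : P.weylGroup} (h : Delta P B 𝒜 f g w) (h' : Delta P B 𝒜 f g' w')
    (hv : Delta P B 𝒜 g g' v) {q : M} (hq : ∀ j ∈ B, 0 ≤ P.coroot' j q) (hvq : v • q = q)
    {e : M} (he : ∀ j ∈ B, 0 ≤ P.coroot' j e) :
    rnorm P B (e - w • q) ≤ rnorm P B (e - w' • q) := by
  obtain ⟨h, hh, e1, e2⟩ := h
  obtain ⟨h', hh', e1', e2'⟩ := h'
  obtain ⟨m, hm, e3, e4⟩ := hv
  obtain ⟨b₁, hb₁⟩ := H.asy_bounded hf hh e1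
  obtain ⟨b₂, hb₂⟩ := H.asy_bounded hg (H.tw_mem hh w) e2
  obtain ⟨b₃, hb₃⟩ := H.asy_bounded hf hh' e1'
  obtain ⟨b₄, hb₄⟩ := H.asy_bounded hg' (H.tw_mem hh' w') e2'
  obtain ⟨b₅, hb₅⟩ := H.asy_bounded hg hm e3
  obtain ⟨b₆, hb₆⟩ := H.asy_bounded hg' (H.tw_mem hm v) e4
  refine H.le_of_smul_le (b := b₁ + b₃ + (b₄ + b₆ + b₅ + b₂)) fun l hl => ?_
  have hqC := tmul_mem_chamber hq hl
  have heC := tmul_mem_chamber he hl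
  have d : ∀ h ∈ 𝒜, ∀ w : P.weylGroup, bdist P B 𝒜 (h (w • (q ⊗ₜ[F] l))) (h (e ⊗ₜ[F] l)) =
      rnorm P B (e - w • q) • l := fun h hh w => by
    rw [H.bdist_eq hh, TensorProduct.smul_tmul', ← TensorProduct.sub_tmul, vnorm_tmul _ hl]
  rw [← d h hh, ← d h' hh']
  have t1 := hb₁ _ heC
  have t2 := hb₂ _ hqC
  have t3 := hb₃ _ heC
  have t4 := hb₄ _ hqC
  have t5 := hb₅ _ hqC
  have t6 := hb₆ _ hqC
  rw [tw_apply] at t2 t4 t6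
  rw [TensorProduct.smul_tmul', hvq] at t6
  rw [H.bdist_comm] at t1 t2
  rw [H.bdist_comm] at t4 t5
  have hqq : bdist P B 𝒜 (h (w • (q ⊗ₜ[F] l))) (h' (w' • (q ⊗ₜ[F] l))) ≤ b₂ + (b₅ + (b₆ + b₄)) :=
    (H.bdist_triangle _ (g (q ⊗ₜ[F] l)) _).trans <| add_le_add t2 <|
    (H.bdist_triangle _ (m (q ⊗ₜ[F] l)) _).trans <| add_le_add (by rw [H.bdist_comm]; exact t5) <|
    (H.bdist_triangle _ (g' (q ⊗ₜ[F] l)) _).trans <| add_le_add (by rw [H.bdist_comm]; exact t6)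
      (by rw [H.bdist_comm]; exact t4)
  have hee : bdist P B 𝒜 (h' (e ⊗ₜ[F] l)) (h (e ⊗ₜ[F] l)) ≤ b₃ + b₁ :=
    (H.bdist_triangle _ (f (e ⊗ₜ[F] l)) _).trans <| add_le_add (by rw [H.bdist_comm]; exact t3)
      (by rw [H.bdist_comm]; exact t1)
  refine (H.bdist_triangle _ (h' (w' • (q ⊗ₜ[F] l))) _).trans ?_
  refine (add_le_add hqq (H.bdist_triangle _ (h' (e ⊗ₜ[F] l)) _)).trans ?_
  refine (add_le_add le_rfl (add_le_add le_rfl hee)).trans (le_of_eq ?_)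
  abel

/-- If the chambers at infinity of `g` and `g'` share a face, then their Weyl distances from the
chamber of `f` agree on this face. -/
lemma delta_fixed {f g g' : ModelSpace F M Λ → X} (hf : f ∈ 𝒜) (hg : g ∈ 𝒜) (hg' : g' ∈ 𝒜)
    {w w' v : P.weylGroup} (h : Delta P B 𝒜 f g w) (h' : Delta P B 𝒜 f g' w')
    (hv : Delta P B 𝒜 g g' v) {q : M} (hq : ∀ j ∈ B, 0 ≤ P.coroot' j q) (hvq : v • q = q) :
    w • q = w' • q :=
  eq_of_rnorm_eq H.basis hq w w' fun _ he =>
    le_antisymm (H.delta_fixed_le hf hg hg' h h' hv hq hvq he)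
      (H.delta_fixed_le hf hg' hg h' h (H.delta_symm hv) hq (by
        rw [inv_smul_eq_iff, hvq]) he)

/-- The two distances agree on a generic vector of the panel `j`, whose stabilizer is `{1, s_j}`. -/
lemma delta_adjacent {f g g' : ModelSpace F M Λ → X} (hf : f ∈ 𝒜) (hg : g ∈ 𝒜) (hg' : g' ∈ 𝒜)
    {w w' v : P.weylGroup} (h : Delta P B 𝒜 f g w) (h' : Delta P B 𝒜 f g' w') {j : ι} (hj : j ∈ B)
    (hv : Delta P B 𝒜 g g' v) (hvj : v = 1 ∨ v = refl P j) :
    w' = w ∨ w' = w * refl P j := by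
  obtain ⟨q, hq, hjq, hstab⟩ := exists_panel_vector H.basis hj
  have h1 := H.delta_fixed hf hg hg' h h' hv hq (by rcases hvj with rfl | rfl <;> simp [hjq])
  rcases hstab (w⁻¹ * w') (by rw [mul_smul, ← h1, inv_smul_smul]) with h2 | h2
  · left; exact (inv_mul_eq_one.1 h2).symm
  · right; exact inv_mul_eq_iff_eq_mul.1 h2

lemma delta_adjacent_left {f f' g : ModelSpace F M Λ → X} (hf : f ∈ 𝒜) (hf' : f' ∈ 𝒜) (hg : g ∈ 𝒜)
    {w w' v : P.weylGroup} (h : Delta P B 𝒜 f g w) (h' : Delta P B 𝒜 f' g w') {j : ι} (hj : j ∈ B)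
    (hv : Delta P B 𝒜 f f' v) (hvj : v = 1 ∨ v = refl P j) :
    w' = w ∨ w' = refl P j * w := by
  rcases H.delta_adjacent hg hf hf' (H.delta_symm h) (H.delta_symm h') hj hv hvj with h1 | h1
  · left; simpa using h1
  · right
    rw [← inv_inv w', h1]; simp

end Setup

end Charts

/-! ### Branching of apartments -/

section Opposition

variable {ι : Type*} {F : Subfield ℝ} {M N : Type*}
  [AddCommGroup M] [Module F M] [AddCommGroup N] [Module F N]
  {P : RootPairing ι F M N} {B : Set ι}

lemma refl_ne_one (i : ι) : refl P i ≠ 1 := fun h => by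
  have h1 : neg P i = i := by rw [← refl_smul_idx_self, h, one_smul]
  have h2 := congrArg P.root h1
  have h3 := congrArg (P.coroot' i) h2
  rw [root_neg, map_neg, coroot'_root_self] at h3
  norm_num at h3

lemma mem_posRoots_of_root_eq_smul {i k : ι} {c : F} (hc : 0 < c) (h : P.root i = c • P.root k)
    (hk : k ∈ posRoots P B) : i ∈ posRoots P B := by
  change P.root i ∈ posCone P B
  rw [h]
  exact (posCone P B).smul_mem ⟨c, hc.le⟩ hk

variable [Finite ι] [P.IsRootSystem]

/-- Conjugation with the longest element permutes the simple reflections. -/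
lemma exists_opposite_simple (hB : IsBasis P B) {w : P.weylGroup}
    (hw : ∀ i, w • i ∈ posRoots P B ↔ i ∉ posRoots P B) {j : ι} (hj : j ∈ B) :
    ∃ k ∈ B, w⁻¹ * refl P j * w = refl P k := by
  let _ := Fintype.ofFinite ι
  obtain ⟨q, hq, hjq, hstab⟩ := exists_panel_vector hB hj
  -- Both `-w⁻¹α_j` and `-w⁻¹q` lie on the positive side, and the former vanishes on the latter. So
  -- some simple coroot `k` vanishes there too, and `s_{wα_k}` fixes `q`, whence it equals `s_j`.
  have hγ : neg P (w⁻¹ • j) ∈ posRoots P B := by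
    rw [neg_mem_posRoots_iff hB, ← hw, smul_inv_smul]
    exact mem_posRoots_of_mem hj
  have hq' : ∀ k ∈ B, 0 ≤ P.coroot' k (-(w⁻¹ • q)) := fun k hk => by
    rw [map_neg, coroot'_smul_right, inv_inv]
    refine neg_nonneg.2 (coroot'_neg_of_neg hB hq fun h => ?_)
    exact (hw k).1 h (mem_posRoots_of_mem hk)
  have h0 : P.coroot' j q = 0 := by
    refine coroot'_eq_zero_of_fixed hB hq hjq hj ?_
    rw [refl_smul_idx_self]
    exact neg_notMem_posRoots hB (mem_posRoots_of_mem hj)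
  have h1 : P.coroot' (neg P (w⁻¹ • j)) (-(w⁻¹ • q)) = 0 := by
    rw [coroot'_neg, LinearMap.neg_apply, map_neg, neg_neg, coroot'_smul, h0]
  obtain ⟨c, -, hc, hx⟩ := exists_simple_of_coroot'_eq_zero hq' hγ h1
  obtain ⟨k, hk⟩ : ∃ k, c k ≠ 0 := by
    by_contra! hcon
    apply coroot'_ne_zero (P := P) (neg P (w⁻¹ • j))
    rw [hx]; simp [hcon]
  obtain ⟨hkB, hk0⟩ := hc k hk
  refine ⟨k, hkB, ?_⟩
  have h2 : refl P (w • k) • q = q := by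
    rw [map_neg, neg_eq_zero, coroot'_smul_right, inv_inv] at hk0
    rw [refl_smul, hk0, zero_smul, sub_zero]
  rcases hstab _ h2 with h | h
  · exact absurd h (refl_ne_one _)
  · rw [refl_smul_index] at h
    rw [← h]; group

end Opposition

section Branching

open Classical

variable {ι : Type*} {F : Subfield ℝ} {M N Λ : Type*}
  [AddCommGroup M] [Module F M] [AddCommGroup N] [Module F N]
  [AddCommGroup Λ] [LinearOrder Λ] [Module F Λ]
  {X : Type*}
  {P : RootPairing ι F M N} {B : Set ι}
  {T : AddSubgroup (ModelSpace F M Λ)} {𝒜 : Set (ModelSpace F M Λ → X)}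
  [Finite ι] [P.IsRootSystem] [IsOrderedAddMonoid Λ] [IsOrderedModule F Λ]

namespace Setup

variable (H : Setup P B T 𝒜)
include H

/-- The hypothesis on `v` says that the `v`-chamber lies on the same side of the `j`-wall as `f`.
Along a gallery on this side the distance from `g` cannot stay constant, since comparison with the
distance from `f` would force a crossing of that wall or `s_k = 1`. -/
lemma delta_gallery {f g : ModelSpace F M Λ → X} (hf : f ∈ 𝒜) (hg : g ∈ 𝒜) {j : ι} (hj : j ∈ B)
    (h : Delta P B 𝒜 f g (refl P j)) (v : P.weylGroup) (hv : v⁻¹ • j ∈ posRoots P B) :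
    Delta P B 𝒜 g (tw f v) (refl P j * v) := by
  induction v using weyl_induction H.basis with
  | one => simpa using H.delta_symm h
  | step v k hk hvk _ ih =>
    -- A minimal gallery ending on the positive side never leaves it: otherwise this step would
    -- cross the `j`-wall back, and `v • k` would be a positive multiple of `-α_j`.
    have hv' : v⁻¹ • j ∈ posRoots P B := by
      by_contra hn
      have h1 : refl P k • ((v * refl P k)⁻¹ • j) = v⁻¹ • j := by
        rw [← mul_smul, mul_inv_rev, refl_inv, ← mul_assoc, refl_mul_self, one_mul]
      obtain ⟨c, hc, hcr⟩ := exists_root_eq_smul_of_refl_smul H.basis hk hv (by rw [h1]; exact hn)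
      have h2 : P.root (neg P j) = c • P.root (v • k) := by
        have h3 : j = v • refl P k • ((v * refl P k)⁻¹ • j) := by rw [h1, smul_inv_smul]
        rw [root_neg, h3, root_smul, root_smul, hcr, smul_comm _ c, ← root_smul, refl_smul_idx_self,
          smul_comm v c, root_smul v, root_neg]
        simp
      exact neg_notMem_posRoots H.basis (mem_posRoots_of_mem hj)
        (mem_posRoots_of_root_eq_smul hc h2 hvk)
    have hv1 := H.tw_mem hf v
    have hv2 := H.tw_mem hf (v * refl P k)
    obtain ⟨x, hx⟩ := H.exists_delta hg hv2
    have hadj : Delta P B 𝒜 (tw f v) (tw f (v * refl P k)) (refl P k) := by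
      simpa using H.delta_tw hf v (v * refl P k)
    rcases H.delta_adjacent hg hv1 hv2 (ih hv') hx hk hadj (Or.inr rfl) with rfl | rfl
    · exfalso
      rcases H.delta_adjacent_left hf hg hv2 (H.delta_self_tw hf _) hx hj h (Or.inr rfl) with h1 | h1
      · have h2 : refl P (v⁻¹ • j) = refl P k := by
          rw [refl_smul_index, inv_inv, mul_assoc, h1]; group
        have h3 : (v * refl P k)⁻¹ • j = neg P (v⁻¹ • j) := by
          rw [mul_inv_rev, mul_smul, refl_inv, ← h2, refl_smul_idx_self]
        rw [h3] at hv
        exact neg_notMem_posRoots H.basis hv' hv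
      · have := mul_left_cancel h1
        exact refl_ne_one k (left_eq_mul.1 this)
    · rwa [mul_assoc] at hx

/-- The Weyl distance grows along a gallery moving away. -/
lemma delta_away {e c c' : ModelSpace F M Λ → X} (hc' : c' ∈ 𝒜)
    {x : P.weylGroup} {j : ι} (hj : j ∈ B) (h1 : Delta P B 𝒜 e c x)
    (h2 : Delta P B 𝒜 c c' (refl P j)) (hx : x • j ∈ posRoots P B) :
    Delta P B 𝒜 e c' (x * refl P j) := by
  obtain ⟨h, hh, e1, e2⟩ := h1
  have h3 := H.delta_gallery (H.tw_mem hh x) hc' hj (H.delta_congr h2 e2 (Asy.refl _)) x⁻¹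
    (by simpa using hx)
  rw [tw_tw, mul_inv_cancel, tw_one] at h3
  have := H.delta_symm (H.delta_congr h3 (Asy.refl _) e1.symm)
  simpa using this

omit [Finite ι] [P.IsRootSystem] [IsOrderedAddMonoid Λ] [IsOrderedModule F Λ] H in
lemma asy_tw_of_eq_on {f h : ModelSpace F M Λ → X} (w : P.weylGroup) {k k' : ModelSpace F M Λ}
    (hk : ∀ u ∈ chamber P B Λ, f (k + w • u) = h (k' + w • u)) : Asy P B (tw f w) (tw h w) :=
  ⟨w⁻¹ • k, w⁻¹ • k', fun u hu => by simpa [smul_add] using hk u hu⟩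

/-- If the chamber at infinity of `g` is adjacent to the one of `f` and not contained in the apartment
of `f`, there is an apartment containing a half-apartment of `f` and the chamber of `g`. -/
lemma exists_branch {f g : ModelSpace F M Λ → X} (hf : f ∈ 𝒜) (hg : g ∈ 𝒜) {j : ι} (hj : j ∈ B)
    (h : Delta P B 𝒜 f g (refl P j)) (hne : ¬ Asy P B g (tw f (refl P j))) {w : P.weylGroup}
    (hw : ∀ i, w • i ∈ posRoots P B ↔ i ∉ posRoots P B) :
    ∃ h ∈ 𝒜, ∃ l, (∀ x, f x ∈ Set.range h ↔ l ≤ ev P j x) ∧ (∀ x, l ≤ ev P j x → f x = h x) ∧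
      Asy P B g (tw h (refl P j)) ∧ Asy P B f h ∧
      Asy P B (tw f (refl P j * w)) (tw h (refl P j * w)) := by
  obtain ⟨l₀, h₀⟩ := H.exists_pos
  have hv : (refl P j * w)⁻¹ • j ∈ posRoots P B := by
    rw [mul_inv_rev, mul_smul, refl_inv, refl_smul_idx_self, smul_neg, neg_mem_posRoots_iff H.basis,
      ← hw, smul_inv_smul]
    exact mem_posRoots_of_mem hj
  have he := H.tw_mem hf (refl P j * w)
  have h1 := H.delta_gallery hf hg hj h _ hv
  rw [← mul_assoc, refl_mul_self, one_mul] at h1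
  -- The chamber `s_j w` of `f` lies on the side of `f`, so by the gallery lemma it is at the
  -- longest distance `w` from `g`. The apartment `m` spanned by this opposite pair is the branch;
  -- `n` is re-indexed to start at the neighbour of `g`.
  obtain ⟨m, hm, e1, e2⟩ := h1
  have hh := H.tw_mem hm (refl P j)
  set n := tw m (refl P j) with hn
  have e1' : Asy P B g (tw n (refl P j)) := by simpa [hn] using e1
  have e2' : Asy P B (tw f (refl P j * w)) (tw n (refl P j * w)) := by
    rw [hn, tw_tw, ← mul_assoc, refl_mul_self, one_mul]; exact e2
  have hgn : Delta P B 𝒜 g n (refl P j) := by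
    have := H.delta_tw hh (refl P j) 1
    rw [mul_one, refl_inv, tw_one] at this
    exact H.delta_congr this e1'.symm (Asy.refl _)
  obtain ⟨y, hy⟩ := H.exists_delta hf hh
  -- Both `f` and `n` are `j`-adjacent to `g`, so their distance is `1` or `s_j`. The value `s_j`
  -- would move `n` further from the chamber `s_j w`, contradicting its distance within the branch.
  have hfn : Asy P B f n := by
    rcases H.delta_adjacent hf hg hh h hy hj hgn (Or.inr rfl) with rfl | rfl
    · exfalso
      have h2 := H.delta_symm (H.delta_self_tw hf (refl P j * w))
      have h3 := H.delta_away hh hj h2 hy hv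
      have h4 := H.delta_congr (H.delta_symm (H.delta_self_tw hh (refl P j * w))) e2'.symm (Asy.refl _)
      have := H.delta_unique h3 h4
      exact refl_ne_one j (mul_eq_left.1 this)
    · rw [refl_mul_self] at hy
      exact (H.delta_one_iff hf).1 hy
  obtain ⟨h', hh', e3, ⟨t, rfl⟩, hr, hag, k, hk⟩ := H.asy_normalize hf hh hfn
  have e3' : ∀ v : P.weylGroup, Asy P B (tw n v) (tw (fun u => n (u + t)) v) := fun v =>
    asy_tw_of_eq_on v (k := t) (k' := 0) fun u _ => by simp [add_comm]
  obtain ⟨k₁, k₂, hk12⟩ := H.asy_trans e2' (e3' _)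
  have hconv := H.convex hf hh' (hk 0 zero_mem_chamber)
  have hgn' : Asy P B g (tw (fun u => n (u + t)) (refl P j)) := H.asy_trans e1' (e3' _)
  refine ⟨_, hh', ?_⟩
  rcases hconv.eq_halfSpace H.basis h₀ hw hj (k := k) (k' := (refl P j * w) • k₁)
    (fun u hu => ⟨_, (hk u hu).symm⟩) (fun u hu => by
      rw [← smul_add]; exact ⟨_, (hk12 u hu).symm⟩) with h2 | ⟨l, h2⟩
  · exfalso
    apply hne
    have h3 : f = fun u => n (u + t) := funext fun x => hag x (by
      have : x ∈ f ⁻¹' Set.range fun u => n (u + t) := by rw [h2]; trivial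
      exact this)
    rw [h3]; exact hgn'
  · have h3 : ∀ x, f x ∈ Set.range (fun u => n (u + t)) ↔ l ≤ ev P j x := fun x => by
      change x ∈ f ⁻¹' Set.range (fun u => n (u + t)) ↔ _
      rw [h2]; rfl
    exact ⟨l, h3, fun x hx => hag x ((h3 x).2 hx), hgn', H.asy_trans hfn e3, H.asy_trans e2' (e3' _)⟩

/-- The two apartments containing the chamber at infinity of `g` and a half-apartment of `f` cover the
apartment of `f`. -/
lemma exists_branches {f g : ModelSpace F M Λ → X} (hf : f ∈ 𝒜) (hg : g ∈ 𝒜) {j : ι} (hj : j ∈ B)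
    (h : Delta P B 𝒜 f g (refl P j)) (hne : ¬ Asy P B g (tw f (refl P j))) :
    ∃ h₁ ∈ 𝒜, ∃ h₂ ∈ 𝒜, ∃ m₁ m₂ : Λ, m₁ ≤ m₂ ∧
      (∀ x, m₁ ≤ ev P j x → f x = h₁ x) ∧ Asy P B g (tw h₁ (refl P j)) ∧
      (∀ x, ev P j x ≤ m₂ → f x = h₂ x) ∧ Asy P B g h₂ := by
  obtain ⟨l₀, h₀⟩ := H.exists_pos
  obtain ⟨w, hw⟩ := exists_opposition H.basis
  obtain ⟨h₁, hh₁, m₁, r₁, a₁, g₁, f₁, o₁⟩ := H.exists_branch hf hg hj h hne hw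
  have hf' := H.tw_mem hf (refl P j)
  have hff' := H.delta_self_tw hf (refl P j)
  have hfng : ¬ Asy P B g f := fun h' => by
    have h1 := H.delta_unique h ((H.delta_one_iff hf).2 h'.symm)
    exact refl_ne_one j h1
  have hnf : ¬ Asy P B f (tw f (refl P j)) := fun h' =>
    refl_ne_one j (H.delta_unique hff' ((H.delta_one_iff hf).2 h'))
  -- The second branch comes from the first construction with `f` replaced by its reflected chart,
  -- for which the two sides of the wall are exchanged.
  have h' : Delta P B 𝒜 (tw f (refl P j)) g (refl P j) := by
    obtain ⟨y, hy⟩ := H.exists_delta hf' hg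
    rcases H.delta_adjacent_left hf hf' hg h hy hj hff' (Or.inr rfl) with rfl | rfl
    · exact hy
    · rw [refl_mul_self] at hy
      exact absurd ((H.delta_one_iff hf').1 hy).symm hne
  obtain ⟨n, hn, m₂, r₂, a₂, g₂, f₂, o₂⟩ := H.exists_branch hf' hg hj h' (by simpa using hfng) hw
  have hh₂ := H.tw_mem hn (refl P j)
  have hev : ∀ x : ModelSpace F M Λ, ev P j (refl P j • x) = - ev P j x := fun x => by
    rw [ev_smul_right, refl_inv, refl_smul_idx_self, ev_neg]
  -- a common chamber of the two new apartments opposite to the chamber of `g`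
  obtain ⟨k, hk, hkj⟩ := exists_opposite_simple H.basis hw hj
  have hwk : refl P j * w = w * refl P k := by rw [← hkj]; group
  have hE : Asy P B (tw h₁ w) (tw n w) := by
    -- The `w`-chambers of `h₁`, `f` and `n` share a panel of type `k`, so those of `h₁` and `n`
    -- have distance `1` or `s_k`. Both have distance `s_j w` from `g`, and a `k`-step from there
    -- increases the distance, which rules out `s_k`.
    have q₁ : Delta P B 𝒜 (tw h₁ w) (tw f (refl P j * w)) (refl P k) := by
      have := H.delta_tw hh₁ w (refl P j * w)
      rw [hwk, inv_mul_cancel_left] at this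
      rw [hwk] at o₁
      rw [hwk]
      exact H.delta_congr this (Asy.refl _) o₁.symm
    have q₂ : Delta P B 𝒜 (tw f (refl P j * w)) (tw f w) (refl P k) := by
      have := H.delta_tw hf (refl P j * w) w
      rw [hwk] at this ⊢
      simpa using this
    have q₃ : Delta P B 𝒜 (tw f w) (tw n w) (refl P k) := by
      have := H.delta_tw hn (refl P j * w) w
      rw [tw_tw, ← mul_assoc, refl_mul_self, one_mul] at o₂
      rw [hwk] at this o₂
      have := H.delta_congr this o₂.symm (Asy.refl _)
      simpa using this
    have c₁ := H.tw_mem hh₁ w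
    have c₂ := H.tw_mem hf (refl P j * w)
    have c₃ := H.tw_mem hf w
    have c₄ := H.tw_mem hn w
    obtain ⟨y, hy⟩ := H.exists_delta c₁ c₃
    obtain ⟨z, hz⟩ := H.exists_delta c₁ c₄
    have hy' : y = refl P k ∨ y = 1 := by
      rcases H.delta_adjacent c₁ c₂ c₃ q₁ hy hk q₂ (Or.inr rfl) with h | h
      · exact Or.inl h
      · right; rw [h, refl_mul_self]
    have hz' : z = 1 ∨ z = refl P k := by
      rcases H.delta_adjacent c₁ c₃ c₄ hy hz hk q₃ (Or.inr rfl) with h | h <;>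
      rcases hy' with rfl | rfl <;> simp [h]
    rcases hz' with rfl | rfl
    · exact (H.delta_one_iff c₁).1 hz
    · exfalso
      have d₁ : Delta P B 𝒜 g (tw h₁ w) (refl P j * w) := by
        have := H.delta_tw hh₁ (refl P j) w
        rw [refl_inv] at this
        exact H.delta_congr this g₁.symm (Asy.refl _)
      have d₂ : Delta P B 𝒜 g (tw n w) (refl P j * w) := by
        have := H.delta_tw hn (refl P j) w
        rw [refl_inv] at this
        exact H.delta_congr this g₂.symm (Asy.refl _)
      have hpos : (refl P j * w) • k ∈ posRoots P B := by
        rw [hwk, mul_smul, refl_smul_idx_self, smul_neg, neg_mem_posRoots_iff H.basis, hw]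
        exact not_not.2 (mem_posRoots_of_mem hk)
      have := H.delta_unique d₂ (H.delta_away c₄ hk d₁ hz hpos)
      exact refl_ne_one k (left_eq_mul.1 this)
  -- the two new apartments meet in a half-apartment
  have hb₁ := H.tw_mem hh₁ (refl P j)
  obtain ⟨n', hn', e3, ⟨t, rfl⟩, hr, hag, k₀, hk₀⟩ :=
    H.asy_normalize hb₁ hh₂ (H.asy_trans g₁.symm g₂)
  have e3' : ∀ v : P.weylGroup, Asy P B (tw n (refl P j * v))
      (tw (fun u => tw n (refl P j) (u + t)) v) := fun v => by
    rw [← tw_tw]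
    exact asy_tw_of_eq_on v (k := t) (k' := 0) fun u _ => by simp [add_comm]
  have hE' : Asy P B (tw (tw h₁ (refl P j)) (refl P j * w))
      (tw (fun u => tw n (refl P j) (u + t)) (refl P j * w)) := by
    have e4 := e3' (refl P j * w)
    rw [← mul_assoc, refl_mul_self, one_mul] at e4
    rw [tw_tw, ← mul_assoc, refl_mul_self, one_mul]
    exact H.asy_trans hE e4
  obtain ⟨k₁, k₂, hk12⟩ := hE'
  have hconv := H.convex hb₁ hn' (hk₀ 0 zero_mem_chamber)
  have hhalf : ∃ l, (tw h₁ (refl P j)) ⁻¹' Set.range (fun u => tw n (refl P j) (u + t)) =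
      halfSpace P j l := by
    rcases hconv.eq_halfSpace H.basis h₀ hw hj (k := k₀) (k' := (refl P j * w) • k₁)
      (fun u hu => ⟨_, (hk₀ u hu).symm⟩) (fun u hu => by
        rw [← smul_add]; exact ⟨_, (hk12 u hu).symm⟩) with h2 | h2
    -- If the two branches coincided, the chambers at infinity of `f` and of `f ∘ s_j` would be
    -- equal.
    · exfalso
      apply hnf
      have h3 : tw h₁ (refl P j) = fun u => tw n (refl P j) (u + t) := funext fun x => hag x (by
        have : x ∈ tw h₁ (refl P j) ⁻¹' Set.range fun u => tw n (refl P j) (u + t) := by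
          rw [h2]; trivial
        exact this)
      have h4 := e3' (refl P j)
      rw [← h3, refl_mul_self, tw_one, tw_tw, refl_mul_self, tw_one] at h4
      exact H.asy_trans f₁ (H.asy_trans h4.symm f₂.symm)
    · exact h2
  obtain ⟨l, hl⟩ := hhalf
  have inter : ∀ a b : ModelSpace F M Λ → X, Set.range a ∩ Set.range b = a '' (a ⁻¹' Set.range b) :=
    fun a b => by rw [Set.image_preimage_eq_inter_range, Set.inter_comm]
  have hfn : ∀ x, f x ∈ Set.range n ↔ m₂ ≤ - ev P j x := fun x => by
    rw [← hev, ← r₂, tw_apply, refl_refl_smul]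
  -- The apartments of `f` and of the two branches meet pairwise in half-apartments. A common point
  -- from (A6) has `m₁ ≤ ⟨u, α_j∨⟩ ≤ -m₂`, so the two halves of `f` overlap and cover it.
  obtain ⟨x, ⟨⟨u, rfl⟩, hx1⟩, hx2⟩ := H.building.inter_nonempty f hf _ hb₁ _ hn'
    ⟨_, ⟨j, m₁, rfl⟩, by
      rw [inter, range_tw]
      congr 1
      ext x; exact r₁ x⟩
    ⟨_, ⟨j, l, rfl⟩, by rw [inter, hl]⟩
    ⟨_, ⟨neg P j, m₂, rfl⟩, by
      rw [inter, hr, range_tw]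
      congr 1
      ext x
      rw [Set.mem_preimage, hfn, halfSpace, Set.mem_ofPred_eq, ev_neg]⟩
  rw [range_tw, r₁] at hx1
  rw [hr, range_tw, hfn] at hx2
  refine ⟨h₁, hh₁, tw n (refl P j), hh₂, m₁, -m₂, hx1.trans (le_neg_of_le_neg hx2), a₁, g₁,
    fun x hx => ?_, g₂⟩
  have := a₂ (refl P j • x) (by rw [hev]; exact le_neg_of_le_neg hx)
  rwa [tw_apply, refl_refl_smul] at this

end Setup

end Branching

/-! ### Transport of chambers and germs along galleries -/

section Transport

open Classical

variable {ι : Type*} {F : Subfield ℝ} {M N Λ : Type*}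
  [AddCommGroup M] [Module F M] [AddCommGroup N] [Module F N]
  [AddCommGroup Λ] [LinearOrder Λ] [Module F Λ]
  {X : Type*}
  {P : RootPairing ι F M N} {B : Set ι}
  {T : AddSubgroup (ModelSpace F M Λ)} {𝒜 : Set (ModelSpace F M Λ → X)}
  [Finite ι] [IsOrderedAddMonoid Λ]

/-- The chambers `f (u + v C)` and `g (u' + v' C)` have the same germ at their base points. -/
def Near (P : RootPairing ι F M N) (B : Set ι) (f : ModelSpace F M Λ → X) (u : ModelSpace F M Λ)
    (v : P.weylGroup) (g : ModelSpace F M Λ → X) (u' : ModelSpace F M Λ) (v' : P.weylGroup) : Prop :=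
  ∃ ε : Λ, 0 < ε ∧ ∀ a ∈ chamber P B Λ, vnorm P B a < ε → f (u + v • a) = g (u' + v' • a)

omit [IsOrderedAddMonoid Λ] in
lemma Near.trans {f g h : ModelSpace F M Λ → X} {u u' u'' : ModelSpace F M Λ}
    {v v' v'' : P.weylGroup} (h₁ : Near P B f u v g u' v') (h₂ : Near P B g u' v' h u'' v'') :
    Near P B f u v h u'' v'' := by
  obtain ⟨ε, hε, h₁⟩ := h₁
  obtain ⟨δ, hδ, h₂⟩ := h₂
  exact ⟨min ε δ, lt_min hε hδ, fun a ha hn =>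
    (h₁ a ha (hn.trans_le (min_le_left _ _))).trans (h₂ a ha (hn.trans_le (min_le_right _ _)))⟩

variable [P.IsRootSystem] [IsOrderedModule F Λ]

namespace Setup

variable (H : Setup P B T 𝒜)
include H

omit [P.IsRootSystem] [IsOrderedModule F Λ] in
lemma near_of_eq {f g : ModelSpace F M Λ → X} {u u' : ModelSpace F M Λ}
    {v v' : P.weylGroup} (h : ∀ a ∈ chamber P B Λ, f (u + v • a) = g (u' + v' • a)) :
    Near P B f u v g u' v' := by
  obtain ⟨l₀, h₀⟩ := H.exists_pos
  exact ⟨l₀, h₀, fun a ha _ => h a ha⟩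

/-- One of the two branches contains `f u`. A vector fixed by `s_j` is parallel to the wall, so
adding it stays in the same half. -/
lemma exists_adjacent_at {f g : ModelSpace F M Λ → X} (hf : f ∈ 𝒜) (hg : g ∈ 𝒜) {j : ι} (hj : j ∈ B)
    (h : Delta P B 𝒜 f g (refl P j)) (u : ModelSpace F M Λ) :
    ∃ h ∈ 𝒜, ∃ u', Asy P B h g ∧ h u' = f u ∧
      ∀ q ∈ chamber P B Λ, refl P j • q = q → h (u' + q) = f (u + q) := by
  by_cases hne : Asy P B g (tw f (refl P j))
  · exact ⟨_, H.tw_mem hf _, refl P j • u, hne.symm, by simp, fun q _ hq => by simp [smul_add, hq]⟩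
  obtain ⟨h₁, hh₁, h₂, hh₂, m₁, m₂, hm, a₁, g₁, a₂, g₂⟩ := H.exists_branches hf hg hj h hne
  have hev : ∀ q : ModelSpace F M Λ, refl P j • q = q → ev P j q = 0 := fun q hq => by
    have h1 : ev P j q = - ev P j q := by
      conv_lhs => rw [← hq, ev_smul_right, refl_inv, refl_smul_idx_self, ev_neg]
    exact self_eq_neg.1 h1
  rcases le_total m₁ (ev P j u) with hu | hu
  · refine ⟨_, H.tw_mem hh₁ (refl P j), refl P j • u, g₁.symm, by simp [a₁ u hu], fun q _ hq => ?_⟩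
    rw [a₁ _ (by rw [map_add, hev q hq, add_zero]; exact hu)]
    simp [smul_add, hq]
  · refine ⟨_, hh₂, u, g₂.symm, (a₂ u (hu.trans hm)).symm, fun q _ hq => ?_⟩
    rw [a₂ _ (by rw [map_add, hev q hq, add_zero]; exact hu.trans hm)]

/-- Every chamber at infinity has a representative based at a given point; it shares the faces which
are common at infinity with the given chamber at this point. -/
lemma exists_chamber_at {f g : ModelSpace F M Λ → X} (hf : f ∈ 𝒜) (hg : g ∈ 𝒜) {w : P.weylGroup}
    (h : Delta P B 𝒜 f g w) (u : ModelSpace F M Λ) :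
    ∃ h ∈ 𝒜, ∃ u', Asy P B h g ∧ h u' = f u ∧
      ∀ q ∈ chamber P B Λ, w • q = q → h (u' + q) = f (u + q) := by
  induction w using weyl_induction H.basis generalizing g with
  | one =>
    obtain ⟨g', hg', h1, ⟨t, rfl⟩, -⟩ := H.asy_normalize hf hg ((H.delta_one_iff hf).1 h)
    exact ⟨f, hf, u, (H.delta_one_iff hf).1 h, rfl, fun _ _ _ => rfl⟩
  | step w k hk hp _ ih =>
    obtain ⟨m, hm, e1, e2⟩ := h
    obtain ⟨h', hh', u', a', b', c'⟩ := ih (H.tw_mem hm w)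
      (H.delta_congr (H.delta_self_tw hm w) e1.symm (Asy.refl _))
    have hd : Delta P B 𝒜 h' g (refl P k) := by
      have := H.delta_congr (H.delta_tw hm w (w * refl P k)) a'.symm e2.symm
      simpa using this
    obtain ⟨h'', hh'', u'', a'', b'', c''⟩ := H.exists_adjacent_at hh' hg hk hd u'
    refine ⟨h'', hh'', u'', a'', b''.trans b', fun q hq hfix => ?_⟩
    -- Since the word is reduced, an element `w s_k` fixing the dominant `q` has both `s_k` and `w`
    -- fixing it, so agreement on `q` persists through both moves.
    have h0 : ev P k q = 0 := ev_eq_zero_of_fixed H.basis hq hfix (mem_posRoots_of_mem hk) (by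
      rw [mul_smul, refl_smul_idx_self, smul_neg]
      exact neg_notMem_posRoots H.basis hp)
    have h1 := refl_smul_of_ev_eq_zero h0
    rw [mul_smul, h1] at hfix
    rw [c'' q hq h1, c' q hq hfix]

/-- The outcome depends on the side to which the `w`-chamber points and on which half contains `u`.
If the chamber points into a half containing `u`, it lies there entirely. Otherwise `u` is strictly
away from the relevant boundary and a whole germ fits into the other branch, the radius being the
gap in the `j`-coordinate. -/
lemma exists_adjacent_germ {f g : ModelSpace F M Λ → X} (hf : f ∈ 𝒜) (hg : g ∈ 𝒜) {j : ι} (hj : j ∈ B)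
    (h : Delta P B 𝒜 f g (refl P j)) (u : ModelSpace F M Λ) (w : P.weylGroup) :
    ∃ h ∈ 𝒜, ∃ u', Asy P B h g ∧ h u' = f u ∧
      ((∀ a ∈ chamber P B Λ, f (u + w • a) = h (u' + (refl P j * w) • a)) ∨
      Near P B f u w h u' w ∨
      (w⁻¹ • j ∉ posRoots P B ∧ Near P B f u w h u' (refl P j * w))) := by
  obtain ⟨l₀, h₀⟩ := H.exists_pos
  by_cases hne : Asy P B g (tw f (refl P j))
  · exact ⟨_, H.tw_mem hf _, refl P j • u, hne.symm, by simp, Or.inl fun a _ => by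
      simp [smul_add, mul_smul]⟩
  obtain ⟨h₁, hh₁, h₂, hh₂, m₁, m₂, hm, a₁, g₁, a₂, g₂⟩ := H.exists_branches hf hg hj h hne
  have habs : ∀ a : ModelSpace F M Λ, |ev P j (w • a)| ≤ vnorm P B a := fun a => by
    rw [← vnorm_smul H.basis w]; exact abs_ev_le_vnorm H.basis j _
  by_cases hw : w⁻¹ • j ∈ posRoots P B
  · have hpos : ∀ a ∈ chamber P B Λ, 0 ≤ ev P j (w • a) := fun a ha => by
      rw [ev_smul_right]; exact mem_chamber.1 ha _ hw
    rcases le_or_gt m₁ (ev P j u) with hu | hu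
    · refine ⟨_, H.tw_mem hh₁ (refl P j), refl P j • u, g₁.symm, by simp [a₁ u hu], Or.inl fun a ha => ?_⟩
      rw [a₁ _ (by rw [map_add]; exact hu.trans (le_add_of_nonneg_right (hpos a ha)))]
      simp [smul_add, mul_smul]
    · refine ⟨_, hh₂, u, g₂.symm, (a₂ u (hu.le.trans hm)).symm, Or.inr (Or.inl
        ⟨m₁ - ev P j u, sub_pos.2 hu, fun a ha hn => a₂ _ ?_⟩)⟩
      rw [map_add]
      have h1 := (le_abs_self _).trans ((habs a).trans hn.le)
      exact (add_le_add le_rfl h1).trans (by rw [add_sub_cancel]; exact hm)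
  · have hneg : ∀ a ∈ chamber P B Λ, ev P j (w • a) ≤ 0 := fun a ha => by
      rw [ev_smul_right]; exact ev_nonpos_of_neg H.basis ha hw
    rcases le_or_gt (ev P j u) m₂ with hu | hu
    · refine ⟨_, hh₂, u, g₂.symm, (a₂ u hu).symm, Or.inr (Or.inl (H.near_of_eq fun a ha => a₂ _ ?_))⟩
      rw [map_add]; exact (add_le_of_nonpos_right (hneg a ha)).trans hu
    · refine ⟨_, H.tw_mem hh₁ (refl P j), refl P j • u, g₁.symm, by simp [a₁ u (hm.trans hu.le)],
        Or.inr (Or.inr ⟨hw, ev P j u - m₂, sub_pos.2 hu, fun a ha hn => ?_⟩)⟩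
      rw [a₁]
      · simp [smul_add, mul_smul]
      · rw [map_add]
        have h1 := (neg_abs_le (ev P j (w • a)))
        have h2 := neg_le_neg ((habs a).trans hn.le)
        have h3 := add_le_add (le_refl (ev P j u)) (h2.trans h1)
        rw [neg_sub, add_sub_cancel] at h3
        exact hm.trans h3

/-- Either the chamber of `g` at infinity and the chamber `f (u + C)` lie in a common apartment, or some
apartment contains the former together with the germ of the latter, at a smaller Weyl distance. -/
lemma exists_chamber_germ {f g : ModelSpace F M Λ → X} (hf : f ∈ 𝒜) (hg : g ∈ 𝒜) {v : P.weylGroup}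
    (h : Delta P B 𝒜 f g v) (u : ModelSpace F M Λ) :
    ∃ h ∈ 𝒜, ∃ u', Asy P B h g ∧ h u' = f u ∧
      ((∀ a ∈ chamber P B Λ, f (u + a) = h (u' + v⁻¹ • a)) ∨
      ∃ w, len P B w < len P B v ∧ Near P B f u 1 h u' w) := by
  induction v using weyl_induction H.basis generalizing g with
  | one =>
    exact ⟨f, hf, u, (H.delta_one_iff hf).1 h, rfl, Or.inl fun a _ => by simp⟩
  | step v k hk hp hlen ih =>
    obtain ⟨m, hm, e1, e2⟩ := h
    obtain ⟨h', hh', u', a', b', c'⟩ := ih (H.tw_mem hm v)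
      (H.delta_congr (H.delta_self_tw hm v) e1.symm (Asy.refl _))
    have hd : Delta P B 𝒜 h' g (refl P k) := by
      have := H.delta_congr (H.delta_tw hm v (v * refl P k)) a'.symm e2.symm
      simpa using this
    have hle : ∀ w, len P B (refl P k * w) ≤ 1 + len P B w := fun w =>
      (len_mul_le H.basis _ _).trans (Nat.add_le_add_right (len_refl_le hk) _)
    -- Each step lengthens `v` by one and the relative position of the germ by at most one, so a
    -- deficit persists. Starting from a full chamber, the third outcome is excluded because `v • k`
    -- is positive, and keeping the germ direction `v⁻¹` creates a deficit.
    rcases c' with c' | ⟨w, hw, c'⟩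
    · obtain ⟨h'', hh'', u'', a'', b'', c''⟩ := H.exists_adjacent_germ hh' hg hk hd u' v⁻¹
      refine ⟨h'', hh'', u'', a'', b''.trans b', ?_⟩
      have hn : Near P B f u 1 h' u' v⁻¹ := H.near_of_eq fun a ha => by
        rw [one_smul]; exact c' a ha
      rcases c'' with c'' | c'' | ⟨hneg, -⟩
      · left
        intro a ha
        rw [c' a ha, c'' a ha, mul_inv_rev, refl_inv]
      · right
        exact ⟨v⁻¹, by rw [len_inv H.basis]; omega, hn.trans c''⟩
      · rw [inv_inv] at hneg
        exact absurd hp hneg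
    · obtain ⟨h'', hh'', u'', a'', b'', c''⟩ := H.exists_adjacent_germ hh' hg hk hd u' w
      refine ⟨h'', hh'', u'', a'', b''.trans b', Or.inr ?_⟩
      have := hle w
      rcases c'' with c'' | c'' | ⟨-, c''⟩
      · exact ⟨refl P k * w, by omega, c'.trans (H.near_of_eq c'')⟩
      · exact ⟨w, by omega, c'.trans c''⟩
      · exact ⟨refl P k * w, by omega, c'.trans c''⟩

end Setup

end Transport

/-! ### Faces of the fundamental chamber and the Weyl group -/

section Faces

open Classical

variable {ι : Type*} {F : Subfield ℝ} {M N Λ : Type*}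
  [AddCommGroup M] [Module F M] [AddCommGroup N] [Module F N]
  [AddCommGroup Λ] [LinearOrder Λ] [Module F Λ]
  {P : RootPairing ι F M N} {B : Set ι}
  [Finite ι] [P.IsRootSystem] [IsOrderedAddMonoid Λ] [IsOrderedModule F Λ]

/-- The stabilizer of a dominant vector is generated by the simple reflections fixing it, and these
have type in `J`, so they fix the face pointwise. -/
lemma smul_eq_of_mem_face (hB : IsBasis P B) {J : Set ι} {q : M} (hq : ∀ j ∈ B, 0 ≤ P.coroot' j q)
    (hJ : ∀ j ∈ B, P.coroot' j q = 0 → j ∈ J) {w : P.weylGroup} (hw : w • q = q)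
    {u : ModelSpace F M Λ} (hu : u ∈ face P B J) : w • u = u := by
  induction w using weyl_induction hB with
  | one => simp
  | step g j hj hp _ ih =>
    have hn : (g * refl P j) • j ∉ posRoots P B := by
      rw [mul_smul, refl_smul_idx_self, smul_neg]
      exact neg_notMem_posRoots hB hp
    have h0 := coroot'_eq_zero_of_fixed hB hq hw hj hn
    have h1 : refl P j • q = q := by rw [refl_smul, h0]; simp
    rw [mul_smul, h1] at hw
    rw [mul_smul, refl_smul_of_ev_eq_zero ((mem_face.1 hu).2 j (hJ j hj h0)), ih hw]

lemma nonneg_of_smul_nonneg {c : F} {l : Λ} (hl : 0 < l) (h : 0 ≤ c • l) : 0 ≤ c := by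
  by_contra! hc
  have := smul_pos_of_pos (neg_pos.2 hc) hl
  rw [neg_smul, neg_pos] at this
  exact this.not_ge h

lemma eq_one_of_smul_chamber_subset (hB : IsBasis P B) {l₀ : Λ} (h₀ : 0 < l₀) {g : P.weylGroup}
    (h : ∀ u ∈ chamber P B Λ, g • u ∈ chamber P B Λ) : g = 1 := by
  rw [← inv_eq_one]
  refine eq_one_of_pos hB fun j hj => ?_
  refine inv_smul_mem_posRoots hB h₀ (k := 0) (l := 0) fun u hu => ?_
  rw [zero_add]
  exact mem_chamber.1 (h u hu) j (mem_posRoots_of_mem hj)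

lemma smul_eq_of_smul_tmul_mem (hB : IsBasis P B) {l₀ : Λ} (h₀ : 0 < l₀) {g : P.weylGroup} {q : M}
    (hq : ∀ j ∈ B, 0 ≤ P.coroot' j q) (h : g • (q ⊗ₜ[F] l₀) ∈ chamber P B Λ) : g • q = q := by
  refine (eq_of_smul_eq hB g hq (fun j hj => ?_) rfl).symm
  have := mem_chamber_iff_simple.1 h j hj
  rw [TensorProduct.smul_tmul', ev_tmul] at this
  exact nonneg_of_smul_nonneg h₀ this

lemma eq_one_or_refl_of_smul_panel (hB : IsBasis P B) {l₀ : Λ} (h₀ : 0 < l₀) {g : P.weylGroup} {j : ι}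
    (hj : j ∈ B) (h : ∀ u ∈ face P B (Λ := Λ) {j}, g • u ∈ chamber P B Λ) : g = 1 ∨ g = refl P j := by
  obtain ⟨q, hq, hjq, hstab⟩ := exists_panel_vector hB hj
  refine hstab g (smul_eq_of_smul_tmul_mem hB h₀ hq (h _ (mem_face.2 ⟨tmul_mem_chamber hq h₀.le, ?_⟩)))
  rintro _ rfl
  rw [ev_tmul, coroot'_eq_zero_of_fixed hB hq hjq hj, zero_smul]
  rw [refl_smul_idx_self]
  exact neg_notMem_posRoots hB (mem_posRoots_of_mem hj)

/-- A Weyl group element which moves a generic vector of the face of type `J` into the closed face of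
type `J'`, up to the order of the coefficients, fixes the face of type `J`. -/
lemma subset_and_fixes (hB : IsBasis P B) {J J' : Set ι} (hJ' : J' ⊆ B) {w : P.weylGroup} {q : M}
    (hq : ∀ j ∈ B, P.coroot' j q = if j ∈ J then 0 else 1)
    (h : ∀ j ∈ B, 0 ≤ P.coroot' j (w • q)) (h' : ∀ j ∈ J', P.coroot' j (w • q) ≤ 0) :
    J' ⊆ J ∧ ∀ u ∈ face P B (Λ := Λ) J, w • u = u := by
  have hq0 : ∀ k ∈ B, 0 ≤ P.coroot' k q := fun k hk => by rw [hq k hk]; split_ifs <;> simp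
  have hJq : ∀ j ∈ B, P.coroot' j q ≤ 0 → j ∈ J := fun j hj hl => by
    by_contra hn
    rw [hq j hj, if_neg hn] at hl
    exact (zero_lt_one (α := F)).not_ge hl
  have hw : w • q = q := (eq_of_smul_eq hB w hq0 h rfl).symm
  rw [hw] at h'
  exact ⟨fun j hj => hJq j (hJ' hj) (h' j hj),
    fun u hu => smul_eq_of_mem_face hB hq0 (fun j hj h0 => hJq j hj h0.le) hw hu⟩

lemma tmul_mem_face {J : Set ι} (hJ : J ⊆ B) {q : M}
    (hq : ∀ j ∈ B, P.coroot' j q = if j ∈ J then 0 else 1) {l : Λ} (hl : 0 ≤ l) :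
    q ⊗ₜ[F] l ∈ face P B J := by
  refine mem_face.2 ⟨tmul_mem_chamber (fun k hk => ?_) hl, fun j hj => ?_⟩
  · rw [hq k hk]; split_ifs <;> simp
  · rw [ev_tmul, hq j (hJ hj), if_pos hj, zero_smul]

lemma subset_and_fixes_of_small (hB : IsBasis P B) {J J' : Set ι} (hJ : J ⊆ B) (hJ' : J' ⊆ B)
    {w : P.weylGroup} {ε : Λ} (hε : 0 < ε)
    (h : ∀ u ∈ face P B J, vnorm P B u < ε → w • u ∈ face P B J') :
    J' ⊆ J ∧ ∀ u ∈ face P B (Λ := Λ) J, w • u = u := by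
  obtain ⟨q, hq⟩ := exists_face_vector hB J
  have hr : 0 ≤ rnorm P B q := Finset.sum_nonneg fun _ _ => abs_nonneg _
  -- Scales a generic vector of the face to norm strictly below `ε`; the `+ 1` makes the inequality
  -- strict.
  have hl : 0 < (rnorm P B q + 1)⁻¹ • ε := smul_pos_of_pos (by positivity) hε
  set l := (rnorm P B q + 1)⁻¹ • ε with hldef
  have hlt : vnorm P B (q ⊗ₜ[F] l) < ε := by
    have : ε = rnorm P B q • l + l := by
      have h1 : ε = (rnorm P B q + 1) • l := by
        rw [hldef, smul_smul, mul_inv_cancel₀ (by positivity), one_smul]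
      rwa [add_smul, one_smul] at h1
    rw [vnorm_tmul _ hl.le]
    conv_rhs => rw [this]
    exact lt_add_of_pos_right _ hl
  have h1 := mem_face.1 (h _ (tmul_mem_face hJ hq hl.le) hlt)
  rw [TensorProduct.smul_tmul'] at h1
  refine subset_and_fixes hB hJ' hq (fun j hj => ?_) fun j hj => ?_
  · have := mem_chamber_iff_simple.1 h1.1 j hj
    rw [ev_tmul] at this
    exact nonneg_of_smul_nonneg hl this
  · have := h1.2 j hj
    rw [ev_tmul] at this
    exact ((smul_eq_zero.1 this).resolve_right hl.ne').le

end Faces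

/-! ### Weyl simplices in normal form, parallel classes, representatives and germs. -/

section Simplices

open Classical

variable {ι : Type*} {F : Subfield ℝ} {M N Λ : Type*}
  [AddCommGroup M] [Module F M] [AddCommGroup N] [Module F N]
  [AddCommGroup Λ] [LinearOrder Λ] [Module F Λ]
  {X : Type*}
  {P : RootPairing ι F M N} {B : Set ι}
  {T : AddSubgroup (ModelSpace F M Λ)} {𝒜 : Set (ModelSpace F M Λ → X)}
  [Finite ι] [P.IsRootSystem] [IsOrderedAddMonoid Λ] [IsOrderedModule F Λ]

/-- The image under the chart `f` of the simplex `k + F_J`. -/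
def sx (P : RootPairing ι F M N) (B : Set ι) (f : ModelSpace F M Λ → X) (k : ModelSpace F M Λ)
    (J : Set ι) : Set X := (fun u => f (k + u)) '' face P B J

lemma mem_sx {f : ModelSpace F M Λ → X} {k u : ModelSpace F M Λ} {J : Set ι} (hu : u ∈ face P B J) :
    f (k + u) ∈ sx P B f k J := ⟨u, hu, rfl⟩

lemma sx_congr {f g : ModelSpace F M Λ → X} {k k' : ModelSpace F M Λ} {J : Set ι}
    (h : ∀ u ∈ face P B J, f (k + u) = g (k' + u)) : sx P B f k J = sx P B g k' J :=
  Set.image_congr h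

lemma image_place {f : ModelSpace F M Λ → X} {w : ModelSpace F M Λ ≃ₗ[F] ModelSpace F M Λ}
    {g : P.weylGroup} (hw : ∀ u, w u = g • u) (k : ModelSpace F M Λ) (Y : Set (ModelSpace F M Λ)) :
    f '' place w k Y = (fun u => tw f g (g⁻¹ • k + u)) '' Y := by
  rw [place, ← Set.image_comp]
  refine Set.image_congr fun u _ => ?_
  simp [hw, add_comm]

lemma image_place_one {f : ModelSpace F M Λ → X} (k : ModelSpace F M Λ) (Y : Set (ModelSpace F M Λ)) :
    f '' place 1 k Y = (fun u => f (k + u)) '' Y := by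
  rw [place, ← Set.image_comp]
  refine Set.image_congr fun u _ => ?_
  simp [add_comm]

namespace Setup

variable (H : Setup P B T 𝒜)
include H

/-- The Weyl group element is absorbed into the chart by (A1), here and in the next normal forms. -/
lemma isWeylSimplexAt_iff {J : Set ι} {x : X} {S : Set X} : IsWeylSimplexAt P B 𝒜 J x S ↔
    J ⊆ B ∧ ∃ f ∈ 𝒜, ∃ k, f k = x ∧ S = sx P B f k J := by
  refine and_congr_right fun _ => ⟨?_, ?_⟩
  · rintro ⟨f, hf, w, hw, k, rfl, rfl⟩
    obtain ⟨g, hg⟩ := mem_weyl_iff.1 hw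
    exact ⟨tw f g, H.tw_mem hf g, g⁻¹ • k, by simp, image_place hg _ _⟩
  · rintro ⟨f, hf, k, rfl, rfl⟩
    exact ⟨f, hf, 1, one_mem _, k, rfl, (image_place_one _ _).symm⟩

lemma isWeylSimplexAt_sx {f : ModelSpace F M Λ → X} (hf : f ∈ 𝒜) (k : ModelSpace F M Λ) {J : Set ι}
    (hJ : J ⊆ B) : IsWeylSimplexAt P B 𝒜 J (f k) (sx P B f k J) :=
  H.isWeylSimplexAt_iff.2 ⟨hJ, f, hf, k, rfl, rfl⟩

lemma isFaceAt_iff {x : X} {S₁ S₂ : Set X} : IsFaceAt P B 𝒜 x S₁ S₂ ↔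
    ∃ f ∈ 𝒜, ∃ k, f k = x ∧ ∃ J₁ J₂ : Set ι, J₂ ⊆ J₁ ∧ J₁ ⊆ B ∧
      S₁ = sx P B f k J₁ ∧ S₂ = sx P B f k J₂ := by
  constructor
  · rintro ⟨f, hf, w, hw, k, rfl, J₁, J₂, h1, h2, rfl, rfl⟩
    obtain ⟨g, hg⟩ := mem_weyl_iff.1 hw
    exact ⟨tw f g, H.tw_mem hf g, g⁻¹ • k, by simp, J₁, J₂, h1, h2, image_place hg _ _, image_place hg _ _⟩
  · rintro ⟨f, hf, k, rfl, J₁, J₂, h1, h2, rfl, rfl⟩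
    exact ⟨f, hf, 1, one_mem _, k, rfl, J₁, J₂, h1, h2, (image_place_one _ _).symm,
      (image_place_one _ _).symm⟩

lemma isOppositeAt_iff {w₀ : P.weylGroup} (h₀ : ∀ i, w₀ • i ∈ posRoots P B ↔ i ∉ posRoots P B) {x : X}
    {S₁ S₂ : Set X} : IsOppositeAt P B 𝒜 x S₁ S₂ ↔ ∃ f ∈ 𝒜, ∃ k, f k = x ∧
      S₁ = sx P B f k ∅ ∧ S₂ = sx P B (tw f w₀) (w₀⁻¹ • k) ∅ := by
  have hpos : ∀ i, w₀⁻¹ • i ∈ posRoots P B ↔ i ∉ posRoots P B := fun i => by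
    have := h₀ (w₀⁻¹ • i)
    rw [smul_inv_smul] at this
    tauto
  have hneg : ∀ f : ModelSpace F M Λ → X, ∀ k, (fun u => f (k + u)) '' {u | -u ∈ face P B ∅} =
      sx P B (tw f w₀) (w₀⁻¹ • k) ∅ := by
    intro f k
    have key : ∀ u : ModelSpace F M Λ, -u ∈ chamber P B Λ ↔ w₀⁻¹ • u ∈ chamber P B Λ := by
      intro u
      rw [mem_chamber, mem_chamber]
      constructor
      · intro h i hi
        rw [ev_smul_right, inv_inv]
        have hn := mt (h₀ i).1 (not_not.2 hi)
        have := h _ (neg_mem_posRoots H.basis hn)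
        simpa using this
      · intro h i hi
        have hn := mt (hpos i).1 (not_not.2 hi)
        have := h _ (neg_mem_posRoots H.basis hn)
        simpa [← smul_neg, ev_smul] using this
    ext y
    constructor
    · rintro ⟨u, hu, rfl⟩
      exact ⟨w₀⁻¹ • u, (key u).1 hu, by simp⟩
    · rintro ⟨u, hu, rfl⟩
      exact ⟨w₀ • u, (key _).2 (by simpa [chamber] using hu), by simp⟩
  constructor
  · rintro ⟨f, hf, w, hw, k, rfl, rfl, rfl⟩
    obtain ⟨g, hg⟩ := mem_weyl_iff.1 hw
    exact ⟨tw f g, H.tw_mem hf g, g⁻¹ • k, by simp, image_place hg _ _,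
      (image_place hg _ _).trans (hneg _ _)⟩
  · rintro ⟨f, hf, k, rfl, rfl, rfl⟩
    exact ⟨f, hf, 1, one_mem _, k, rfl, (image_place_one _ _).symm,
      ((image_place_one _ _).trans (hneg _ _)).symm⟩

lemma sx_tw_ne {f : ModelSpace F M Λ → X} (hf : f ∈ 𝒜) (k : ModelSpace F M Λ) {g : P.weylGroup}
    (hg : g ≠ 1) : sx P B f k ∅ ≠ sx P B (tw f g) (g⁻¹ • k) ∅ := by
  obtain ⟨l₀, h₀⟩ := H.exists_pos
  intro h
  refine hg (eq_one_of_smul_chamber_subset H.basis h₀ fun u hu => ?_)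
  have : tw f g (g⁻¹ • k + u) ∈ sx P B f k ∅ := h ▸ mem_sx hu
  obtain ⟨v, hv, he⟩ := this
  have h1 := H.inj hf he
  simp only [smul_add, smul_inv_smul, add_right_inj] at h1
  exact h1 ▸ hv

lemma isAdjacentAt_iff {x : X} {S₁ S₂ : Set X} : IsAdjacentAt P B 𝒜 x S₁ S₂ ↔
    ∃ f ∈ 𝒜, ∃ k, f k = x ∧ ∃ i ∈ B, S₁ = sx P B f k ∅ ∧
      S₂ = sx P B (tw f (refl P i)) ((refl P i)⁻¹ • k) ∅ := by
  obtain ⟨l₀, h₀⟩ := H.exists_pos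
  constructor
  · rintro ⟨hne, f, hf, w₁, hw₁, w₂, hw₂, k, rfl, rfl, rfl, i, hi, j, hj, hp⟩
    obtain ⟨g₁, hg₁⟩ := mem_weyl_iff.1 hw₁
    obtain ⟨g₂, hg₂⟩ := mem_weyl_iff.1 hw₂
    -- The panels are allowed different types `i` and `j`. Still, `g₁⁻¹g₂` maps the panel of type
    -- `j` into the chamber, so it is `1` or `s_j` by the fundamental domain property, and the value
    -- `1` is excluded by distinctness.
    have h1 : ∀ u ∈ face P B {j}, (g₁⁻¹ * g₂) • u ∈ chamber P B Λ := by
      intro u hu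
      have : w₂ u + k ∈ place w₁ k (face P B {i}) := hp ▸ ⟨u, hu, rfl⟩
      obtain ⟨v, hv, he⟩ := this
      have h2 : g₁ • v = g₂ • u := by
        rw [← hg₁, ← hg₂]
        exact add_right_cancel he
      rw [mul_smul, ← h2, inv_smul_smul]
      exact face_subset_chamber hv
    refine ⟨tw f g₁, H.tw_mem hf _, g₁⁻¹ • k, by simp, j, hj, image_place hg₁ _ _, ?_⟩
    rcases eq_one_or_refl_of_smul_panel H.basis h₀ hj h1 with h2 | h2
    · refine absurd ?_ hne
      have : g₁ = g₂ := inv_mul_eq_one.1 h2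
      rw [image_place hg₁, image_place hg₂, this]
    · have : g₂ = g₁ * refl P j := by rw [← h2, mul_inv_cancel_left]
      rw [image_place hg₂, tw_tw, this, mul_inv_rev, mul_smul]
      rfl
  · rintro ⟨f, hf, k, rfl, i, hi, rfl, rfl⟩
    refine ⟨H.sx_tw_ne hf k (refl_ne_one i), f, hf, 1, one_mem _, ?_⟩
    obtain ⟨w, hw, hg⟩ := exists_weyl (Λ := Λ) (refl P i)
    refine ⟨w, hw, k, rfl, (image_place_one _ _).symm, (image_place hg _ _).symm, i, hi, i, hi, ?_⟩
    refine Set.image_congr fun u hu => ?_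
    rw [hg, refl_smul_of_ev_eq_zero ((mem_face.1 hu).2 i rfl)]
    rfl

/-! ### Parallelism -/

lemma parallel_refl (S : Set X) : Parallel P B 𝒜 S S :=
  ⟨0, fun x hx => ⟨x, hx, (H.bdist_self x).le⟩, fun x hx => ⟨x, hx, (H.bdist_self x).le⟩⟩

omit H in
lemma _root_.AffBuilding.Parallel.symm {S S' : Set X} (h : Parallel P B 𝒜 S S') :
    Parallel P B 𝒜 S' S := by
  obtain ⟨b, h1, h2⟩ := h
  exact ⟨b, h2, h1⟩

lemma parallel_trans {S S' S'' : Set X} (h : Parallel P B 𝒜 S S') (h' : Parallel P B 𝒜 S' S'') :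
    Parallel P B 𝒜 S S'' := by
  obtain ⟨b, h1, h2⟩ := h
  obtain ⟨b', h1', h2'⟩ := h'
  refine ⟨b + b', fun x hx => ?_, fun x hx => ?_⟩
  · obtain ⟨y, hy, e⟩ := h1 x hx
    obtain ⟨z, hz, e'⟩ := h1' y hy
    exact ⟨z, hz, (H.bdist_triangle _ y _).trans (add_le_add e e')⟩
  · obtain ⟨y, hy, e⟩ := h2' x hx
    obtain ⟨z, hz, e'⟩ := h2 y hy
    exact ⟨z, hz, (H.bdist_triangle _ y _).trans ((add_le_add e e').trans_eq (add_comm _ _))⟩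

lemma parClass_eq_iff {S S' : Set X} (hS : ∃ J x, IsWeylSimplexAt P B 𝒜 J x S') :
    parClass P B 𝒜 S = parClass P B 𝒜 S' ↔ Parallel P B 𝒜 S S' := by
  constructor
  · intro h
    have : S' ∈ parClass P B 𝒜 S := h ▸ ⟨hS, H.parallel_refl S'⟩
    exact this.2
  · intro h
    ext R
    exact and_congr_right fun _ => ⟨fun h' => H.parallel_trans h.symm h', fun h' => H.parallel_trans h h'⟩

lemma parallel_of_asy {f g : ModelSpace F M Λ → X} (hf : f ∈ 𝒜) (hg : g ∈ 𝒜) (h : Asy P B f g)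
    (k k' : ModelSpace F M Λ) (J : Set ι) : Parallel P B 𝒜 (sx P B f k J) (sx P B g k' J) := by
  obtain ⟨b, hb⟩ := H.asy_bounded hf hg h
  have key : ∀ u ∈ face P B J, bdist P B 𝒜 (f (k + u)) (g (k' + u)) ≤
      vnorm P B k + (b + vnorm P B k') := fun u hu => by
    refine (H.bdist_triangle _ (f u) _).trans (add_le_add ?_
      ((H.bdist_triangle _ (g u) _).trans (add_le_add (hb u (face_subset_chamber hu)) ?_)))
    · rw [H.bdist_eq hf, sub_add_cancel_right, vnorm_neg]
    · rw [H.bdist_eq hg, add_sub_cancel_right]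
  refine ⟨vnorm P B k + (b + vnorm P B k'), ?_, ?_⟩
  · rintro _ ⟨u, hu, rfl⟩
    exact ⟨_, mem_sx hu, key u hu⟩
  · rintro _ ⟨u, hu, rfl⟩
    refine ⟨_, mem_sx hu, ?_⟩
    rw [H.bdist_comm]
    exact key u hu

/-- Counterpart of `subset_and_fixes_of_small` at infinity: along a ray through a generic vector,
inequalities up to a bounded error become exact. -/
lemma subset_and_fixes_of_bounded {J J' : Set ι} (hJ : J ⊆ B) (hJ' : J' ⊆ B) {w : P.weylGroup} {b : Λ}
    (h : ∀ u ∈ face P B J, ∃ u' ∈ face P B J', vnorm P B (w • u - u') ≤ b) :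
    J' ⊆ J ∧ ∀ u ∈ face P B (Λ := Λ) J, w • u = u := by
  obtain ⟨q, hq⟩ := exists_face_vector H.basis J
  have key : ∀ l : Λ, 0 ≤ l → ∃ u' ∈ face P B J', ∀ i,
      |P.coroot' i (w • q) • l - ev P i u'| ≤ b := fun l hl => by
    obtain ⟨u', hu', hb⟩ := h _ (tmul_mem_face hJ hq hl)
    refine ⟨u', hu', fun i => ?_⟩
    have := (abs_ev_le_vnorm H.basis i _).trans hb
    rwa [TensorProduct.smul_tmul', map_sub, ev_tmul] at this
  refine subset_and_fixes H.basis hJ' hq (fun j hj => ?_) fun j hj => ?_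
  · refine H.le_of_smul_le (b := b) fun l hl => ?_
    obtain ⟨u', hu', hb⟩ := key l hl
    have h1 := (abs_le.1 (hb j)).1
    have h2 := mem_chamber_iff_simple.1 (mem_face.1 hu').1 j hj
    rw [zero_smul]
    exact h2.trans (neg_le_sub_iff_le_add.1 h1)
  · refine H.le_of_smul_le (b := b) fun l hl => ?_
    obtain ⟨u', hu', hb⟩ := key l hl
    have h1 := (abs_le.1 (hb j)).2
    rwa [(mem_face.1 hu').2 j hj, sub_zero, ← zero_add b, ← zero_smul F l] at h1

lemma parallel_delta {f g : ModelSpace F M Λ → X} (hf : f ∈ 𝒜) (hg : g ∈ 𝒜) {w : P.weylGroup}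
    (h : Delta P B 𝒜 f g w) {k k' : ModelSpace F M Λ} {J J' : Set ι} (hJ : J ⊆ B) (hJ' : J' ⊆ B)
    (hp : Parallel P B 𝒜 (sx P B f k J) (sx P B g k' J')) :
    J = J' ∧ ∀ u ∈ face P B (Λ := Λ) J, w • u = u := by
  obtain ⟨m, hm, e1, e2⟩ := h
  have hm' := H.tw_mem hm w
  obtain ⟨b, h1, h2⟩ := H.parallel_trans (H.parallel_of_asy hm hf e1.symm 0 k J)
    (H.parallel_trans hp (H.parallel_of_asy hg hm' e2 k' 0 J'))
  have key : J' ⊆ J ∧ ∀ u ∈ face P B (Λ := Λ) J, w⁻¹ • u = u := by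
    refine H.subset_and_fixes_of_bounded hJ hJ' (b := b) fun u hu => ?_
    obtain ⟨_, ⟨u', hu', rfl⟩, hb⟩ := h1 _ (mem_sx hu)
    refine ⟨u', hu', ?_⟩
    simp only [zero_add, tw_apply] at hb
    rwa [H.bdist_eq hm, ← vnorm_smul H.basis w⁻¹, smul_sub, inv_smul_smul, ← vnorm_neg, neg_sub] at hb
  have key' : J ⊆ J' ∧ ∀ u ∈ face P B (Λ := Λ) J', w • u = u := by
    refine H.subset_and_fixes_of_bounded hJ' hJ (b := b) fun u hu => ?_
    obtain ⟨_, ⟨u', hu', rfl⟩, hb⟩ := h2 _ (mem_sx hu)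
    refine ⟨u', hu', ?_⟩
    simp only [zero_add, tw_apply] at hb
    rwa [H.bdist_eq hm, ← vnorm_neg, neg_sub] at hb
  have := key'.1.antisymm key.1
  exact ⟨this, this ▸ key'.2⟩

/-! ### Representatives at a point -/

lemma exists_asy_at {f : ModelSpace F M Λ → X} (hf : f ∈ 𝒜) (x : X) :
    ∃ h ∈ 𝒜, ∃ u, Asy P B h f ∧ h u = x := by
  obtain ⟨g, hg, ⟨u, rfl⟩, -⟩ := H.building.exists_chart x x
  obtain ⟨w, hw⟩ := H.exists_delta hg hf
  obtain ⟨h, hh, u', h1, h2, -⟩ := H.exists_chamber_at hg hf hw u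
  exact ⟨h, hh, u', h1, h2⟩

lemma parClass_eq_of_asy {f g : ModelSpace F M Λ → X} (hf : f ∈ 𝒜) (hg : g ∈ 𝒜) (h : Asy P B f g)
    (k k' : ModelSpace F M Λ) {J : Set ι} (hJ : J ⊆ B) :
    parClass P B 𝒜 (sx P B f k J) = parClass P B 𝒜 (sx P B g k' J) :=
  (H.parClass_eq_iff ⟨_, _, H.isWeylSimplexAt_sx hg k' hJ⟩).2 (H.parallel_of_asy hf hg h k k' J)

lemma exists_rep {a : Set (Set X)} (ha : a ∈ infSimplices P B 𝒜) (x : X) :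
    ∃ f ∈ 𝒜, ∃ k J, J ⊆ B ∧ f k = x ∧ a = parClass P B 𝒜 (sx P B f k J) := by
  obtain ⟨J, y, S, hS, rfl⟩ := ha
  obtain ⟨hJ, f, hf, k, rfl, rfl⟩ := H.isWeylSimplexAt_iff.1 hS
  obtain ⟨h, hh, u, h1, h2⟩ := H.exists_asy_at hf x
  exact ⟨h, hh, u, J, hJ, h2, (H.parClass_eq_of_asy hh hf h1 u k hJ).symm⟩

/-- The Weyl distance fixes the common face. The chamber of `g` transported to `f k` therefore
agrees with `f` on that face, and by `asy_eq` it agrees with `g` everywhere. -/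
lemma sx_eq_of_parallel {f g : ModelSpace F M Λ → X} (hf : f ∈ 𝒜) (hg : g ∈ 𝒜)
    {k k' : ModelSpace F M Λ} {J J' : Set ι} (hJ : J ⊆ B) (hJ' : J' ⊆ B) (hk : f k = g k')
    (hp : Parallel P B 𝒜 (sx P B f k J) (sx P B g k' J')) : sx P B f k J = sx P B g k' J' := by
  obtain ⟨w, hw⟩ := H.exists_delta hf hg
  obtain ⟨rfl, h1⟩ := H.parallel_delta hf hg hw hJ hJ' hp
  obtain ⟨h, hh, u, h2, h3, h4⟩ := H.exists_chamber_at hf hg hw k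
  refine sx_congr fun q hq => ?_
  rw [← h4 q (face_subset_chamber hq) (h1 q hq)]
  exact H.asy_eq hh hg h2 (h3.trans hk) (face_subset_chamber hq)

lemma isRepAt_iff {f : ModelSpace F M Λ → X} (hf : f ∈ 𝒜) (k : ModelSpace F M Λ) {J : Set ι}
    (hJ : J ⊆ B) {S : Set X} : IsRepAt P B 𝒜 (f k) (parClass P B 𝒜 (sx P B f k J)) S ↔
      S = sx P B f k J := by
  constructor
  · rintro ⟨⟨-, hp⟩, J', hS⟩
    obtain ⟨hJ', g, hg, k', hk, rfl⟩ := H.isWeylSimplexAt_iff.1 hS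
    exact (H.sx_eq_of_parallel hf hg hJ hJ' hk.symm hp).symm
  · rintro rfl
    have := H.isWeylSimplexAt_sx hf k hJ
    exact ⟨⟨⟨_, _, this⟩, H.parallel_refl _⟩, J, this⟩

lemma proj_parClass {f : ModelSpace F M Λ → X} (hf : f ∈ 𝒜) (k : ModelSpace F M Λ) {J : Set ι}
    (hJ : J ⊆ B) : proj P B 𝒜 (f k) (parClass P B 𝒜 (sx P B f k J)) =
      germ P B 𝒜 (f k) (sx P B f k J) := by
  ext S'
  simp [proj, H.isRepAt_iff hf k hJ]

lemma existsUnique_rep {a : Set (Set X)} (ha : a ∈ infSimplices P B 𝒜) (x : X) :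
    ∃! S, IsRepAt P B 𝒜 x a S := by
  obtain ⟨f, hf, k, J, hJ, rfl, rfl⟩ := H.exists_rep ha x
  exact ⟨_, (H.isRepAt_iff hf k hJ).2 rfl, fun S hS => (H.isRepAt_iff hf k hJ).1 hS⟩

lemma exists_rep_of_boundary {f : ModelSpace F M Λ → X} (hf : f ∈ 𝒜) (k : ModelSpace F M Λ)
    {a : Set (Set X)} (ha : a ∈ boundary P B 𝒜 (Set.range f)) :
    ∃ w : P.weylGroup, ∃ J, J ⊆ B ∧ a = parClass P B 𝒜 (sx P B (tw f w) (w⁻¹ • k) J) := by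
  obtain ⟨J, x, S, hS, hr, rfl⟩ := ha
  obtain ⟨hJ, g, hg, k₀, rfl, rfl⟩ := H.isWeylSimplexAt_iff.1 hS
  obtain ⟨v, k', h1⟩ := H.exists_eq_of_subset (S := face P B J) (w := 1) (k := k₀) hg hf zero_mem_face
    fun u hu => hr (by rw [one_smul]; exact mem_sx hu)
  refine ⟨v, J, hJ, ?_⟩
  have h2 : sx P B g k₀ J = sx P B (tw f v) (v⁻¹ • k') J := sx_congr fun u hu => by
    simpa using h1 u hu
  rw [h2]
  exact H.parClass_eq_of_asy (H.tw_mem hf v) (H.tw_mem hf v) (Asy.refl _) _ _ hJ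

/-! ### Germs -/

lemma sameGerm_refl (x : X) (S : Set X) : SameGerm P B 𝒜 x S S := by
  obtain ⟨l₀, h₀⟩ := H.exists_pos
  exact ⟨l₀, h₀, fun y hy _ => hy, fun y hy _ => hy⟩

omit H in
lemma _root_.AffBuilding.SameGerm.symm {x : X} {S S' : Set X} (h : SameGerm P B 𝒜 x S S') :
    SameGerm P B 𝒜 x S' S := by
  obtain ⟨ε, hε, h1, h2⟩ := h
  exact ⟨ε, hε, h2, h1⟩

omit H in
lemma _root_.AffBuilding.SameGerm.trans {x : X} {S S' S'' : Set X} (h : SameGerm P B 𝒜 x S S')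
    (h' : SameGerm P B 𝒜 x S' S'') : SameGerm P B 𝒜 x S S'' := by
  obtain ⟨ε, hε, h1, h2⟩ := h
  obtain ⟨δ, hδ, h1', h2'⟩ := h'
  exact ⟨min ε δ, lt_min hε hδ,
    fun y hy hd => h1' y (h1 y hy (hd.trans_le (min_le_left _ _))) (hd.trans_le (min_le_right _ _)),
    fun y hy hd => h2 y (h2' y hy (hd.trans_le (min_le_right _ _))) (hd.trans_le (min_le_left _ _))⟩

lemma germ_eq_iff {x : X} {S S' : Set X} (hS : ∃ J, IsWeylSimplexAt P B 𝒜 J x S') :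
    germ P B 𝒜 x S = germ P B 𝒜 x S' ↔ SameGerm P B 𝒜 x S S' := by
  constructor
  · intro h
    have : S' ∈ germ P B 𝒜 x S := h ▸ ⟨hS, H.sameGerm_refl x S'⟩
    exact this.2
  · intro h
    ext R
    exact and_congr_right fun _ => ⟨fun h' => h.symm.trans h', fun h' => h.trans h'⟩

/-- The transition map moves small vectors of the face `J` into the face `J'`, and its inverse does
the reverse; generic small vectors already determine type and action. -/
lemma germ_sx_eq {f g : ModelSpace F M Λ → X} (hf : f ∈ 𝒜) (hg : g ∈ 𝒜) {k k' : ModelSpace F M Λ}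
    {J J' : Set ι} (hJ : J ⊆ B) (hJ' : J' ⊆ B) (hk : f k = g k')
    (h : germ P B 𝒜 (f k) (sx P B f k J) = germ P B 𝒜 (f k) (sx P B g k' J'))
    {φ : P.weylGroup} {t : ModelSpace F M Λ} (hφ : ∀ u, f u ∈ Set.range g → f u = g (φ • u + t)) :
    J = J' ∧ ∀ u ∈ face P B (Λ := Λ) J, φ • u = u := by
  obtain ⟨ε, hε, h1, h2⟩ := (H.germ_eq_iff ⟨J', hk ▸ H.isWeylSimplexAt_sx hg k' hJ'⟩).1 h
  have ht : φ • k + t = k' := H.inj hg ((hφ k ⟨k', hk.symm⟩).symm.trans hk)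
  have hφ' : ∀ u u', f (k + u) = g (k' + u') → φ • u = u' := fun u u' hu => by
    have h3 := H.inj hg ((hφ (k + u) ⟨_, hu.symm⟩).symm.trans hu)
    rw [← ht, smul_add, add_right_comm, add_right_inj] at h3
    exact h3
  have key : J' ⊆ J ∧ ∀ u ∈ face P B (Λ := Λ) J, φ • u = u := by
    refine subset_and_fixes_of_small H.basis hJ hJ' hε fun u hu hn => ?_
    obtain ⟨u', hu', he⟩ := h1 _ (mem_sx hu) (by rwa [H.bdist_eq hf, add_sub_cancel_left])
    rw [hφ' u u' he.symm]
    exact hu'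
  have key' : J ⊆ J' ∧ ∀ u ∈ face P B (Λ := Λ) J', φ⁻¹ • u = u := by
    refine subset_and_fixes_of_small H.basis hJ' hJ hε fun u hu hn => ?_
    obtain ⟨u', hu', he⟩ := h2 _ (mem_sx hu) (by rwa [hk, H.bdist_eq hg, add_sub_cancel_left])
    rw [← hφ' u' u he, inv_smul_smul]
    exact hu'
  exact ⟨key'.1.antisymm key.1, key.2⟩

lemma germ_sx_eq_of_near {f g : ModelSpace F M Λ → X} (hf : f ∈ 𝒜) (hg : g ∈ 𝒜)
    {k k' : ModelSpace F M Λ} (hk : f k = g k') {w : P.weylGroup} (h : Near P B f k 1 g k' w) :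
    germ P B 𝒜 (f k) (sx P B f k ∅) = germ P B 𝒜 (f k) (sx P B (tw g w) (w⁻¹ • k') ∅) := by
  obtain ⟨ε, hε, h⟩ := h
  have hgw := H.tw_mem hg w
  have hkw : f k = tw g w (w⁻¹ • k') := by simpa using hk
  refine (H.germ_eq_iff ⟨∅, hkw ▸ H.isWeylSimplexAt_sx hgw _ (Set.empty_subset _)⟩).2
    ⟨ε, hε, ?_, ?_⟩
  · rintro _ ⟨u, hu, rfl⟩ hd
    rw [H.bdist_eq hf, add_sub_cancel_left] at hd
    exact ⟨u, hu, by simpa using (h u hu hd).symm⟩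
  · rintro _ ⟨u, hu, rfl⟩ hd
    simp only [] at hd ⊢
    rw [hkw, H.bdist_eq hgw, add_sub_cancel_left] at hd
    exact ⟨u, hu, by simpa using h u hu hd⟩

end Setup

end Simplices

/-! ### The projection to a residue -/

section Projection

open Classical

variable {ι : Type*} {F : Subfield ℝ} {M N Λ : Type*}
  [AddCommGroup M] [Module F M] [AddCommGroup N] [Module F N]
  [AddCommGroup Λ] [LinearOrder Λ] [Module F Λ]
  {X : Type*}
  {P : RootPairing ι F M N} {B : Set ι}
  {T : AddSubgroup (ModelSpace F M Λ)} {𝒜 : Set (ModelSpace F M Λ → X)}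
  [Finite ι] [P.IsRootSystem] [IsOrderedAddMonoid Λ] [IsOrderedModule F Λ]

/-- A positive element of `Λ` exists because otherwise `Λ = 0`, the model space is trivial and so is
`T`. -/
lemma IsTranslationGroup.setup (hT : IsTranslationGroup P T) (hB : IsBasis P B)
    (hX : IsAffineBuilding P B T 𝒜) : Setup P B T 𝒜 := by
  refine ⟨hB, ?_, hX⟩
  by_contra! h
  have h0 : ∀ l : Λ, l = 0 := fun l =>
    le_antisymm (h l) (neg_nonpos.1 (h (-l)))
  have := hT.ne_bot
  refine this ((AddSubgroup.eq_bot_iff_forall _).2 fun t _ => ?_)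
  exact model_ext hB fun j _ => (h0 _).trans (h0 _).symm

lemma sx_tw_congr {f : ModelSpace F M Λ → X} {k : ModelSpace F M Λ} {v w : P.weylGroup} {J : Set ι}
    (h : ∀ u ∈ face P B (Λ := Λ) J, (w⁻¹ * v) • u = u) :
    sx P B (tw f v) (v⁻¹ • k) J = sx P B (tw f w) (w⁻¹ • k) J :=
  sx_congr fun u hu => by
    have := h u hu
    rw [mul_smul, inv_smul_eq_iff] at this
    simp [this]

namespace Setup

variable (H : Setup P B T 𝒜)
include H

/-- Comparison of a simplex of an arbitrary apartment with one of a given apartment with the same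
germ. -/
lemma sx_eq_of_germ_eq {f g : ModelSpace F M Λ → X} (hf : f ∈ 𝒜) (hg : g ∈ 𝒜) {k k' : ModelSpace F M Λ}
    {J J' : Set ι} (hJ : J ⊆ B) (hJ' : J' ⊆ B) (hk : g k' = f k) {w : P.weylGroup}
    (h : germ P B 𝒜 (f k) (sx P B g k' J') = germ P B 𝒜 (f k) (sx P B (tw f w) (w⁻¹ • k) J))
    {φ : P.weylGroup} {t : ModelSpace F M Λ} (hφ : ∀ u, g u ∈ Set.range f → g u = f (φ • u + t)) :
    J' = J ∧ sx P B (tw f φ) (φ⁻¹ • k) J = sx P B (tw f w) (w⁻¹ • k) J := by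
  obtain ⟨h1, h2⟩ := H.germ_sx_eq hg (H.tw_mem hf w) hJ' hJ (by simpa using hk) (hk ▸ h)
    (φ := w⁻¹ * φ) (t := w⁻¹ • t) fun u hu => by
      rw [range_tw] at hu
      rw [hφ u hu, tw_apply, smul_add, smul_inv_smul, smul_smul, mul_inv_cancel_left]
  subst h1
  exact ⟨rfl, sx_tw_congr h2⟩

lemma mem_infChambers_iff {f : ModelSpace F M Λ → X} (hf : f ∈ 𝒜) (k : ModelSpace F M Λ) {J : Set ι}
    (hJ : J ⊆ B) : parClass P B 𝒜 (sx P B f k J) ∈ infChambers P B 𝒜 ↔ J = ∅ := by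
  constructor
  · rintro ⟨S, ⟨x, hS⟩, h⟩
    obtain ⟨-, g, hg, k', rfl, rfl⟩ := H.isWeylSimplexAt_iff.1 hS
    obtain ⟨w, hw⟩ := H.exists_delta hf hg
    exact (H.parallel_delta hf hg hw hJ (Set.empty_subset _)
      ((H.parClass_eq_iff ⟨_, _, hS⟩).1 h)).1
  · rintro rfl
    exact ⟨_, ⟨_, H.isWeylSimplexAt_sx hf k hJ⟩, rfl⟩

lemma asy_of_parClass_eq {f g : ModelSpace F M Λ → X} (hf : f ∈ 𝒜) (hg : g ∈ 𝒜)
    {k k' : ModelSpace F M Λ} {J : Set ι} (hJ : J ⊆ B)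
    (h : parClass P B 𝒜 (sx P B f k J) = parClass P B 𝒜 (sx P B g k' ∅)) : J = ∅ ∧ Asy P B f g := by
  obtain ⟨w, hw⟩ := H.exists_delta hf hg
  obtain ⟨rfl, h2⟩ := H.parallel_delta hf hg hw hJ (Set.empty_subset _)
    ((H.parClass_eq_iff ⟨_, _, H.isWeylSimplexAt_sx hg k' (Set.empty_subset _)⟩).1 h)
  refine ⟨rfl, (H.delta_one_iff hf).1 ?_⟩
  rwa [H.eq_one_of_fixes h2] at hw

/-- If two chambers of an apartment have a representation `f`, `f ∘ w` in another apartment, they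
have Weyl distance `w`. -/
lemma eq_mul_of_parClass_eq {f g : ModelSpace F M Λ → X} (hf : f ∈ 𝒜) (hg : g ∈ 𝒜)
    {w₁ w₂ v : P.weylGroup} {k₁ k₂ l₁ l₂ : ModelSpace F M Λ} {J₁ J₂ : Set ι} (h₁ : J₁ ⊆ B) (h₂ : J₂ ⊆ B)
    (e₁ : parClass P B 𝒜 (sx P B (tw f w₁) k₁ J₁) = parClass P B 𝒜 (sx P B g l₁ ∅))
    (e₂ : parClass P B 𝒜 (sx P B (tw f w₂) k₂ J₂) = parClass P B 𝒜 (sx P B (tw g v) l₂ ∅)) :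
    J₁ = ∅ ∧ J₂ = ∅ ∧ w₂ = w₁ * v := by
  obtain ⟨r₁, a₁⟩ := H.asy_of_parClass_eq (H.tw_mem hf w₁) hg h₁ e₁
  obtain ⟨r₂, a₂⟩ := H.asy_of_parClass_eq (H.tw_mem hf w₂) (H.tw_mem hg v) h₂ e₂
  refine ⟨r₁, r₂, ?_⟩
  have := H.delta_unique (H.delta_tw hf w₁ w₂) (H.delta_congr (H.delta_self_tw hg v) a₁.symm a₂.symm)
  rw [← this, mul_inv_cancel_left]

lemma proj_tw {f : ModelSpace F M Λ → X} (hf : f ∈ 𝒜) (k : ModelSpace F M Λ) (w : P.weylGroup)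
    {J : Set ι} (hJ : J ⊆ B) :
    proj P B 𝒜 (f k) (parClass P B 𝒜 (sx P B (tw f w) (w⁻¹ • k) J)) =
      germ P B 𝒜 (f k) (sx P B (tw f w) (w⁻¹ • k) J) := by
  have h : f k = tw f w (w⁻¹ • k) := by simp
  rw [h]
  exact H.proj_parClass (H.tw_mem hf w) _ hJ

lemma proj_eq_of_parClass {f g : ModelSpace F M Λ → X} (hf : f ∈ 𝒜) (hg : g ∈ 𝒜) (h : Asy P B g f)
    (k u : ModelSpace F M Λ) {J : Set ι} (hJ : J ⊆ B) :
    proj P B 𝒜 (g u) (parClass P B 𝒜 (sx P B f k J)) = germ P B 𝒜 (g u) (sx P B g u J) := by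
  rw [← H.parClass_eq_of_asy hg hf h u k hJ, H.proj_parClass hg u hJ]

lemma mapsTo_proj {f : ModelSpace F M Λ → X} (hf : f ∈ 𝒜) (k : ModelSpace F M Λ) :
    Set.MapsTo (proj P B 𝒜 (f k)) (boundary P B 𝒜 (Set.range f)) (resSimplices P B 𝒜 (f k)) := by
  intro a ha
  obtain ⟨w, J, hJ, rfl⟩ := H.exists_rep_of_boundary hf k ha
  rw [H.proj_tw hf k w hJ]
  refine ⟨J, _, ?_, rfl⟩
  have := H.isWeylSimplexAt_sx (H.tw_mem hf w) (w⁻¹ • k) hJ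
  simpa using this

lemma injOn_proj {f : ModelSpace F M Λ → X} (hf : f ∈ 𝒜) (k : ModelSpace F M Λ) :
    Set.InjOn (proj P B 𝒜 (f k)) (boundary P B 𝒜 (Set.range f)) := by
  intro a ha b hb hab
  obtain ⟨w, J, hJ, rfl⟩ := H.exists_rep_of_boundary hf k ha
  obtain ⟨v, J', hJ', rfl⟩ := H.exists_rep_of_boundary hf k hb
  rw [H.proj_tw hf k w hJ, H.proj_tw hf k v hJ'] at hab
  obtain ⟨rfl, h⟩ := H.sx_eq_of_germ_eq hf (H.tw_mem hf w) hJ' hJ (by simp) hab (φ := w) (t := 0)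
    fun u _ => by simp
  rw [h]

lemma proj_mem_resChambers_iff {f : ModelSpace F M Λ → X} (hf : f ∈ 𝒜) (k : ModelSpace F M Λ)
    {a : Set (Set X)} (ha : a ∈ boundary P B 𝒜 (Set.range f)) :
    a ∈ infChambers P B 𝒜 ↔ proj P B 𝒜 (f k) a ∈ resChambers P B 𝒜 (f k) := by
  obtain ⟨w, J, hJ, rfl⟩ := H.exists_rep_of_boundary hf k ha
  rw [H.proj_tw hf k w hJ, H.mem_infChambers_iff (H.tw_mem hf w) _ hJ]
  constructor
  · rintro rfl
    refine ⟨_, ?_, rfl⟩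
    have := H.isWeylSimplexAt_sx (H.tw_mem hf w) (w⁻¹ • k) hJ
    simpa using this
  · rintro ⟨S, hS, h⟩
    obtain ⟨-, g, hg, k', hk, rfl⟩ := H.isWeylSimplexAt_iff.1 hS
    obtain ⟨φ, t, -, hφ⟩ := H.exists_transition hg hf hk
    exact (H.sx_eq_of_germ_eq hf hg hJ (Set.empty_subset _) hk h.symm hφ).1.symm

lemma infLE_iff {f : ModelSpace F M Λ → X} (hf : f ∈ 𝒜) (k : ModelSpace F M Λ)
    {a b : Set (Set X)} (ha : a ∈ boundary P B 𝒜 (Set.range f))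
    (hb : b ∈ boundary P B 𝒜 (Set.range f)) :
    InfLE P B 𝒜 a b ↔ ResLE P B 𝒜 (f k) (proj P B 𝒜 (f k) a) (proj P B 𝒜 (f k) b) := by
  constructor
  · rintro ⟨y, S₁, S₂, h, rfl, rfl⟩
    obtain ⟨g, hg, v, rfl, J₁, J₂, hs, hJ₁, rfl, rfl⟩ := H.isFaceAt_iff.1 h
    -- The chamber carrying both faces is moved to base point `f k`; a single chart then shows the
    -- face relation between the two germs.
    obtain ⟨m, hm, u, hmg, hu⟩ := H.exists_asy_at hg (f k)
    rw [← hu, H.proj_eq_of_parClass hg hm hmg v u hJ₁, H.proj_eq_of_parClass hg hm hmg v u (hs.trans hJ₁)]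
    exact ⟨_, _, H.isFaceAt_iff.2 ⟨m, hm, u, rfl, J₁, J₂, hs, hJ₁, rfl, rfl⟩, rfl, rfl⟩
  · rintro ⟨S₁, S₂, h, h₁, h₂⟩
    obtain ⟨w₁, I₁, hI₁, rfl⟩ := H.exists_rep_of_boundary hf k ha
    obtain ⟨w₂, I₂, hI₂, rfl⟩ := H.exists_rep_of_boundary hf k hb
    rw [H.proj_tw hf k _ hI₁] at h₁
    rw [H.proj_tw hf k _ hI₂] at h₂
    obtain ⟨g, hg, v, hv, J₁, J₂, hs, hJ₁, rfl, rfl⟩ := H.isFaceAt_iff.1 h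
    -- Conversely, the transition map carries the two faces from `g` into the apartment of `f`,
    -- where equality of germs is equality of simplices.
    obtain ⟨φ, t, -, hφ⟩ := H.exists_transition hg hf hv
    obtain ⟨rfl, e₁⟩ := H.sx_eq_of_germ_eq hf hg hI₁ hJ₁ hv h₁.symm hφ
    obtain ⟨rfl, e₂⟩ := H.sx_eq_of_germ_eq hf hg hI₂ (hs.trans hJ₁) hv h₂.symm hφ
    rw [← e₁, ← e₂]
    exact ⟨_, _, _, H.isFaceAt_iff.2 ⟨tw f φ, H.tw_mem hf φ, _, rfl, J₁, J₂, hs, hJ₁, rfl, rfl⟩, rfl, rfl⟩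

lemma infAdj_iff {f : ModelSpace F M Λ → X} (hf : f ∈ 𝒜) (k : ModelSpace F M Λ)
    {a b : Set (Set X)} (ha : a ∈ boundary P B 𝒜 (Set.range f))
    (hb : b ∈ boundary P B 𝒜 (Set.range f)) :
    InfAdj P B 𝒜 a b ↔ ResAdj P B 𝒜 (f k) (proj P B 𝒜 (f k) a) (proj P B 𝒜 (f k) b) := by
  refine and_congr ((H.injOn_proj hf k).ne_iff ha hb).symm ?_
  obtain ⟨w₁, I₁, hI₁, rfl⟩ := H.exists_rep_of_boundary hf k ha
  obtain ⟨w₂, I₂, hI₂, rfl⟩ := H.exists_rep_of_boundary hf k hb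
  rw [H.proj_tw hf k _ hI₁, H.proj_tw hf k _ hI₂]
  constructor
  · rintro ⟨y, S₁, S₂, h, h₁, h₂⟩
    obtain ⟨g, hg, v, rfl, i, hi, rfl, rfl⟩ := H.isAdjacentAt_iff.1 h
    obtain ⟨rfl, rfl, rfl⟩ := H.eq_mul_of_parClass_eq hf hg hI₁ hI₂ h₁ h₂
    refine ⟨_, _, H.isAdjacentAt_iff.2 ⟨tw f w₁, H.tw_mem hf w₁, w₁⁻¹ • k, by simp, i, hi, rfl, rfl⟩,
      rfl, ?_⟩
    rw [tw_tw, mul_inv_rev, mul_smul]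
  · rintro ⟨S₁, S₂, h, h₁, h₂⟩
    obtain ⟨g, hg, v, hv, i, hi, rfl, rfl⟩ := H.isAdjacentAt_iff.1 h
    obtain ⟨φ, t, -, hφ⟩ := H.exists_transition hg hf hv
    obtain ⟨rfl, e₁⟩ := H.sx_eq_of_germ_eq hf hg hI₁ (Set.empty_subset _) hv h₁.symm hφ
    obtain ⟨rfl, e₂⟩ := H.sx_eq_of_germ_eq hf (H.tw_mem hg (refl P i)) hI₂ (Set.empty_subset _)
      (by simpa using hv) h₂.symm (φ := φ * refl P i) (t := t) fun u hu => by
        rw [mul_smul]; exact hφ _ hu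
    rw [← e₁, ← e₂]
    refine ⟨f k, _, _, H.isAdjacentAt_iff.2 ⟨tw f φ, H.tw_mem hf φ, φ⁻¹ • k, by simp, i, hi, rfl, rfl⟩,
      rfl, ?_⟩
    rw [tw_tw, mul_inv_rev, mul_smul]

/-- An apartment which contains the chambers at infinity of two opposite chambers of another apartment
contains this apartment. -/
lemma range_subset_of_asy {f g : ModelSpace F M Λ → X} (hf : f ∈ 𝒜) (hg : g ∈ 𝒜) {w₀ : P.weylGroup}
    (h₀ : ∀ i, w₀ • i ∈ posRoots P B ↔ i ∉ posRoots P B) (h : Asy P B f g)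
    (h' : Asy P B (tw f w₀) (tw g w₀)) : Set.range f ⊆ Set.range g := by
  obtain ⟨l₀, hl₀⟩ := H.exists_pos
  obtain ⟨k, k', h⟩ := h
  obtain ⟨m, m', h'⟩ := h'
  have := (H.convex hf hg (h 0 zero_mem_chamber)).eq_univ H.basis hl₀ h₀ (k := k) (k' := w₀ • m)
    (fun u hu => ⟨_, (h u hu).symm⟩) fun u hu => ⟨w₀ • (m' + u), by
      have := h' u hu
      simp only [tw_apply, smul_add] at this ⊢
      exact this.symm⟩
  rintro _ ⟨u, rfl⟩
  exact (this ▸ Set.mem_univ u : u ∈ f ⁻¹' Set.range g)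

lemma mem_range_iff_resOpp {f : ModelSpace F M Λ → X} (hf : f ∈ 𝒜) {c d : Set (Set X)}
    (hc : c ∈ boundary P B 𝒜 (Set.range f)) (hd : d ∈ boundary P B 𝒜 (Set.range f))
    (h : InfOpp P B 𝒜 c d) (x : X) :
    x ∈ Set.range f ↔ ResOpp P B 𝒜 x (proj P B 𝒜 x c) (proj P B 𝒜 x d) := by
  obtain ⟨w₀, h₀⟩ := exists_opposition H.basis
  obtain ⟨y, S₁, S₂, hS, h₁, h₂⟩ := h
  obtain ⟨g, hg, v, rfl, rfl, rfl⟩ := (H.isOppositeAt_iff h₀).1 hS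
  constructor
  · rintro ⟨k, rfl⟩
    obtain ⟨w₁, I₁, hI₁, rfl⟩ := H.exists_rep_of_boundary hf k hc
    obtain ⟨w₂, I₂, hI₂, rfl⟩ := H.exists_rep_of_boundary hf k hd
    obtain ⟨rfl, rfl, rfl⟩ := H.eq_mul_of_parClass_eq hf hg hI₁ hI₂ h₁ h₂
    rw [H.proj_tw hf k _ hI₁, H.proj_tw hf k _ hI₂]
    refine ⟨_, _, (H.isOppositeAt_iff h₀).2 ⟨tw f w₁, H.tw_mem hf w₁, w₁⁻¹ • k, by simp, rfl, rfl⟩,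
      rfl, ?_⟩
    rw [tw_tw, mul_inv_rev, mul_smul]
  · intro hres
    obtain ⟨w₁, I₁, hI₁, rfl⟩ := H.exists_rep_of_boundary hf 0 hc
    obtain ⟨w₂, I₂, hI₂, rfl⟩ := H.exists_rep_of_boundary hf 0 hd
    obtain ⟨rfl, rfl, rfl⟩ := H.eq_mul_of_parClass_eq hf hg hI₁ hI₂ h₁ h₂
    have hf₁ := H.tw_mem hf w₁
    have hf₂ := H.tw_mem hf (w₁ * w₀)
    obtain ⟨a, ha, u₁, ha₁, rfl⟩ := H.exists_asy_at hf₁ x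
    have hΔ : Delta P B 𝒜 a (tw f (w₁ * w₀)) w₀ := by
      refine H.delta_congr (H.delta_self_tw hf₁ w₀) ha₁.symm ?_
      rw [tw_tw]
      exact Asy.refl _
    -- Here `a` represents `c` and `b` represents `d` at `x`.
    obtain ⟨b, hb, u₂, hb₁, hu, halt⟩ := H.exists_chamber_germ ha hf₂ hΔ u₁
    rw [H.proj_eq_of_parClass hf₁ ha ha₁ _ u₁ hI₁, ← hu, H.proj_eq_of_parClass hf₂ hb hb₁ _ u₂ hI₂] at hres
    -- If the whole representative of `c` lies in the apartment of `b`, that apartment has both `c`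
    -- and `d` at infinity and is contained in the given one. Otherwise oppositeness of the germs,
    -- read in the chart `b`, forces `w = w₀⁻¹`, which is not shorter than `w₀`.
    rcases halt with halt | ⟨w, hlen, hnear⟩
    · have e₁ : Asy P B (tw b w₀⁻¹) (tw f w₁) :=
        H.asy_trans ⟨w₀ • u₂, u₁, fun q hq => by simpa using (halt q hq).symm⟩ ha₁
      have e₂ : Asy P B (tw (tw b w₀⁻¹) w₀) (tw (tw f w₁) w₀) := by simpa using hb₁
      have := H.range_subset_of_asy (H.tw_mem hb _) hf₁ h₀ e₁ e₂
      rw [range_tw, range_tw] at this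
      exact hu ▸ this ⟨u₂, rfl⟩
    · obtain ⟨S₁, S₂, hopp, r₁, r₂⟩ := hres
      obtain ⟨m, hm, k, hk, rfl, rfl⟩ := (H.isOppositeAt_iff h₀).1 hopp
      rw [hu, H.germ_sx_eq_of_near ha hb hu.symm hnear, ← hu] at r₁
      obtain ⟨φ, t, -, hφ⟩ := H.exists_transition hm hb hk
      obtain ⟨-, f₁⟩ := H.germ_sx_eq hm (H.tw_mem hb w) hI₁ hI₁ (by simpa using hk)
        (hk ▸ r₁.symm) (φ := w⁻¹ * φ) (t := w⁻¹ • t) fun u hu => by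
          rw [range_tw] at hu
          rw [hφ u hu, tw_apply, smul_add, smul_inv_smul, smul_smul, mul_inv_cancel_left]
      obtain ⟨-, f₂⟩ := H.germ_sx_eq (k := w₀⁻¹ • k) (k' := u₂) (H.tw_mem hm w₀) hb hI₁ hI₁ (by simpa using hk)
        (by simpa [hk] using r₂.symm) (φ := φ * w₀) (t := t) fun u hu => by
          rw [mul_smul]; exact hφ _ hu
      have g₁ := H.eq_one_of_fixes f₁
      have g₂ := H.eq_one_of_fixes f₂
      have : w = w₀⁻¹ := by
        rw [inv_mul_eq_one.1 g₁]
        exact eq_inv_of_mul_eq_one_left g₂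
      rw [this, len_inv H.basis] at hlen
      exact absurd hlen (lt_irrefl _)

end Setup

end Projection

end AffBuilding

end

open AffBuilding in
theorem mainTheorem7
    {ι : Type*} [Finite ι] (F : Subfield ℝ) {M N : Type*}
    [AddCommGroup M] [Module F M] [AddCommGroup N] [Module F N]
    (P : RootPairing ι F M N) [P.IsRootSystem] (B : Set ι) (hB : IsBasis P B)
    {Λ : Type*} [AddCommGroup Λ] [LinearOrder Λ] [IsOrderedAddMonoid Λ]
    [Module F Λ] [IsOrderedModule F Λ]
    (T : AddSubgroup (ModelSpace F M Λ)) (hT : IsTranslationGroup P T)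
    {X : Type*} (𝒜 : Set (ModelSpace F M Λ → X)) (hX : IsAffineBuilding P B T 𝒜) :
    -- the projection is well defined: each simplex at infinity has exactly one representative
    -- based at a given point
    (∀ x : X, ∀ a ∈ infSimplices P B 𝒜, ∃! S, IsRepAt P B 𝒜 x a S) ∧
    -- opposite chambers at infinity detect their apartment
    (∀ f ∈ 𝒜, ∀ c ∈ infChambers P B 𝒜 ∩ boundary P B 𝒜 (Set.range f),
      ∀ d ∈ infChambers P B 𝒜 ∩ boundary P B 𝒜 (Set.range f), InfOpp P B 𝒜 c d →
      ∀ x : X, x ∈ Set.range f ↔ ResOpp P B 𝒜 x (proj P B 𝒜 x c) (proj P B 𝒜 x d)) ∧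
    -- the restriction of the projection to the boundary of an apartment containing `x` is an
    -- isomorphism onto its image
    (∀ f ∈ 𝒜, ∀ x ∈ Set.range f,
      Set.MapsTo (proj P B 𝒜 x) (boundary P B 𝒜 (Set.range f)) (resSimplices P B 𝒜 x) ∧
      Set.InjOn (proj P B 𝒜 x) (boundary P B 𝒜 (Set.range f)) ∧
      (∀ a ∈ boundary P B 𝒜 (Set.range f),
        (a ∈ infChambers P B 𝒜 ↔ proj P B 𝒜 x a ∈ resChambers P B 𝒜 x)) ∧
      (∀ a ∈ boundary P B 𝒜 (Set.range f), ∀ b ∈ boundary P B 𝒜 (Set.range f),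
        (InfLE P B 𝒜 a b ↔ ResLE P B 𝒜 x (proj P B 𝒜 x a) (proj P B 𝒜 x b)) ∧
        (InfAdj P B 𝒜 a b ↔ ResAdj P B 𝒜 x (proj P B 𝒜 x a) (proj P B 𝒜 x b)))) := by
  have H := hT.setup hB hX
  refine ⟨fun x a ha => H.existsUnique_rep ha x, fun f hf c hc d hd h x =>
    H.mem_range_iff_resOpp hf hc.2 hd.2 h x, ?_⟩
  rintro f hf _ ⟨k, rfl⟩
  exact ⟨H.mapsTo_proj hf k, H.injOn_proj hf k, fun a ha => H.proj_mem_resChambers_iff hf k ha,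
    fun a ha b hb => ⟨H.infLE_iff hf k ha hb, H.infAdj_iff hf k ha hb⟩⟩
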